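/- Work in the algebra $\mathbb{Q}\langle\langle \mathbf{x}_1,\mathbf{x}_2,\dots\rangle\rangle$ of formal power series in noncommuting variables, and put $[n]=\{1,\dots,n\}$, $n\ge 0$. An edge-coloured digraph $\mathbf{G}$ on $[n]$ has double edges $a\Rightarrow b$ and solid edges $a\to b$. A proper colouring is a map $\kappa:[n]\to\{1,2,\dots\}$ with $\kappa(a)\le\kappa(b)$ if $a\Rightarrow b$ and $\kappa(a)<\kappa(b)$ if $a\to b$. An enriched colouring is a map $\kappa:[n]\to\{-1\prec 1\prec -2\prec 2\prec\cdots\}$ such that $\kappa(a)\prec\kappa(b)$ or $\kappa(a)=\kappa(b)>0$ if $a\Rightarrow b$, and $\kappa(a)\prec\kappa(b)$ or $\kappa(a)=\kappa(b)<0$ if $a\to b$. Put $$\mathscr{Y}_{\mathbf{G}}=\sum_{\kappa\text{ proper}}\mathbf{x}_{\kappa(1)}\cdots\mathbf{x}_{\kappa(n)},\qquad \mathscr{F}_{\mathbf{G}}=\sum_{\kappa\text{ enriched}}\mathbf{x}_{|\kappa(1)|}\cdots\mathbf{x}_{|\kappa(n)|}.$$ For $A\subseteq[n-1]$ and a permutation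 $\sigma$ of $[n]$ with $\mathrm{Des}(\sigma)\subseteq A$ (a standard pair), let $\mathbf{G}_{(A,\sigma)}$ be the directed path $\sigma(1),\dots,\sigma(n)$ whose edge from $\sigma(i)$ to $\sigma(i+1)$ is solid if $i\in A$ and double otherwise. The functions $\mathbf{F}_{(A,\sigma)}=\mathscr{Y}_{\mathbf{G}_{(A,\sigma)}}$ over all $n\ge 0$ and all standard pairs form a basis of the space $\mathrm{NCQSym}$ of quasisymmetric functions in noncommuting variables, and $\Theta$ is the linear map on $\mathrm{NCQSym}$ with $\Theta(\mathbf{F}_{(A,\sigma)})=\mathscr{F}_{\mathbf{G}_{(A,\sigma)}}$ (the labelled descent-to-peak map). For a set partition $\pi$ of $[n]$ let $\mathbf{m}_\pi$ be the sum of all words $\mathbf{x}_{i_1}\cdots\mathbf{x}_{i_n}$ such that $i_j=i_k$ if and only if $j,k$ lie in the same block of $\pi$, and let $\mathbf{p}_\pi=\sum_\tau\mathbf{m}_\tau$ over all $\tau$ coarser than or equal to $\pi$. Let $\mathrm{NCSym}\subseteq\mathrm{NCQSym}$ be the span of all $\mathbf{m}_\pi$, $n\ge 0$. Let $Q_\pi$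 (resp. $P_\pi$) be the disjoint union of the increasing directed paths on the blocks of $\pi$, with all edges double (resp. solid); let $\mathfrak{S}_\pi$ be the group of permutations that map each block of $\pi$ to itself; let $\sigma\circ\mathbf{G}$ be $\mathbf{G}$ with each vertex $i$ renamed to $\sigma(i)$. Put $$\mathbf{h}_\pi=\sum_{\sigma\in\mathfrak{S}_\pi}\mathscr{Y}_{\sigma\circ Q_\pi},\quad \mathbf{e}_\pi=\sum_{\sigma\in\mathfrak{S}_\pi}\mathscr{Y}_{\sigma\circ P_\pi},\quad \mathbf{q}_\pi=\sum_{\sigma\in\mathfrak{S}_\pi}\mathscr{F}_{\sigma\circ Q_\pi}.$$ The $\mathbf{h}_\pi$ form a basis of $\mathrm{NCSym}$; let $\omega:\mathrm{NCSym}\to\mathrm{NCSym}$ be the linear map with $\omega(\mathbf{h}_\pi)=\mathbf{e}_\pi$. Let $\mathrm{NC}\Omega=\Theta(\mathrm{NCSym})$. Call $\pi$ odd if all its blocks have odd size. Call a set partition $\pi$ of $[n]$ connected if $n\ge 1$ and for every $0<k<n$ some block of $\pi$ meets both $\{1,\dots,k\}$ and $\{k+1,\dots,n\}$, i.e. $\pi$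 is not a shifted concatenation of set partitions of two nonempty sets $[k]$ and $[n-k]$. **Theorem.** 1. For every $n\ge 0$ and every set partition $\pi$ of $[n]$, $\mathbf{q}_\pi\in\mathrm{NCSym}$ and $\omega(\mathbf{q}_\pi)=\mathbf{q}_\pi$. 2. The $\mathbf{q}_\pi$, where $\pi$ runs over the odd set partitions of all $[n]$, $n\ge 0$, are linearly independent and form a basis of $\mathrm{NC}\Omega$. 3. $\mathrm{NC}\Omega$ is a subalgebra of the algebra of power series. As a unital associative $\mathbb{Q}$-algebra it is freely generated by the $\mathbf{p}_\pi$ with $\pi$ a connected odd set partition, and it is also freely generated by the $\mathbf{q}_\pi$ with $\pi$ a connected odd set partition. -/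

import Mathlib

namespace NCSchurQ

noncomputable section

/-! ## Formal power series in noncommuting variables -/

/-- Formal power series over `ℚ` in the noncommuting variables `x₁, x₂, …`; the value at the list
`[i₁, …, iₙ]` is the coefficient of the word `x_{i₁} ⋯ x_{iₙ}`. -/
def NCSeries : Type := List ℕ+ → ℚ

namespace NCSeries

instance : AddCommGroup NCSeries := inferInstanceAs (AddCommGroup (List ℕ+ → ℚ))
instance : Module ℚ NCSeries := inferInstanceAs (Module ℚ (List ℕ+ → ℚ))

@[ext] theorem ext {f g : NCSeries} (h : ∀ w, f w = g w) : f = g := funext h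

@[simp] theorem add_apply (f g : NCSeries) (w : List ℕ+) : (f + g) w = f w + g w := rfl
@[simp] theorem zero_apply (w : List ℕ+) : (0 : NCSeries) w = 0 := rfl
@[simp] theorem smul_apply (c : ℚ) (f : NCSeries) (w : List ℕ+) : (c • f) w = c * f w := rfl

/-- Evaluation at a word, as a linear map. -/
def coeff (w : List ℕ+) : NCSeries →ₗ[ℚ] ℚ where
  toFun f := f w
  map_add' _ _ := rfl
  map_smul' _ _ := rfl

@[simp] theorem coeff_apply (w : List ℕ+) (f : NCSeries) : coeff w f = f w := rfl

theorem sum_apply {ι : Type*} (s : Finset ι) (f : ι → NCSeries) (w : List ℕ+) :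
    (∑ i ∈ s, f i) w = ∑ i ∈ s, f i w := by
  exact map_sum (coeff w) f s

/-- The empty word. -/
instance : One NCSeries := ⟨fun w => if w = [] then 1 else 0⟩

/-- The product of power series: the coefficient of `w` is the sum of `f u * g v` over all
factorizations `w = u v` into two words. -/
instance : Mul NCSeries :=
  ⟨fun f g w => ∑ i ∈ Finset.range (w.length + 1), f (w.take i) * g (w.drop i)⟩

theorem one_def (w : List ℕ+) : (1 : NCSeries) w = if w = [] then 1 else 0 := rfl

theorem mul_def (f g : NCSeries) (w : List ℕ+) :
    (f * g) w = ∑ i ∈ Finset.range (w.length + 1), f (w.take i) * g (w.drop i) := rfl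

/-- Auxiliary: strip a fixed first letter. -/
def tail (a : ℕ+) (f : NCSeries) : NCSeries := fun w => f (a :: w)

theorem mul_nil (f g : NCSeries) : (f * g) [] = f [] * g [] := by simp [mul_def]

theorem mul_cons (f g : NCSeries) (a : ℕ+) (w : List ℕ+) :
    (f * g) (a :: w) = f [] * g (a :: w) + (tail a f * g) w := by
  rw [mul_def, List.length_cons, Finset.sum_range_succ', mul_def, add_comm]
  simp [tail]

theorem mul_assoc' (h : NCSeries) (w : List ℕ+) :
    ∀ f g : NCSeries, (f * g * h) w = (f * (g * h)) w := by
  induction w with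
  | nil => intro f g; simp [mul_nil, mul_assoc]
  | cons a w ih =>
    intro f g
    have e : tail a (f * g) = f [] • tail a g + tail a f * g := by
      ext v; simp [tail, mul_cons]
    have e2 : ((f [] • tail a g + tail a f * g) * h) w
        = f [] * (tail a g * h) w + (tail a f * g * h) w := by
      simp only [mul_def _ h, add_apply, smul_apply, add_mul, Finset.sum_add_distrib,
        Finset.mul_sum, mul_assoc]
    rw [mul_cons, e, e2, ih, mul_cons f, mul_cons g, mul_nil]
    ring

instance : Ring NCSeries :=
  { (inferInstance : AddCommGroup NCSeries) with
    mul := (· * ·)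
    one := 1
    left_distrib := fun f g h => by
      ext w; simp only [mul_def, add_apply, mul_add, Finset.sum_add_distrib]
    right_distrib := fun f g h => by
      ext w; simp only [mul_def, add_apply, add_mul, Finset.sum_add_distrib]
    zero_mul := fun f => by ext w; simp [mul_def]
    mul_zero := fun f => by ext w; simp [mul_def]
    mul_assoc := fun f g h => ext fun w => mul_assoc' h w f g
    one_mul := fun f => by
      ext w
      cases w with
      | nil => simp [mul_nil, one_def]
      | cons a w =>
        have : tail a (1 : NCSeries) = 0 := by ext v; simp [tail, one_def]
        rw [mul_cons, this]
        simp [one_def, mul_def]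
    mul_one := fun f => by
      ext w
      induction w generalizing f with
      | nil => simp [mul_nil, one_def]
      | cons a w ih => rw [mul_cons, ih]; simp [one_def, tail] }

instance : Algebra ℚ NCSeries :=
  Algebra.ofModule
    (fun c f g => by ext w; simp [mul_def, Finset.mul_sum, mul_assoc])
    (fun c f g => by ext w; simp [mul_def, Finset.mul_sum, mul_left_comm])

end NCSeries

/-- The formal sum of the words `word x` over all `x` with `P x`; it is used only when every word
arises from finitely many `x`. -/
def wordSum {X : Type} (P : X → Prop) (word : X → List ℕ+) : NCSeries :=
  fun w => (Nat.card {x : X // P x ∧ word x = w} : ℚ)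

/-! ## Edge-coloured digraphs, proper colourings and enriched colourings -/

/-- An edge-coloured digraph with vertex set `[n]` (here `{0, …, n - 1}`), with double edges
`a ⇒ b` and solid edges `a → b`. -/
structure EdgeColouredDigraph (n : ℕ) where
  double : Fin n → Fin n → Prop
  solid : Fin n → Fin n → Prop

namespace EdgeColouredDigraph

variable {n : ℕ}

/-- Proper colourings: weakly increasing along double edges, strictly along solid edges. -/
def IsProper (G : EdgeColouredDigraph n) (κ : Fin n → ℕ+) : Prop :=
  (∀ a b, G.double a b → κ a ≤ κ b) ∧ (∀ a b, G.solid a b → κ a < κ b)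

/-- The ordered set `-1 ≺ 1 ≺ -2 ≺ 2 ≺ ⋯`: the pair `(k, false)` is `-k` and `(k, true)` is `k`,
ordered lexicographically. -/
abbrev SignedColour : Type := ℕ+ ×ₗ Bool

/-- The absolute value of a signed colour. -/
def SignedColour.abs (c : SignedColour) : ℕ+ := (ofLex c).1

/-- The signed colour is positive. -/
def SignedColour.IsPos (c : SignedColour) : Prop := (ofLex c).2 = true

/-- The signed colour is negative. -/
def SignedColour.IsNeg (c : SignedColour) : Prop := (ofLex c).2 = false

/-- Enriched colourings. -/
def IsEnriched (G : EdgeColouredDigraph n) (κ : Fin n → SignedColour) : Prop :=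
  (∀ a b, G.double a b → κ a < κ b ∨ (κ a = κ b ∧ SignedColour.IsPos (κ a))) ∧
  (∀ a b, G.solid a b → κ a < κ b ∨ (κ a = κ b ∧ SignedColour.IsNeg (κ a)))

/-- The generalized chromatic function in noncommuting variables
`𝒴_G = ∑_κ x_{κ(1)} ⋯ x_{κ(n)}`, over all proper colourings `κ`. -/
def chromatic (G : EdgeColouredDigraph n) : NCSeries :=
  wordSum G.IsProper List.ofFn

/-- The enriched chromatic function in noncommuting variables
`𝓕_G = ∑_κ x_{|κ(1)|} ⋯ x_{|κ(n)|}`, over all enriched colourings `κ`. -/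
def enriched (G : EdgeColouredDigraph n) : NCSeries :=
  wordSum G.IsEnriched (fun κ => List.ofFn fun i => SignedColour.abs (κ i))

/-- The digraph `σ ∘ G`, obtained from `G` by renaming each vertex `i` to `σ i`. -/
def relabel (σ : Equiv.Perm (Fin n)) (G : EdgeColouredDigraph n) : EdgeColouredDigraph n where
  double a b := G.double (σ.symm a) (σ.symm b)
  solid a b := G.solid (σ.symm a) (σ.symm b)

/-- The directed path `σ(1), σ(2), …, σ(n)`, in which the edge from `σ(i)` to `σ(i+1)` is solid
if `i ∈ A` and double otherwise. (Positions `1, …, n` are `0, …, n - 1` in `Fin n`.) -/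
def path (A : Finset ℕ) (σ : Equiv.Perm (Fin n)) : EdgeColouredDigraph n where
  double a b := ∃ (k : ℕ) (h : k + 1 < n), k + 1 ∉ A ∧
    a = σ ⟨k, Nat.lt_of_succ_lt h⟩ ∧ b = σ ⟨k + 1, h⟩
  solid a b := ∃ (k : ℕ) (h : k + 1 < n), k + 1 ∈ A ∧
    a = σ ⟨k, Nat.lt_of_succ_lt h⟩ ∧ b = σ ⟨k + 1, h⟩

end EdgeColouredDigraph

/-! ## Set partitions -/

/-- Set partitions of `[n]`, ordered by refinement (finer `≤` coarser). -/
abbrev SetPartition (n : ℕ) : Type := Finpartition (Finset.univ : Finset (Fin n))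

namespace SetPartition

variable {n : ℕ}

/-- All blocks have odd size. -/
def IsOdd (π : SetPartition n) : Prop := ∀ B ∈ π.parts, Odd B.card

/-- `n ≥ 1`, and `π` is not a shifted concatenation `α|β` of set partitions `α` of `[k]` and `β`
of `[n - k]` with `0 < k < n`: for every such `k`, some block meets both `{1, …, k}` and
`{k + 1, …, n}`. -/
def IsConnected (π : SetPartition n) : Prop :=
  0 < n ∧ ∀ k, 0 < k → k < n → ∃ B ∈ π.parts, (∃ i ∈ B, i.val < k) ∧ ∃ j ∈ B, k ≤ j.val

open Classical in
/-- The subgroup `𝔖_π` of the permutations that map each block of `π` to itself. -/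
def youngPerms (π : SetPartition n) : Finset (Equiv.Perm (Fin n)) :=
  Finset.univ.filter fun σ => ∀ i, σ i ∈ π.part i

/-- `a < b` are consecutive elements of one block of `π`. -/
def Consecutive (π : SetPartition n) (a b : Fin n) : Prop :=
  b ∈ π.part a ∧ a < b ∧ ∀ c ∈ π.part a, ¬(a < c ∧ c < b)

/-- The digraph `Q_π`, the disjoint union of the increasing paths with double edges on the blocks
of `π`. -/
def doublePaths (π : SetPartition n) : EdgeColouredDigraph n where
  double := π.Consecutive
  solid _ _ := False

/-- The digraph `P_π`, the disjoint union of the increasing paths with solid edges on the blocks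
of `π`. -/
def solidPaths (π : SetPartition n) : EdgeColouredDigraph n where
  double _ _ := False
  solid := π.Consecutive

/-- The complete homogeneous symmetric function `h_π` in noncommuting variables. -/
def h (π : SetPartition n) : NCSeries :=
  ∑ σ ∈ π.youngPerms, (π.doublePaths.relabel σ).chromatic

/-- The elementary symmetric function `e_π` in noncommuting variables. -/
def e (π : SetPartition n) : NCSeries :=
  ∑ σ ∈ π.youngPerms, (π.solidPaths.relabel σ).chromatic

/-- The Schur `Q`-function `q_π` in noncommuting variables. -/
def q (π : SetPartition n) : NCSeries :=
  ∑ σ ∈ π.youngPerms, (π.doublePaths.relabel σ).enriched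

end SetPartition

/-! ## Standard pairs and quasisymmetric functions in noncommuting variables -/

/-- Standard pairs `(A, σ)`: `A ⊆ [n - 1]`, `σ` is a permutation of `[n]`, and every descent of
`σ` lies in `A`. They encode the set compositions of `[n]`. -/
@[ext] structure StandardPair (n : ℕ) where
  A : Finset ℕ
  σ : Equiv.Perm (Fin n)
  subset : A ⊆ Finset.Ioo 0 n
  standard : ∀ (k : ℕ) (h : k + 1 < n), σ ⟨k + 1, h⟩ < σ ⟨k, Nat.lt_of_succ_lt h⟩ → k + 1 ∈ A

namespace StandardPair

variable {n : ℕ}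

instance : Finite (StandardPair n) := by
  refine Finite.of_injective
    (β := {A : Finset ℕ // A ∈ (Finset.Ioo 0 n).powerset} × Equiv.Perm (Fin n))
    (fun φ => (⟨φ.A, Finset.mem_powerset.2 φ.subset⟩, φ.σ)) ?_
  intro φ ψ hφ
  simp only [Prod.mk.injEq, Subtype.mk.injEq] at hφ
  exact StandardPair.ext hφ.1 hφ.2

instance : Fintype (StandardPair n) := Fintype.ofFinite _

/-- The index of the block containing `j` in the set composition
`σ(1)⋯σ(a₁) | σ(a₁+1)⋯σ(a₂) | ⋯ | σ(a_k+1)⋯σ(n)` (blocks are numbered from `0`). -/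
def block (φ : StandardPair n) (j : Fin n) : ℕ :=
  (φ.A.filter fun a => a ≤ (φ.σ.symm j).val).card

open Classical in
/-- The set partition with the same blocks as the set composition of `φ`. -/
def setPartition (φ : StandardPair n) : SetPartition n :=
  Finpartition.ofSetoid (Setoid.ker φ.block)

/-- The condition that a word `x_{κ(1)} ⋯ x_{κ(n)}` occurs in `M_{(A,σ)}`. -/
def Fits (φ : StandardPair n) (κ : Fin n → ℕ+) : Prop :=
  (∀ j k, κ j = κ k ↔ φ.block j = φ.block k) ∧ (∀ j k, κ j < κ k ↔ φ.block j < φ.block k)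

/-- The monomial quasisymmetric function `M_{(A,σ)}` in noncommuting variables. -/
def M (φ : StandardPair n) : NCSeries := wordSum φ.Fits List.ofFn

/-- The fundamental quasisymmetric function `F_{(A,σ)}` in noncommuting variables. -/
def F (φ : StandardPair n) : NCSeries := (EdgeColouredDigraph.path φ.A φ.σ).chromatic

/-- The enriched fundamental function `K_{(B,σ)}`, where `B = A \ ((A + 1) ∪ {1})` is the peak set
of a chain with descent set `A`. -/
def K (φ : StandardPair n) : NCSeries := (EdgeColouredDigraph.path φ.A φ.σ).enriched

end StandardPair

/-- The space of quasisymmetric functions in noncommuting variables. -/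
def NCQSym : Submodule ℚ NCSeries :=
  Submodule.span ℚ (Set.range fun φ : (Σ n, StandardPair n) => φ.2.M)

namespace SetPartition

variable {n : ℕ}

open Classical in
/-- The monomial symmetric function `m_π` in noncommuting variables: the sum of the `M_φ` over all
set compositions `φ` with the same blocks as `π`. -/
def m (π : SetPartition n) : NCSeries :=
  ∑ φ : StandardPair n with φ.setPartition = π, φ.M

open Classical in
/-- The power sum symmetric function `p_π` in noncommuting variables: the sum of the `m_τ` over
all `τ` coarser than or equal to `π`. -/
def p (π : SetPartition n) : NCSeries := ∑ τ : SetPartition n with π ≤ τ, τ.m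

end SetPartition

/-- The space of symmetric functions in noncommuting variables. -/
def NCSym : Submodule ℚ NCSeries :=
  Submodule.span ℚ (Set.range fun π : (Σ n, SetPartition n) => π.2.m)

theorem NCSym_le_NCQSym : NCSym ≤ NCQSym := by
  refine Submodule.span_le.2 ?_
  rintro _ ⟨⟨n, π⟩, rfl⟩
  exact Submodule.sum_mem _ fun φ _ => Submodule.subset_span ⟨⟨n, φ⟩, rfl⟩

/-! ## The basis of fundamental functions -/

open Classical in
theorem wordSum_ofFn {n : ℕ} (P : (Fin n → ℕ+) → Prop) (κ : Fin n → ℕ+) :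
    wordSum P List.ofFn (List.ofFn κ) = if P κ then 1 else 0 := by
  have key : ∀ x : Fin n → ℕ+, List.ofFn x = List.ofFn κ ↔ x = κ := fun x =>
    List.ofFn_injective.eq_iff
  unfold wordSum
  simp only [key]
  split_ifs with h
  · have : Unique {x // P x ∧ x = κ} := ⟨⟨⟨κ, h, rfl⟩⟩, fun x => Subtype.ext x.2.2⟩
    simp
  · have : IsEmpty {x // P x ∧ x = κ} := ⟨fun x => h (x.2.2 ▸ x.2.1)⟩
    simp

theorem wordSum_of_length_ne {n : ℕ} (P : (Fin n → ℕ+) → Prop) {w : List ℕ+} (h : w.length ≠ n) :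
    wordSum P List.ofFn w = 0 := by
  unfold wordSum
  have : IsEmpty {x // P x ∧ List.ofFn x = w} := ⟨fun x => h (by rw [← x.2.2]; simp)⟩
  simp

/-- The series has only words of length `n`. -/
def Homogeneous (n : ℕ) (f : NCSeries) : Prop := ∀ w : List ℕ+, w.length ≠ n → f w = 0

theorem Homogeneous.sum {n : ℕ} {ι : Type*} {s : Finset ι} {f : ι → NCSeries}
    (h : ∀ i ∈ s, Homogeneous n (f i)) : Homogeneous n (∑ i ∈ s, f i) := fun w hw => by
  rw [NCSeries.sum_apply]
  exact Finset.sum_eq_zero fun i hi => h i hi w hw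

theorem Homogeneous.smul {n : ℕ} {f : NCSeries} (h : Homogeneous n f) (c : ℚ) :
    Homogeneous n (c • f) := fun w hw => by simp [h w hw]

theorem Homogeneous.ext {n : ℕ} {f g : NCSeries} (hf : Homogeneous n f) (hg : Homogeneous n g)
    (h : ∀ κ : Fin n → ℕ+, f (List.ofFn κ) = g (List.ofFn κ)) : f = g := by
  ext w
  by_cases hw : w.length = n
  · subst hw
    have := h w.get
    rwa [List.ofFn_get] at this
  · rw [hf w hw, hg w hw]

/-- A vanishing combination of homogeneous series vanishes in each degree. -/
theorem homogeneous_relation {X : ℕ → Type} [∀ n, Fintype (X n)] {f : (Σ n, X n) → NCSeries}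
    (hf : ∀ x, Homogeneous x.1 (f x)) {s : Finset (Σ n, X n)} {g : (Σ n, X n) → ℚ}
    (h : ∑ x ∈ s, g x • f x = 0) (n : ℕ) :
    ∃ c : X n → ℚ, (∀ x, (⟨n, x⟩ : Σ n, X n) ∈ s → g ⟨n, x⟩ = c x) ∧
      ∑ x, c x • f ⟨n, x⟩ = 0 := by
  classical
  refine ⟨fun x => if (⟨n, x⟩ : Σ n, X n) ∈ s then g ⟨n, x⟩ else 0, fun x hx => by simp [hx], ?_⟩
  refine Homogeneous.ext (n := n) (Homogeneous.sum fun x _ => (hf ⟨n, x⟩).smul _) (fun w _ => rfl) ?_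
  intro κ
  have h1 := congrArg (NCSeries.coeff (List.ofFn κ)) h
  rw [map_sum, map_zero] at h1
  rw [NCSeries.sum_apply, NCSeries.zero_apply]
  refine Eq.trans ?_ h1
  have h2 : ∀ x ∈ s, x ∉ s.filter (fun x => x.1 = n) →
      NCSeries.coeff (List.ofFn κ) (g x • f x) = 0 := by
    intro x hx hx'
    have : x.1 ≠ n := fun hh => hx' (Finset.mem_filter.2 ⟨hx, hh⟩)
    simp [hf x (List.ofFn κ) (by simpa using this.symm)]
  rw [← Finset.sum_subset (Finset.filter_subset _ s) h2]
  symm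
  have h3 : s.filter (fun x => x.1 = n) =
      (Finset.univ.filter fun x : X n => (⟨n, x⟩ : Σ n, X n) ∈ s).map
        (Function.Embedding.sigmaMk n) := by
    ext ⟨k, x⟩
    simp only [Finset.mem_filter, Finset.mem_map, Finset.mem_univ, true_and,
      Function.Embedding.sigmaMk_apply]
    constructor
    · rintro ⟨h, rfl⟩
      exact ⟨x, h, rfl⟩
    · rintro ⟨y, hy, he⟩
      cases he
      exact ⟨hy, rfl⟩
  rw [h3, Finset.sum_map, Finset.sum_filter]
  refine Finset.sum_congr rfl fun x _ => ?_
  by_cases hx : (⟨n, x⟩ : Σ n, X n) ∈ s <;> simp [hx]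

namespace StandardPair

variable {n : ℕ}

open Classical in
/-- The positions of the strict ascents of `c`. -/
def ascents (c : Fin n → ℕ+) : Finset ℕ :=
  (Finset.Ioo 0 n).filter fun k =>
    ∃ (j : ℕ) (h : j + 1 < n), k = j + 1 ∧ c ⟨j, Nat.lt_of_succ_lt h⟩ < c ⟨j + 1, h⟩

theorem succ_mem_ascents (c : Fin n → ℕ+) (k : ℕ) (h : k + 1 < n) :
    k + 1 ∈ ascents c ↔ c ⟨k, Nat.lt_of_succ_lt h⟩ < c ⟨k + 1, h⟩ := by
  simp only [ascents, Finset.mem_filter, Finset.mem_Ioo, Nat.succ_pos, true_and, h]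
  constructor
  · rintro ⟨j, hj, he, hlt⟩
    obtain rfl : k = j := by omega
    exact hlt
  · intro hlt
    exact ⟨k, h, rfl, hlt⟩

theorem sort_standard (κ : Fin n → ℕ+) (k : ℕ) (h : k + 1 < n)
    (hlt : Tuple.sort κ ⟨k + 1, h⟩ < Tuple.sort κ ⟨k, Nat.lt_of_succ_lt h⟩) :
    k + 1 ∈ ascents (κ ∘ Tuple.sort κ) := by
  rw [succ_mem_ascents _ k h]
  obtain ⟨h1, h2⟩ := (Tuple.eq_sort_iff (f := κ) (σ := Tuple.sort κ)).1 rfl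
  have hk : (⟨k, Nat.lt_of_succ_lt h⟩ : Fin n) < ⟨k + 1, h⟩ :=
    Fin.lt_def.2 (Nat.lt_succ_self k)
  refine lt_of_le_of_ne (h1 hk.le) fun he => ?_
  exact absurd (h2 _ _ hk he) (not_lt.2 hlt.le)

/-- The standard pair of the set composition that collects equal letters of the word `κ`. -/
def ofWord (κ : Fin n → ℕ+) : StandardPair n where
  A := ascents (κ ∘ Tuple.sort κ)
  σ := Tuple.sort κ
  subset := by classical exact Finset.filter_subset _ _
  standard := sort_standard κ

/-- Strict increase of a standard pair without elements of `A` in between. -/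
theorem lt_of_gap (φ : StandardPair n) {i : Fin n} (d : ℕ) :
    ∀ j : Fin n, j.val = i.val + d + 1 → (∀ a ∈ φ.A, i.val < a → a ≤ j.val → False) →
      φ.σ i < φ.σ j := by
  have step : ∀ (k : ℕ) (h : k + 1 < n), k + 1 ∉ φ.A →
      φ.σ ⟨k, Nat.lt_of_succ_lt h⟩ < φ.σ ⟨k + 1, h⟩ := by
    intro k h hk
    refine lt_of_le_of_ne (not_lt.1 fun hlt => hk (φ.standard k h hlt)) fun he => ?_
    have := φ.σ.injective he
    simp at this
  induction d with
  | zero =>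
    rintro ⟨j, hj⟩ hji hA
    simp only [add_zero] at hji
    subst hji
    exact step i.val hj fun hm => hA _ hm (Nat.lt_succ_self _) le_rfl
  | succ d ih =>
    rintro ⟨j, hj⟩ hji hA
    simp only at hji
    subst hji
    have hj' : i.val + d + 1 < n := by omega
    refine (ih ⟨i.val + d + 1, hj'⟩ rfl fun a ha h1 h2 => hA a ha h1 ?_).trans ?_
    · simp only at h2 ⊢; omega
    · exact step (i.val + d + 1) hj fun hm => hA _ hm (by omega) (by simp)

theorem isProper_path_iff (φ : StandardPair n) (κ : Fin n → ℕ+) :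
    (EdgeColouredDigraph.path φ.A φ.σ).IsProper κ ↔
      φ.σ = (ofWord κ).σ ∧ φ.A ⊆ (ofWord κ).A := by
  constructor
  · rintro ⟨h1, h2⟩
    have hmono : Monotone (κ ∘ φ.σ) := by
      cases n with
      | zero => exact fun a => a.elim0
      | succ n =>
        refine Fin.monotone_iff_le_succ.2 fun i => ?_
        by_cases hi : i.val + 1 ∈ φ.A
        · exact (h2 _ _ ⟨i.val, Nat.succ_lt_succ i.2, hi, rfl, rfl⟩).le
        · exact h1 _ _ ⟨i.val, Nat.succ_lt_succ i.2, hi, rfl, rfl⟩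
    have hA : ∀ (k : ℕ) (h : k + 1 < n), k + 1 ∈ φ.A →
        (κ ∘ φ.σ) ⟨k, Nat.lt_of_succ_lt h⟩ < (κ ∘ φ.σ) ⟨k + 1, h⟩ := fun k h hk =>
      h2 _ _ ⟨k, h, hk, rfl, rfl⟩
    have hσ : φ.σ = Tuple.sort κ := by
      refine Tuple.eq_sort_iff.2 ⟨hmono, fun i j hij he => ?_⟩
      refine lt_of_gap φ (j.val - i.val - 1) j (by have := Fin.lt_def.1 hij; omega) ?_
      intro a ha h3 h4
      obtain ⟨k, rfl⟩ : ∃ k, a = k + 1 := ⟨a - 1, by omega⟩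
      have hk : k + 1 < n := lt_of_le_of_lt h4 j.2
      have := hA k hk ha
      have h5 : (κ ∘ φ.σ) i ≤ (κ ∘ φ.σ) ⟨k, Nat.lt_of_succ_lt hk⟩ :=
        hmono (Fin.le_def.2 (by simp only; omega))
      have h6 : (κ ∘ φ.σ) ⟨k + 1, hk⟩ ≤ (κ ∘ φ.σ) j := hmono (Fin.le_def.2 h4)
      exact absurd he (ne_of_lt (lt_of_le_of_lt h5 (lt_of_lt_of_le this h6)))
    refine ⟨hσ, fun a ha => ?_⟩
    have ha' := Finset.mem_Ioo.1 (φ.subset ha)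
    obtain ⟨k, rfl⟩ : ∃ k, a = k + 1 := ⟨a - 1, by omega⟩
    refine (succ_mem_ascents _ k ha'.2).2 ?_
    rw [← hσ]
    exact hA k ha'.2 ha
  · rintro ⟨hσ, hA⟩
    have hmono : Monotone (κ ∘ φ.σ) := by rw [hσ]; exact Tuple.monotone_sort κ
    constructor
    · rintro a b ⟨k, h, hk, rfl, rfl⟩
      exact hmono (Fin.le_def.2 (Nat.le_succ k))
    · rintro a b ⟨k, h, hk, rfl, rfl⟩
      have := (succ_mem_ascents _ k h).1 (hA hk)
      change (κ ∘ Tuple.sort κ) _ < (κ ∘ Tuple.sort κ) _ at this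
      have hs : φ.σ = Tuple.sort κ := hσ
      rw [hs]
      exact this

theorem block_mono (φ : StandardPair n) {i j : Fin n} (h : i ≤ j) :
    φ.block (φ.σ i) ≤ φ.block (φ.σ j) := by
  unfold block
  refine Finset.card_le_card fun a ha => ?_
  simp only [Equiv.symm_apply_apply, Finset.mem_filter] at ha ⊢
  exact ⟨ha.1, ha.2.trans h⟩

theorem block_lt (φ : StandardPair n) {i j : Fin n} {a : ℕ} (ha : a ∈ φ.A) (h1 : i.val < a)
    (h2 : a ≤ j.val) : φ.block (φ.σ i) < φ.block (φ.σ j) := by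
  unfold block
  refine Finset.card_lt_card (Finset.ssubset_iff_of_subset ?_ |>.2 ⟨a, ?_, ?_⟩)
  · intro b hb
    simp only [Equiv.symm_apply_apply, Finset.mem_filter] at hb ⊢
    exact ⟨hb.1, by omega⟩
  · simp [ha, h2]
  · simp [ha, h1]

theorem block_eq (φ : StandardPair n) {i j : Fin n} (hij : i ≤ j)
    (h : ∀ a ∈ φ.A, i.val < a → a ≤ j.val → False) : φ.block (φ.σ i) = φ.block (φ.σ j) := by
  unfold block
  congr 1
  ext a
  simp only [Equiv.symm_apply_apply, Finset.mem_filter, and_congr_right_iff]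
  intro ha
  refine ⟨fun h1 => h1.trans hij, fun h1 => ?_⟩
  by_contra h2
  exact h a ha (not_le.1 h2) h1

theorem fits_of_lt_iff (φ : StandardPair n) (κ : Fin n → ℕ+)
    (h : ∀ j k, κ j < κ k ↔ φ.block j < φ.block k) : φ.Fits κ := by
  refine ⟨fun j k => ?_, h⟩
  have h1 := h j k
  have h2 := h k j
  constructor
  · intro he
    rw [he] at h1 h2
    have h3 := mt h1.2 (lt_irrefl _)
    have h4 := mt h2.2 (lt_irrefl _)
    omega
  · intro he
    rw [he] at h1 h2
    exact le_antisymm (not_lt.1 fun h3 => lt_irrefl _ (h2.1 h3))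
      (not_lt.1 fun h3 => lt_irrefl _ (h1.1 h3))

theorem fits_iff (φ : StandardPair n) (κ : Fin n → ℕ+) : φ.Fits κ ↔ φ = ofWord κ := by
  constructor
  · rintro ⟨h1, h2⟩
    have hmono : Monotone (κ ∘ φ.σ) := fun i j hij =>
      not_lt.1 fun hlt => absurd ((h2 _ _).1 hlt) (not_lt.2 (φ.block_mono hij))
    have hσ : φ.σ = Tuple.sort κ := by
      refine Tuple.eq_sort_iff.2 ⟨hmono, fun i j hij he => ?_⟩
      refine lt_of_gap φ (j.val - i.val - 1) j (by have := Fin.lt_def.1 hij; omega) ?_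
      intro a ha h3 h4
      exact absurd ((h1 _ _).1 he) (ne_of_lt (φ.block_lt ha h3 h4))
    refine StandardPair.ext (Finset.ext fun a => ?_) hσ
    have key : ∀ (k : ℕ) (h : k + 1 < n), k + 1 ∈ φ.A ↔
        κ (φ.σ ⟨k, Nat.lt_of_succ_lt h⟩) < κ (φ.σ ⟨k + 1, h⟩) := by
      intro k h
      rw [h2]
      constructor
      · intro hk
        exact φ.block_lt hk (Nat.lt_succ_self k) le_rfl
      · intro hlt
        by_contra hk
        refine absurd (φ.block_eq (i := ⟨k, Nat.lt_of_succ_lt h⟩) (j := ⟨k + 1, h⟩)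
          (Fin.le_def.2 (Nat.le_succ k)) fun a ha h3 h4 => ?_) (ne_of_lt hlt)
        simp only at h3 h4
        obtain rfl : a = k + 1 := by omega
        exact hk ha
    have key2 : ∀ a, a ∈ φ.A ∨ a ∈ (ofWord κ).A → ∃ k, a = k + 1 ∧ k + 1 < n := by
      intro a ha
      have ha' := Finset.mem_Ioo.1 (ha.elim (fun h => φ.subset h) fun h => (ofWord κ).subset h)
      exact ⟨a - 1, by omega, by omega⟩
    have key3 : ∀ (k : ℕ) (_ : k + 1 < n), k + 1 ∈ φ.A ↔ k + 1 ∈ (ofWord κ).A := by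
      intro k h
      rw [key k h, hσ]
      exact (succ_mem_ascents (κ ∘ Tuple.sort κ) k h).symm
    constructor
    · intro ha
      obtain ⟨k, rfl, hk⟩ := key2 a (Or.inl ha)
      exact (key3 k hk).1 ha
    · intro ha
      obtain ⟨k, rfl, hk⟩ := key2 a (Or.inr ha)
      exact (key3 k hk).2 ha
  · rintro rfl
    have hmono := Tuple.monotone_sort κ
    have gap : ∀ (i : Fin n) (d : ℕ) (j : Fin n), j.val = i.val + d →
        (κ ∘ Tuple.sort κ) i < (κ ∘ Tuple.sort κ) j →
        (ofWord κ).block ((ofWord κ).σ i) < (ofWord κ).block ((ofWord κ).σ j) := by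
      intro i d
      induction d with
      | zero =>
        intro j hj hlt
        have : j = i := Fin.ext hj
        subst this
        exact absurd hlt (lt_irrefl _)
      | succ d ih =>
        rintro ⟨j, hj⟩ he hlt
        simp only at he
        subst he
        have hj' : i.val + d < n := by omega
        by_cases hd : i.val + d + 1 ∈ (ofWord κ).A
        · exact block_lt _ hd (by omega) (by simp)
        · have h3 := mt (succ_mem_ascents _ (i.val + d) hj).2 hd
          refine lt_of_lt_of_le (ih ⟨i.val + d, hj'⟩ rfl
            (lt_of_lt_of_le hlt (not_lt.1 h3))) ((ofWord κ).block_mono ?_)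
          exact Fin.le_def.2 (by simp only; omega)
    have up : ∀ i j : Fin n, κ ((ofWord κ).σ i) < κ ((ofWord κ).σ j) →
        (ofWord κ).block ((ofWord κ).σ i) < (ofWord κ).block ((ofWord κ).σ j) := by
      intro i j hlt
      have hij : i ≤ j := not_lt.1 fun h => absurd (hmono h.le) (not_le.2 hlt)
      exact gap i (j.val - i.val) j (by have := Fin.le_def.1 hij; omega) hlt
    have eqv : ∀ i j : Fin n, i ≤ j → κ ((ofWord κ).σ i) = κ ((ofWord κ).σ j) →
        (ofWord κ).block ((ofWord κ).σ i) = (ofWord κ).block ((ofWord κ).σ j) := by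
      intro i j hij he
      refine (ofWord κ).block_eq hij fun a ha h1 h2 => ?_
      obtain ⟨k, rfl⟩ : ∃ k, a = k + 1 := ⟨a - 1, by omega⟩
      have hk : k + 1 < n := lt_of_le_of_lt h2 j.2
      have h3 := (succ_mem_ascents _ k hk).1 ha
      have h5 : (κ ∘ Tuple.sort κ) i ≤ (κ ∘ Tuple.sort κ) ⟨k, Nat.lt_of_succ_lt hk⟩ :=
        hmono (Fin.le_def.2 (by simp only; omega))
      have h6 : (κ ∘ Tuple.sort κ) ⟨k + 1, hk⟩ ≤ (κ ∘ Tuple.sort κ) j := hmono (Fin.le_def.2 h2)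
      exact absurd he (ne_of_lt (lt_of_le_of_lt h5 (lt_of_lt_of_le h3 h6)))
    refine fits_of_lt_iff _ _ fun j k => ?_
    obtain ⟨i, rfl⟩ := (ofWord κ).σ.surjective j
    obtain ⟨l, rfl⟩ := (ofWord κ).σ.surjective k
    refine ⟨up i l, fun hlt => ?_⟩
    by_contra hn
    rcases (not_lt.1 hn).lt_or_eq with h | h
    · exact absurd (up _ _ h) (not_lt.2 hlt.le)
    · rcases le_total i l with hil | hil
      · exact absurd (eqv _ _ hil h.symm) (ne_of_lt hlt)
      · exact absurd (eqv _ _ hil h).symm (ne_of_lt hlt)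

/-- Every standard pair comes from a word. -/
theorem exists_ofWord (φ : StandardPair n) : ∃ κ, ofWord κ = φ := by
  refine ⟨fun j => Nat.succPNat (φ.block j), ?_⟩
  refine ((φ.fits_iff _).1 (φ.fits_of_lt_iff _ fun j k => ?_)).symm
  rw [← PNat.coe_lt_coe]
  simp

open Classical in
theorem F_ofFn (φ : StandardPair n) (κ : Fin n → ℕ+) :
    φ.F (List.ofFn κ) = if φ.σ = (ofWord κ).σ ∧ φ.A ⊆ (ofWord κ).A then 1 else 0 := by
  unfold F EdgeColouredDigraph.chromatic
  rw [wordSum_ofFn]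
  simp only [isProper_path_iff]

open Classical in
theorem M_ofFn (φ : StandardPair n) (κ : Fin n → ℕ+) :
    φ.M (List.ofFn κ) = if φ = ofWord κ then 1 else 0 := by
  unfold M
  rw [wordSum_ofFn]
  simp only [fits_iff]

theorem F_homogeneous (φ : StandardPair n) : Homogeneous n φ.F :=
  fun _ hw => wordSum_of_length_ne _ hw

theorem M_homogeneous (φ : StandardPair n) : Homogeneous n φ.M :=
  fun _ hw => wordSum_of_length_ne _ hw

open Classical in
theorem F_eq_sum (φ : StandardPair n) :
    φ.F = ∑ ψ : StandardPair n with φ.σ = ψ.σ ∧ φ.A ⊆ ψ.A, ψ.M := by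
  refine Homogeneous.ext φ.F_homogeneous (Homogeneous.sum fun ψ _ => ψ.M_homogeneous) fun κ => ?_
  rw [F_ofFn, NCSeries.sum_apply]
  simp only [M_ofFn]
  rw [Finset.sum_ite_eq']
  simp

theorem linearIndependent_F :
    LinearIndependent ℚ (fun φ : (Σ n, StandardPair n) => φ.2.F) := by
  classical
  rw [linearIndependent_iff']
  rintro s g hs ⟨n, φ⟩ hφ
  obtain ⟨c, hc, h0⟩ := homogeneous_relation (fun x => x.2.F_homogeneous) hs n
  rw [hc φ hφ]
  clear hc hφ
  suffices ∀ (N : ℕ) (φ : StandardPair n), φ.A.card = N → c φ = 0 from this _ φ rfl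
  intro N
  induction N using Nat.strong_induction_on with
  | _ N ih =>
    rintro φ rfl
    obtain ⟨κ, hκ⟩ := φ.exists_ofWord
    have h1 := congrArg (NCSeries.coeff (List.ofFn κ)) h0
    rw [map_sum, map_zero, Finset.sum_eq_single φ] at h1
    · simpa [F_ofFn, hκ] using h1
    · intro ψ _ hne
      simp only [map_smul, NCSeries.coeff_apply, F_ofFn, hκ, smul_eq_mul]
      split_ifs with hh
      · rw [ih ψ.A.card (Finset.card_lt_card (lt_of_le_of_ne hh.2 fun he =>
          hne (StandardPair.ext he hh.1))) ψ rfl, zero_mul]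
      · simp
    · simp

theorem span_F : Submodule.span ℚ (Set.range fun φ : (Σ n, StandardPair n) => φ.2.F) = NCQSym := by
  classical
  apply le_antisymm
  · refine Submodule.span_le.2 ?_
    rintro _ ⟨⟨n, φ⟩, rfl⟩
    change φ.F ∈ NCQSym
    rw [F_eq_sum]
    exact Submodule.sum_mem _ fun ψ _ => Submodule.subset_span ⟨⟨n, ψ⟩, rfl⟩
  · refine Submodule.span_le.2 ?_
    rintro _ ⟨⟨n, φ⟩, rfl⟩
    change φ.M ∈ _
    suffices ∀ (N : ℕ) (φ : StandardPair n), n - φ.A.card = N →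
        φ.M ∈ Submodule.span ℚ (Set.range fun φ : (Σ n, StandardPair n) => φ.2.F) from
      this _ φ rfl
    intro N
    induction N using Nat.strong_induction_on with
    | _ N ih =>
      rintro φ rfl
      have h1 := F_eq_sum φ
      rw [← Finset.add_sum_erase _ _ (a := φ) (by simp)] at h1
      rw [← sub_eq_iff_eq_add.2 h1]
      refine Submodule.sub_mem _ (Submodule.subset_span ⟨⟨n, φ⟩, rfl⟩)
        (Submodule.sum_mem _ fun ψ hψ => ih _ ?_ ψ rfl)
      simp only [Finset.mem_erase, Finset.mem_filter, Finset.mem_univ, true_and] at hψ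
      have h2 : φ.A.card < ψ.A.card := Finset.card_lt_card
        (lt_of_le_of_ne hψ.2.2 fun he => hψ.1 (StandardPair.ext he.symm hψ.2.1.symm))
      have h3 := Finset.card_le_card ψ.subset
      rw [Nat.card_Ioo] at h3
      omega

end StandardPair

/-- The basis of `NCQSym` consisting of the fundamental functions `F_{(A,σ)}`. -/
def fundamentalBasis : Module.Basis (Σ n, StandardPair n) ℚ NCQSym :=
  (Module.Basis.span StandardPair.linearIndependent_F).map
    (LinearEquiv.ofEq _ _ StandardPair.span_F)

theorem fundamentalBasis_apply (φ : Σ n, StandardPair n) :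
    (fundamentalBasis φ : NCSeries) = φ.2.F := by
  simp [fundamentalBasis, Module.Basis.span_apply]

/-- The labelled descent-to-peak map, the linear map with `F_{(A,σ)} ↦ K_{(B,σ)}` for all standard
pairs `(A, σ)`, where `B = A \ ((A + 1) ∪ {1})`. -/
def theta : NCQSym →ₗ[ℚ] NCSeries := fundamentalBasis.constr ℚ fun φ => φ.2.K

theorem theta_F (φ : Σ n, StandardPair n) : theta (fundamentalBasis φ) = φ.2.K := by
  simp [theta]

/-- The space of Schur `Q`-functions in noncommuting variables: the image of the restriction of
the labelled descent-to-peak map to symmetric functions. -/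
def NCOmega : Submodule ℚ NCSeries :=
  LinearMap.range (theta ∘ₗ Submodule.inclusion NCSym_le_NCQSym)

/-! ## The basis of complete homogeneous functions and the involution `ω` -/

namespace SetPartition

variable {n : ℕ}

theorem mem_part_iff (π : SetPartition n) {i j : Fin n} : j ∈ π.part i ↔ π.part j = π.part i :=
  π.mem_part_iff_part_eq_part (Finset.mem_univ _) (Finset.mem_univ _)

theorem le_iff (π τ : SetPartition n) :
    π ≤ τ ↔ ∀ i j, π.part j = π.part i → τ.part j = τ.part i := by
  constructor
  · intro h i j hij
    obtain ⟨C, hC, hle⟩ := h (π.part_mem.2 (Finset.mem_univ i))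
    have hi : i ∈ C := hle (π.mem_part (Finset.mem_univ i))
    have hj : j ∈ C := hle (π.mem_part_iff.2 hij)
    rw [τ.part_eq_of_mem hC hi, τ.part_eq_of_mem hC hj]
  · intro h B hB
    obtain ⟨i, hi⟩ := π.nonempty_of_mem_parts hB
    refine ⟨τ.part i, τ.part_mem.2 (Finset.mem_univ i), fun j hj => τ.mem_part_iff.2 (h i j ?_)⟩
    rw [π.part_eq_of_mem hB hi, π.part_eq_of_mem hB hj]

theorem ext_of_part {π τ : SetPartition n}
    (h : ∀ i j, π.part j = π.part i ↔ τ.part j = τ.part i) : π = τ :=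
  le_antisymm ((le_iff _ _).2 fun i j => (h i j).1) ((le_iff _ _).2 fun i j => (h i j).2)

theorem mem_youngPerms (π : SetPartition n) (σ : Equiv.Perm (Fin n)) :
    σ ∈ π.youngPerms ↔ ∀ i, π.part (σ i) = π.part i := by
  simp [youngPerms, mem_part_iff]

open Classical in
/-- The set partition of the positions of a word by equality of letters. -/
def ker (κ : Fin n → ℕ+) : SetPartition n := Finpartition.ofSetoid (Setoid.ker κ)

theorem part_ofSetoid {X : Type} (f : Fin n → X) [DecidableRel (Setoid.ker f).r] (i j : Fin n) :
    (Finpartition.ofSetoid (Setoid.ker f)).part j = (Finpartition.ofSetoid (Setoid.ker f)).part i ↔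
      f i = f j := by
  rw [← Finpartition.mem_part_iff_part_eq_part _ (Finset.mem_univ _) (Finset.mem_univ _),
    Finpartition.mem_part_ofSetoid_iff_rel]
  exact Iff.rfl

theorem part_ker (κ : Fin n → ℕ+) (i j : Fin n) :
    (ker κ).part j = (ker κ).part i ↔ κ i = κ j := by
  classical
  exact part_ofSetoid κ i j

theorem setPartition_ofWord (κ : Fin n → ℕ+) :
    (StandardPair.ofWord κ).setPartition = ker κ := by
  classical
  refine ext_of_part fun i j => ?_
  rw [part_ker, (((StandardPair.ofWord κ).fits_iff κ).2 rfl).1 i j]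
  exact part_ofSetoid _ i j

theorem exists_ker (τ : SetPartition n) : ∃ κ : Fin n → ℕ+, ker κ = τ := by
  refine ⟨fun i => Nat.succPNat (Encodable.encode (τ.part i)), ext_of_part fun i j => ?_⟩
  rw [part_ker, Nat.succPNat_inj, Encodable.encode_inj, eq_comm]

open Classical in
theorem m_ofFn (π : SetPartition n) (κ : Fin n → ℕ+) :
    π.m (List.ofFn κ) = if ker κ = π then 1 else 0 := by
  unfold m
  rw [NCSeries.sum_apply]
  simp only [StandardPair.M_ofFn]
  rw [Finset.sum_ite_eq']
  simp [setPartition_ofWord]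

theorem m_homogeneous (π : SetPartition n) : Homogeneous n π.m :=
  Homogeneous.sum fun φ _ => φ.M_homogeneous

/-- A homogeneous series whose coefficients depend only on which letters are equal. -/
theorem eq_sum_m {f : NCSeries} (hf : Homogeneous n f) (g : SetPartition n → ℚ)
    (h : ∀ κ : Fin n → ℕ+, f (List.ofFn κ) = g (ker κ)) : f = ∑ τ : SetPartition n, g τ • τ.m := by
  classical
  refine Homogeneous.ext hf (Homogeneous.sum fun τ _ => τ.m_homogeneous.smul _) fun κ => ?_
  rw [h, NCSeries.sum_apply]
  simp [m_ofFn]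

/-- A transitive relation along consecutive elements holds for all pairs in a block. -/
theorem consecutive_chain (π : SetPartition n) (r : Fin n → Fin n → Prop)
    (hr : ∀ a b c, r a b → r b c → r a c) (h : ∀ a b, π.Consecutive a b → r a b) :
    ∀ a b, π.part b = π.part a → a < b → r a b := by
  suffices ∀ (d : ℕ) (a b : Fin n), b.val - a.val = d → π.part b = π.part a → a < b → r a b from
    fun a b => this _ a b rfl
  intro d
  induction d using Nat.strong_induction_on with
  | _ d ih =>
    rintro a b rfl hab hlt
    by_cases hc : ∃ c ∈ π.part a, a < c ∧ c < b
    · obtain ⟨c, hc, h1, h2⟩ := hc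
      rw [mem_part_iff] at hc
      rw [Fin.lt_def] at h1 h2 hlt
      exact hr a c b (ih _ (by omega) a c rfl hc h1) (ih _ (by omega) c b rfl (by rw [hab, hc]) h2)
    · push Not at hc
      exact h a b ⟨π.mem_part_iff.2 hab, hlt, fun c hc' h' => absurd h'.2 (not_lt.2 (hc c hc' h'.1))⟩

theorem consecutive_part {π : SetPartition n} {a b : Fin n} (h : π.Consecutive a b) :
    π.part b = π.part a := π.mem_part_iff.1 h.1

theorem isProper_doublePaths (π : SetPartition n) (σ : Equiv.Perm (Fin n)) (κ : Fin n → ℕ+) :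
    (π.doublePaths.relabel σ).IsProper κ ↔
      ∀ a b, π.part b = π.part a → a < b → κ (σ a) ≤ κ (σ b) := by
  constructor
  · rintro ⟨h, -⟩
    refine consecutive_chain π (fun a b => κ (σ a) ≤ κ (σ b)) (fun _ _ _ => le_trans) ?_
    intro a b hab
    refine h _ _ ?_
    change π.Consecutive _ _
    simpa using hab
  · intro h
    refine ⟨fun a b hab => ?_, fun a b hab => hab.elim⟩
    change π.Consecutive _ _ at hab
    simpa using h _ _ (consecutive_part hab) hab.2.1

theorem isProper_solidPaths (π : SetPartition n) (σ : Equiv.Perm (Fin n)) (κ : Fin n → ℕ+) :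
    (π.solidPaths.relabel σ).IsProper κ ↔
      ∀ a b, π.part b = π.part a → a < b → κ (σ a) < κ (σ b) := by
  constructor
  · rintro ⟨-, h⟩
    refine consecutive_chain π (fun a b => κ (σ a) < κ (σ b)) (fun _ _ _ => lt_trans) ?_
    intro a b hab
    refine h _ _ ?_
    change π.Consecutive _ _
    simpa using hab
  · intro h
    refine ⟨fun a b hab => hab.elim, fun a b hab => ?_⟩
    change π.Consecutive _ _ at hab
    simpa using h _ _ (consecutive_part hab) hab.2.1

theorem exists_sorting (π : SetPartition n) (κ : Fin n → ℕ+) :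
    ∃ σ ∈ π.youngPerms, ∀ a b, π.part b = π.part a → a < b → κ (σ a) ≤ κ (σ b) := by
  have hne : π.youngPerms.Nonempty := ⟨1, by simp [mem_youngPerms]⟩
  obtain ⟨σ, hσ, hmin⟩ := Finset.exists_min_image π.youngPerms
    (fun σ => toLex (fun i => κ (σ i))) hne
  refine ⟨σ, hσ, fun a b hab hlt => ?_⟩
  by_contra hn
  have h1 : σ * Equiv.swap a b ∈ π.youngPerms := by
    rw [mem_youngPerms] at hσ ⊢
    intro i
    rw [Equiv.Perm.mul_apply, hσ]
    rcases eq_or_ne i a with rfl | ha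
    · rw [Equiv.swap_apply_left, hab]
    · rcases eq_or_ne i b with rfl | hb
      · rw [Equiv.swap_apply_right, hab]
      · rw [Equiv.swap_apply_of_ne_of_ne ha hb]
  refine absurd (hmin _ h1) (not_le.2 ?_)
  refine ⟨a, fun j hj => ?_, ?_⟩
  · change κ (σ (Equiv.swap a b j)) = κ (σ j)
    rw [Equiv.swap_apply_of_ne_of_ne hj.ne (hj.trans hlt).ne]
  · change κ (σ (Equiv.swap a b a)) < κ (σ a)
    rw [Equiv.swap_apply_left]
    exact not_le.1 hn

theorem sorting_le (π : SetPartition n) {κ : Fin n → ℕ+} {σ τ : Equiv.Perm (Fin n)}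
    (hσ : σ ∈ π.youngPerms) (hτ : τ ∈ π.youngPerms)
    (h1 : ∀ a b, π.part b = π.part a → a < b → κ (σ a) ≤ κ (σ b))
    (h2 : ∀ a b, π.part b = π.part a → a < b → κ (τ a) ≤ κ (τ b)) (i : Fin n) :
    κ (τ i) ≤ κ (σ i) := by
  classical
  by_contra hn
  have hn := not_le.1 hn
  rw [mem_youngPerms] at hσ hτ
  have hcard : ∀ ρ : Equiv.Perm (Fin n), (∀ i, π.part (ρ i) = π.part i) →
      (Finset.univ.filter fun j => π.part j = π.part i ∧ κ (ρ j) < κ (τ i)).card =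
      (Finset.univ.filter fun j => π.part j = π.part i ∧ κ j < κ (τ i)).card := by
    intro ρ hρ
    refine Finset.card_equiv ρ fun j => ?_
    simp [hρ j]
  have hlt : (Finset.univ.filter fun j => π.part j = π.part i ∧ κ (τ j) < κ (τ i)).card <
      (Finset.univ.filter fun j => π.part j = π.part i ∧ κ (σ j) < κ (τ i)).card := by
    refine Finset.card_lt_card (Finset.ssubset_iff_of_subset ?_ |>.2 ⟨i, by simpa using hn, by simp⟩)
    intro j hj
    simp only [Finset.mem_filter, Finset.mem_univ, true_and] at hj ⊢
    refine ⟨hj.1, ?_⟩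
    have hji : j < i := by
      by_contra h
      rcases (not_lt.1 h).eq_or_lt with rfl | h
      · exact lt_irrefl _ hj.2
      · exact absurd hj.2 (not_lt.2 (h2 i j hj.1 h))
    exact lt_of_le_of_lt (h1 j i hj.1.symm hji) hn
  rw [hcard σ hσ, hcard τ hτ] at hlt
  exact lt_irrefl _ hlt

open Classical in
theorem h_ofFn (π : SetPartition n) (κ : Fin n → ℕ+) :
    π.h (List.ofFn κ) = ((π.youngPerms ∩ (ker κ).youngPerms).card : ℚ) := by
  obtain ⟨ρ, hρ, hs⟩ := exists_sorting π κ
  have e1 : π.h (List.ofFn κ) = ((π.youngPerms.filter fun σ =>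
      ∀ a b, π.part b = π.part a → a < b → κ (σ a) ≤ κ (σ b)).card : ℚ) := by
    unfold h
    rw [NCSeries.sum_apply, Finset.card_filter, Nat.cast_sum]
    refine Finset.sum_congr rfl fun σ _ => ?_
    unfold EdgeColouredDigraph.chromatic
    rw [wordSum_ofFn]
    simp [isProper_doublePaths]
  rw [e1]
  congr 1
  refine Finset.card_equiv (Equiv.mulRight ρ⁻¹) fun σ => ?_
  have hρ' := (mem_youngPerms _ _).1 hρ
  simp only [Finset.mem_filter, Finset.mem_inter, mem_youngPerms, Equiv.coe_mulRight,
    Equiv.Perm.mul_apply, part_ker]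
  have hi1 : ∀ i, ρ (ρ⁻¹ i) = i := ρ.apply_symm_apply
  have hi2 : ∀ i, ρ⁻¹ (ρ i) = i := ρ.symm_apply_apply
  have hinv : ∀ i, π.part (ρ⁻¹ i) = π.part i := fun i => by
    rw [← hρ' (ρ⁻¹ i), hi1]
  constructor
  · rintro ⟨h1, h2⟩
    refine ⟨fun i => by rw [h1, hinv], fun i => ?_⟩
    have h3 := sorting_le π ((mem_youngPerms _ _).2 h1) hρ h2 hs (ρ⁻¹ i)
    have h4 := sorting_le π hρ ((mem_youngPerms _ _).2 h1) hs h2 (ρ⁻¹ i)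
    rw [hi1] at h3 h4
    exact le_antisymm h3 h4
  · rintro ⟨h1, h2⟩
    have h3 : ∀ i, π.part (σ i) = π.part i := fun i => by
      have := h1 (ρ i)
      rwa [hi2, hρ'] at this
    have h4 : ∀ i, κ (σ i) = κ (ρ i) := fun i => by
      have := h2 (ρ i)
      rw [hi2] at this
      exact this.symm
    exact ⟨h3, fun a b hab hlt => by rw [h4, h4]; exact hs a b hab hlt⟩

open Classical in
theorem e_ofFn (π : SetPartition n) (κ : Fin n → ℕ+) :
    π.e (List.ofFn κ) = if ∀ a b, π.part b = π.part a → (ker κ).part b = (ker κ).part a → a = b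
      then ((π.youngPerms ∩ (ker κ).youngPerms).card : ℚ) else 0 := by
  have e1 : ∀ σ ∈ π.youngPerms, (π.solidPaths.relabel σ).chromatic (List.ofFn κ) =
      if ∀ a b, π.part b = π.part a → (ker κ).part b = (ker κ).part a → a = b then
        (π.doublePaths.relabel σ).chromatic (List.ofFn κ) else 0 := by
    intro σ hσ
    have hσ' := (mem_youngPerms _ _).1 hσ
    unfold EdgeColouredDigraph.chromatic
    rw [wordSum_ofFn, wordSum_ofFn]
    simp only [isProper_doublePaths, isProper_solidPaths, part_ker]
    by_cases hi : ∀ a b, π.part b = π.part a → κ a = κ b → a = b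
    · rw [if_pos hi]
      congr 1
      simp only [eq_iff_iff]
      refine ⟨fun h a b hab hlt => (h a b hab hlt).le, fun h a b hab hlt => ?_⟩
      refine lt_of_le_of_ne (h a b hab hlt) fun he => hlt.ne ?_
      exact σ.injective (hi _ _ (by rw [hσ', hσ', hab]) he)
    · rw [if_neg hi, if_neg]
      intro h
      refine hi fun a b hab he => ?_
      obtain ⟨a, rfl⟩ := σ.surjective a
      obtain ⟨b, rfl⟩ := σ.surjective b
      rw [hσ', hσ'] at hab
      rcases lt_trichotomy a b with hlt | rfl | hlt
      · exact absurd he (h a b hab hlt).ne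
      · rfl
      · exact absurd he (h b a hab.symm hlt).ne'
  rw [← h_ofFn]
  unfold e h
  rw [NCSeries.sum_apply, Finset.sum_congr rfl e1, NCSeries.sum_apply]
  split_ifs
  · rfl
  · simp

theorem h_homogeneous (π : SetPartition n) : Homogeneous n π.h :=
  Homogeneous.sum fun _ _ _ hw => wordSum_of_length_ne _ hw

theorem e_homogeneous (π : SetPartition n) : Homogeneous n π.e :=
  Homogeneous.sum fun _ _ _ hw => wordSum_of_length_ne _ hw

theorem mem_NCSym_of {f : NCSeries} (hf : Homogeneous n f) (g : SetPartition n → ℚ)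
    (h : ∀ κ : Fin n → ℕ+, f (List.ofFn κ) = g (ker κ)) : f ∈ NCSym := by
  rw [eq_sum_m hf g h]
  exact Submodule.sum_mem _ fun τ _ => Submodule.smul_mem _ _ (Submodule.subset_span ⟨⟨n, τ⟩, rfl⟩)

theorem e_mem_NCSym (π : SetPartition n) : π.e ∈ NCSym := by
  classical
  exact mem_NCSym_of π.e_homogeneous (fun τ =>
    if ∀ a b, π.part b = π.part a → τ.part b = τ.part a → a = b
      then ((π.youngPerms ∩ τ.youngPerms).card : ℚ) else 0) fun κ => by rw [e_ofFn]

/-- There is a permutation whose cycles are the blocks of `τ`. -/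
theorem exists_cycles (τ : SetPartition n) :
    ∃ σ ∈ τ.youngPerms, ∀ π : SetPartition n, σ ∈ π.youngPerms → τ ≤ π := by
  choose f hf _ using fun s : Finset (Fin n) => s.exists_cycleOn
  have hpart : ∀ x, τ.part (f (τ.part x) x) = τ.part x := fun x =>
    τ.mem_part_iff.1 ((hf (τ.part x)).apply_mem_iff.2 (τ.mem_part (Finset.mem_univ x)))
  have hinj : Function.Injective fun x => f (τ.part x) x := by
    intro x y hxy
    have hxy' : f (τ.part x) x = f (τ.part y) y := hxy
    have h1 : τ.part x = τ.part y := by rw [← hpart x, ← hpart y, hxy']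
    rw [h1] at hxy'
    exact (f (τ.part y)).injective hxy'
  let σ : Equiv.Perm (Fin n) := Equiv.ofBijective _ (Finite.injective_iff_bijective.1 hinj)
  have hσ : ∀ x, σ x = f (τ.part x) x := fun x => rfl
  refine ⟨σ, (mem_youngPerms _ _).2 fun x => by rw [hσ, hpart], fun π hπ => ?_⟩
  rw [mem_youngPerms] at hπ
  refine (le_iff _ _).2 fun i j hij => ?_
  obtain ⟨k, hk⟩ := (hf (τ.part i)).exists_pow_eq (τ.mem_part (Finset.mem_univ i))
    (τ.mem_part_iff.2 hij)
  rw [← hk.2]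
  have hk' : ∀ k : ℕ, τ.part ((f (τ.part i) ^ k) i) = τ.part i ∧
      π.part ((f (τ.part i) ^ k) i) = π.part i := by
    intro k
    induction k with
    | zero => simp
    | succ k ih =>
      rw [pow_succ', Equiv.Perm.mul_apply]
      have h1 : f (τ.part i) ((f (τ.part i) ^ k) i) = σ ((f (τ.part i) ^ k) i) := by
        rw [hσ, ih.1]
      refine ⟨?_, ?_⟩
      · rw [h1, hσ, hpart, ih.1]
      · rw [h1, hπ, ih.2]
  exact (hk' k).2

theorem h_relation (c : SetPartition n → ℚ) (h0 : ∑ π, c π • π.h = 0) : c = 0 := by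
  classical
  have h1 : ∀ τ : SetPartition n,
      ∑ π : SetPartition n, c π * ((π.youngPerms ∩ τ.youngPerms).card : ℚ) = 0 := by
    intro τ
    obtain ⟨κ, rfl⟩ := exists_ker τ
    have := congrArg (NCSeries.coeff (List.ofFn κ)) h0
    simpa [NCSeries.sum_apply, h_ofFn] using this
  have h2 : ∑ σ : Equiv.Perm (Fin n),
      (∑ π : SetPartition n, if σ ∈ π.youngPerms then c π else 0) ^ 2 = 0 := by
    have h3 : ∑ τ : SetPartition n, c τ *
        ∑ π : SetPartition n, c π * ((π.youngPerms ∩ τ.youngPerms).card : ℚ) = 0 := by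
      simp [h1]
    refine Eq.trans ?_ h3
    simp only [sq, Finset.sum_mul_sum]
    rw [Finset.sum_comm]
    refine Finset.sum_congr rfl fun τ _ => ?_
    rw [Finset.sum_comm, Finset.mul_sum]
    refine Finset.sum_congr rfl fun π _ => ?_
    have h4 : ((π.youngPerms ∩ τ.youngPerms).card : ℚ) =
        ∑ σ : Equiv.Perm (Fin n), if σ ∈ π.youngPerms ∩ τ.youngPerms then 1 else 0 := by
      rw [Finset.sum_ite_mem, Finset.univ_inter]
      simp
    rw [h4, Finset.mul_sum, Finset.mul_sum]
    refine Finset.sum_congr rfl fun σ _ => ?_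
    by_cases ha : σ ∈ τ.youngPerms <;> by_cases hb : σ ∈ π.youngPerms <;> simp [ha, hb]
  have h3 : ∀ σ : Equiv.Perm (Fin n),
      (∑ π : SetPartition n, if σ ∈ π.youngPerms then c π else 0) = 0 := fun σ => by
    have := (Finset.sum_eq_zero_iff_of_nonneg fun σ _ => sq_nonneg _).1 h2 σ (Finset.mem_univ σ)
    exact pow_eq_zero_iff two_ne_zero |>.1 this
  by_contra hc
  obtain ⟨π₀, hπ₀⟩ := Function.ne_iff.1 hc
  obtain ⟨τ, hτ, hmax⟩ := Finset.exists_maximal (s := Finset.univ.filter fun π => c π ≠ 0)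
    ⟨π₀, by simpa using hπ₀⟩
  obtain ⟨σ, hσ, hle⟩ := exists_cycles τ
  have h4 := h3 σ
  rw [Finset.sum_eq_single τ] at h4
  · rw [if_pos hσ] at h4
    exact (Finset.mem_filter.1 hτ).2 h4
  · intro π _ hne
    split_ifs with hm
    · by_contra hcπ
      exact hne (le_antisymm (hmax (by simpa using hcπ) (hle π hm)) (hle π hm))
    · rfl
  · simp

theorem linearIndependent_h :
    LinearIndependent ℚ (fun π : (Σ n, SetPartition n) => π.2.h) := by
  rw [linearIndependent_iff']
  rintro s g hs ⟨n, π⟩ hπ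
  obtain ⟨c, hc, h0⟩ := homogeneous_relation (fun x => x.2.h_homogeneous) hs n
  rw [hc π hπ, h_relation c h0]
  rfl

theorem span_h : Submodule.span ℚ (Set.range fun π : (Σ n, SetPartition n) => π.2.h) = NCSym := by
  classical
  apply le_antisymm
  · refine Submodule.span_le.2 ?_
    rintro _ ⟨⟨n, π⟩, rfl⟩
    exact mem_NCSym_of π.h_homogeneous
      (fun τ => ((π.youngPerms ∩ τ.youngPerms).card : ℚ)) (h_ofFn π)
  · refine Submodule.span_le.2 ?_
    rintro _ ⟨⟨n, π⟩, rfl⟩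
    have hli : LinearIndependent ℚ (fun π : SetPartition n => π.h) :=
      Fintype.linearIndependent_iff.2 fun c hc π => congrFun (h_relation c hc) π
    have hle : Submodule.span ℚ (Set.range fun π : SetPartition n => π.h) ≤
        Submodule.span ℚ (Set.range fun π : SetPartition n => π.m) := by
      refine Submodule.span_le.2 ?_
      rintro _ ⟨π, rfl⟩
      change π.h ∈ _
      rw [eq_sum_m π.h_homogeneous
        (fun τ => ((π.youngPerms ∩ τ.youngPerms).card : ℚ)) (h_ofFn π)]
      exact Submodule.sum_mem _ fun τ _ =>
        Submodule.smul_mem _ _ (Submodule.subset_span ⟨τ, rfl⟩)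
    have hfin : FiniteDimensional ℚ (Submodule.span ℚ (Set.range fun π : SetPartition n => π.m)) :=
      FiniteDimensional.span_of_finite ℚ (Set.finite_range _)
    have heq := Submodule.eq_of_le_of_finrank_le hle
      ((finrank_range_le_card (R := ℚ) fun π : SetPartition n => π.m).trans
        (finrank_span_eq_card hli).ge)
    have hm : π.m ∈ Submodule.span ℚ (Set.range fun π : SetPartition n => π.m) :=
      Submodule.subset_span ⟨π, rfl⟩
    rw [← heq] at hm
    refine Submodule.span_mono ?_ hm
    rintro _ ⟨τ, rfl⟩
    exact ⟨⟨n, τ⟩, rfl⟩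

end SetPartition

/-- The basis of `NCSym` consisting of the complete homogeneous functions `h_π`. -/
def homogeneousBasis : Module.Basis (Σ n, SetPartition n) ℚ NCSym :=
  (Module.Basis.span SetPartition.linearIndependent_h).map
    (LinearEquiv.ofEq _ _ SetPartition.span_h)

theorem homogeneousBasis_apply (π : Σ n, SetPartition n) :
    (homogeneousBasis π : NCSeries) = π.2.h := by
  simp [homogeneousBasis, Module.Basis.span_apply]

/-- The linear map `ω : NCSym → NCSym` with `h_π ↦ e_π`. -/
def omega : NCSym →ₗ[ℚ] NCSym :=
  homogeneousBasis.constr ℚ fun π => ⟨π.2.e, π.2.e_mem_NCSym⟩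

theorem omega_h (π : Σ n, SetPartition n) :
    (omega (homogeneousBasis π) : NCSeries) = π.2.e := by
  simp [omega]

/-- The index set of the odd set partitions of `[n]`, `n ≥ 0`. -/
abbrev OddPartition : Type := {π : (Σ n, SetPartition n) // π.2.IsOdd}

/-- The index set of the connected odd set partitions of `[n]`, `n ≥ 1`. -/
abbrev ConnectedOddPartition : Type :=
  {π : (Σ n, SetPartition n) // π.2.IsConnected ∧ π.2.IsOdd}

/-- The subspace `S` is a subalgebra of the algebra of power series, and it is freely generated as
a unital associative algebra by the family `x`: the homomorphism from the free algebra that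
sends the generators to the `x i` is injective with image `S`. -/
def FreelyGenerates {I : Type} (x : I → NCSeries) (S : Submodule ℚ NCSeries) : Prop :=
  Function.Injective (FreeAlgebra.lift ℚ x) ∧
    Subalgebra.toSubmodule (FreeAlgebra.lift ℚ x).range = S

end

end NCSchurQ

namespace NCSchurQ
noncomputable section

/-! ## Power sums -/

namespace SetPartition

variable {n : ℕ}

/-! The power sums diagonalize everything in sight. The coefficient of a word in `p_π` is 1 or 0
according to whether the word is constant on the blocks of `π`. A permutation `σ` preserves the
blocks of a partition `τ` if and only if its orbit partition `cyc σ` refines `τ`. Hence counts of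
permutations preserving two partitions become sums of power sums: `h_π` is the sum of `p_{cyc σ}`
over `σ ∈ 𝔖_π`, and `e_π` is the same sum weighted by signs (`h_eq_sum_p`, `e_eq_sum_p`). So `ω`
multiplies `p_π` by the sign of a permutation with orbits `π`, which is 1 for odd `π`
(`omega_powerSumBasis`).

For `q_π`, fix the set `N` of positions with negative colour. The enriched colourings are then
counted by the signs of the restrictions `σ|_N` over those `σ` that preserve `π`, the word and `N`
(`sum_isEnriched`). Summing over `N` gives each cycle of `σ` a factor `1 + sign`, so only
permutations with odd cycles survive, each with a positive weight. Thus `q_π` is a combination of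
odd power sums, and it is fixed by `ω`. For odd `π` it is a nonzero multiple of `p_π` plus odd power
sums strictly below `π` in refinement order (`isTriangular_q`).

The map `Θ` is given on the fundamental functions only. Its values on other functions come from a
formula for the coefficients of `Θ(f)` as signed sums of coefficients of `f`, taken over chains of
subsets of `[n]` (`theta_ofFn`). The formula holds on a fundamental function because, for a path,
these sums run over an interval in a Boolean lattice. It is evaluated on `p_π` by an Euler
characteristic computation for chains (`sum_refiningChains`). The outcome is that `Θ(p_π)` is a
multiple of `p_π`, each block `B` contributing the factor `1 + (-1)^{|B|+1}`. Therefore `NCΩ` is the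
span of the odd power sums (`NCOmega_eq`), and triangularity makes the odd `q_π` a basis.

Finally, `p_π p_τ` is the power sum of the concatenation (`p_mul_p`), concatenation is strictly
monotone for refinement, and every odd partition is uniquely a concatenation of connected odd ones
(`concatEquiv`). So for either choice of generators the words in the generators are triangular with
respect to the odd power sums, hence a basis, and this is free generation. -/

theorem le_ker_iff (π : SetPartition n) (κ : Fin n → ℕ+) :
    π ≤ ker κ ↔ ∀ i j, π.part j = π.part i → κ i = κ j := by
  simp only [le_iff, part_ker]

open Classical in
theorem p_ofFn (π : SetPartition n) (κ : Fin n → ℕ+) :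
    π.p (List.ofFn κ) = if π ≤ ker κ then 1 else 0 := by
  unfold p
  rw [NCSeries.sum_apply]
  simp only [m_ofFn]
  rw [Finset.sum_ite_eq]
  simp

theorem p_homogeneous (π : SetPartition n) : Homogeneous n π.p :=
  Homogeneous.sum fun τ _ => τ.m_homogeneous

/-- At a word whose kernel `τ` is minimal in the support of the relation, only partitions `π ≤ τ`
have a nonzero coefficient, so only `τ` itself contributes. -/
theorem p_relation (c : SetPartition n → ℚ) (h0 : ∑ π, c π • π.p = 0) : c = 0 := by
  classical
  by_contra hc
  obtain ⟨π₀, hπ₀⟩ := Function.ne_iff.1 hc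
  obtain ⟨τ, hτ, hmin⟩ := Finset.exists_minimal (s := Finset.univ.filter fun π => c π ≠ 0)
    ⟨π₀, by simpa using hπ₀⟩
  obtain ⟨κ, hκ⟩ := exists_ker τ
  have h1 := congrArg (NCSeries.coeff (List.ofFn κ)) h0
  rw [map_sum, map_zero, Finset.sum_eq_single τ] at h1
  · simp only [map_smul, NCSeries.coeff_apply, p_ofFn, hκ, le_refl, if_true, smul_eq_mul,
      mul_one] at h1
    exact (Finset.mem_filter.1 hτ).2 h1
  · intro π _ hne
    simp only [map_smul, NCSeries.coeff_apply, p_ofFn, hκ, smul_eq_mul]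
    split_ifs with hle
    · by_contra hcπ
      rw [mul_one] at hcπ
      exact hne (le_antisymm hle (hmin (by simpa using hcπ) hle))
    · simp
  · simp

theorem linearIndependent_p :
    LinearIndependent ℚ (fun π : (Σ n, SetPartition n) => π.2.p) := by
  rw [linearIndependent_iff']
  rintro s g hs ⟨n, π⟩ hπ
  obtain ⟨c, hc, h0⟩ := homogeneous_relation (fun x => x.2.p_homogeneous) hs n
  rw [hc π hπ, p_relation c h0]
  rfl

theorem p_mem_NCSym (π : SetPartition n) : π.p ∈ NCSym :=
  Submodule.sum_mem _ fun τ _ => Submodule.subset_span ⟨⟨n, τ⟩, rfl⟩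

theorem m_mem_span_p (π : SetPartition n) :
    π.m ∈ Submodule.span ℚ (Set.range fun π : (Σ n, SetPartition n) => π.2.p) := by
  classical
  induction π using WellFoundedGT.induction with
  | _ π ih =>
    have h1 : π.p = ∑ τ : SetPartition n with π ≤ τ, τ.m := by
      unfold p
      exact Finset.sum_congr (by ext; simp) fun _ _ => rfl
    rw [← Finset.add_sum_erase _ _ (a := π) (by simp)] at h1
    rw [← sub_eq_iff_eq_add.2 h1]
    refine Submodule.sub_mem _ (Submodule.subset_span ⟨⟨n, π⟩, rfl⟩)
      (Submodule.sum_mem _ fun τ hτ => ih τ ?_)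
    simp only [Finset.mem_erase, Finset.mem_filter, Finset.mem_univ, true_and] at hτ
    exact lt_of_le_of_ne hτ.2 hτ.1.symm

theorem span_p :
    Submodule.span ℚ (Set.range fun π : (Σ n, SetPartition n) => π.2.p) = NCSym := by
  apply le_antisymm <;> refine Submodule.span_le.2 ?_
  · rintro _ ⟨⟨n, π⟩, rfl⟩
    exact π.p_mem_NCSym
  · rintro _ ⟨⟨n, π⟩, rfl⟩
    exact π.m_mem_span_p

/-- The orbits of a permutation. -/
def cyc (σ : Equiv.Perm (Fin n)) : SetPartition n := by
  classical exact Finpartition.ofSetoid (Equiv.Perm.SameCycle.setoid σ)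

theorem part_cyc (σ : Equiv.Perm (Fin n)) (i j : Fin n) :
    (cyc σ).part j = (cyc σ).part i ↔ σ.SameCycle i j := by
  classical
  rw [← mem_part_iff]
  unfold cyc
  rw [Finpartition.mem_part_ofSetoid_iff_rel]
  exact Iff.rfl

/-- This is the bridge between Young subgroups and power sums: with `π = ker κ`, the right side says
that the word `κ` occurs in `p_{cyc σ}`. -/
theorem mem_youngPerms_iff_cyc_le (π : SetPartition n) (σ : Equiv.Perm (Fin n)) :
    σ ∈ π.youngPerms ↔ cyc σ ≤ π := by
  rw [mem_youngPerms, le_iff]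
  simp only [part_cyc]
  constructor
  · intro h i j hij
    obtain ⟨k, -, rfl⟩ := Equiv.Perm.SameCycle.exists_pow_eq' hij
    have : ∀ k : ℕ, π.part ((σ ^ k) i) = π.part i := by
      intro k
      induction k with
      | zero => simp
      | succ k ih => rw [pow_succ', Equiv.Perm.mul_apply, h, ih]
    exact this k
  · exact fun h i => h i (σ i) (Equiv.Perm.sameCycle_apply_right.2 (Equiv.Perm.SameCycle.refl _ _))

theorem exists_cyc (τ : SetPartition n) : ∃ σ : Equiv.Perm (Fin n), cyc σ = τ := by
  obtain ⟨σ, hσ, h⟩ := exists_cycles τ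
  exact ⟨σ, le_antisymm ((mem_youngPerms_iff_cyc_le _ _).1 hσ)
    (h _ ((mem_youngPerms_iff_cyc_le _ _).2 le_rfl))⟩

/-- The coefficient of `κ` in `h_π` is the number of `σ ∈ 𝔖_π` that also lie in `𝔖_{ker κ}`, and
these are the `σ` for which `κ` occurs in `p_{cyc σ}`. -/
theorem h_eq_sum_p (π : SetPartition n) : π.h = ∑ σ ∈ π.youngPerms, (cyc σ).p := by
  classical
  refine Homogeneous.ext π.h_homogeneous (Homogeneous.sum fun σ _ => (cyc σ).p_homogeneous)
    fun κ => ?_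
  rw [h_ofFn, NCSeries.sum_apply]
  simp only [p_ofFn, ← mem_youngPerms_iff_cyc_le]
  rw [Finset.sum_ite_mem]
  simp

theorem swap_mem_youngPerms {π : SetPartition n} {a b : Fin n} (h : π.part a = π.part b) :
    Equiv.swap a b ∈ π.youngPerms := by
  rw [mem_youngPerms]
  intro i
  rcases eq_or_ne i a with rfl | ha
  · rw [Equiv.swap_apply_left, h]
  · rcases eq_or_ne i b with rfl | hb
    · rw [Equiv.swap_apply_right, h]
    · rw [Equiv.swap_apply_of_ne_of_ne ha hb]

theorem mul_mem_youngPerms {π : SetPartition n} {σ τ : Equiv.Perm (Fin n)}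
    (hσ : σ ∈ π.youngPerms) (hτ : τ ∈ π.youngPerms) : σ * τ ∈ π.youngPerms := by
  rw [mem_youngPerms] at *
  intro i
  rw [Equiv.Perm.mul_apply, hσ, hτ]

/-- The coefficient on the right is the sum of signs over the intersection of two Young subgroups.
It is 1 if the intersection is trivial. Otherwise two elements share both a block of `π` and a
letter, and multiplication by their transposition cancels the terms in pairs, in agreement with the
absence of strict colourings. -/
theorem e_eq_sum_p (π : SetPartition n) :
    π.e = ∑ σ ∈ π.youngPerms, ((Equiv.Perm.sign σ : ℤ) : ℚ) • (cyc σ).p := by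
  classical
  refine Homogeneous.ext π.e_homogeneous
    (Homogeneous.sum fun σ _ => (cyc σ).p_homogeneous.smul _) fun κ => ?_
  rw [e_ofFn, NCSeries.sum_apply]
  simp only [NCSeries.smul_apply, p_ofFn, ← mem_youngPerms_iff_cyc_le, mul_ite, mul_one, mul_zero]
  rw [Finset.sum_ite_mem]
  split_ifs with hi
  · have h1 : π.youngPerms ∩ (ker κ).youngPerms = {1} := by
      ext σ
      simp only [Finset.mem_inter, Finset.mem_singleton, mem_youngPerms]
      constructor
      · rintro ⟨h1, h2⟩
        ext1 i
        exact hi _ _ (h1 i).symm (h2 i).symm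
      · rintro rfl
        simp
    rw [h1]
    simp
  · push Not at hi
    obtain ⟨a, b, h1, h2, hne⟩ := hi
    symm
    refine Finset.sum_involution (fun σ _ => σ * Equiv.swap a b) ?_ ?_ ?_ ?_
    · intro σ _
      simp [Equiv.Perm.sign_swap hne]
    · intro σ _ _ he
      refine hne ?_
      have := congrArg (fun τ => τ a) (mul_eq_left.1 he)
      simpa using this.symm
    · intro σ hσ
      rw [Finset.mem_inter] at hσ ⊢
      exact ⟨mul_mem_youngPerms hσ.1 (swap_mem_youngPerms h1.symm),
        mul_mem_youngPerms hσ.2 (swap_mem_youngPerms h2.symm)⟩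
    · intro σ _
      simp [mul_assoc]

end SetPartition

/-! ## Power sums diagonalize `ω` -/

section Cycles

variable {α : Type*} [Fintype α] [DecidableEq α]

theorem image_support_cycleFactorsFinset (σ : Equiv.Perm α) :
    σ.cycleFactorsFinset.image Equiv.Perm.support =
      σ.support.image fun x => (σ.cycleOf x).support := by
  ext s
  simp only [Finset.mem_image]
  constructor
  · rintro ⟨c, hc, rfl⟩
    obtain ⟨x, hx⟩ := (Equiv.Perm.mem_cycleFactorsFinset_iff.1 hc).1.nonempty_support
    exact ⟨x, Equiv.Perm.mem_cycleFactorsFinset_support_le hc hx,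
      by rw [Equiv.Perm.cycle_is_cycleOf hx hc]⟩
  · rintro ⟨x, hx, rfl⟩
    exact ⟨_, Equiv.Perm.cycleOf_mem_cycleFactorsFinset_iff.2 hx, rfl⟩

/-- Cycle factors that move a common point are equal, so passing from cycles to supports loses no
multiplicity. -/
theorem cycleType_eq_map_image_support (σ : Equiv.Perm α) :
    σ.cycleType = (σ.cycleFactorsFinset.image Equiv.Perm.support).val.map Finset.card := by
  rw [Finset.image_val_of_injOn, Multiset.map_map, Equiv.Perm.cycleType_def]
  intro c hc d hd hcd
  obtain ⟨x, hx⟩ := (Equiv.Perm.mem_cycleFactorsFinset_iff.1 hc).1.nonempty_support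
  have hx' : x ∈ d.support := by rw [← hcd]; exact hx
  rw [Equiv.Perm.cycle_is_cycleOf hx hc, Equiv.Perm.cycle_is_cycleOf hx' hd]

theorem mem_support_iff_exists_sameCycle (σ : Equiv.Perm α) (x : α) :
    x ∈ σ.support ↔ ∃ y, y ≠ x ∧ σ.SameCycle x y := by
  rw [Equiv.Perm.mem_support]
  constructor
  · exact fun h => ⟨σ x, h, Equiv.Perm.sameCycle_apply_right.2 (Equiv.Perm.SameCycle.refl _ _)⟩
  · rintro ⟨y, hy, hxy⟩ hx
    exact hy (hxy.eq_of_left hx).symm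

/-- The supports of the cycles are the orbits with more than one element, so the cycle type depends
on the orbit relation alone. This makes the sign of a set partition well defined. -/
theorem cycleType_eq_of_sameCycle_iff {σ τ : Equiv.Perm α}
    (h : ∀ x y, σ.SameCycle x y ↔ τ.SameCycle x y) : σ.cycleType = τ.cycleType := by
  have h1 : σ.support = τ.support := by
    ext x
    simp only [mem_support_iff_exists_sameCycle, h]
  rw [cycleType_eq_map_image_support, cycleType_eq_map_image_support,
    image_support_cycleFactorsFinset, image_support_cycleFactorsFinset, h1]
  refine congrArg (fun s : Finset (Finset α) => s.val.map Finset.card)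
    (Finset.image_congr fun x _ => ?_)
  ext y
  rw [Equiv.Perm.mem_support_cycleOf_iff, Equiv.Perm.mem_support_cycleOf_iff, h, h1]

end Cycles

namespace SetPartition

variable {n : ℕ}

theorem sign_eq_of_cyc_eq {σ τ : Equiv.Perm (Fin n)} (h : cyc σ = cyc τ) :
    Equiv.Perm.sign σ = Equiv.Perm.sign τ := by
  rw [Equiv.Perm.sign_of_cycleType', Equiv.Perm.sign_of_cycleType',
    cycleType_eq_of_sameCycle_iff fun x y => ?_]
  rw [← part_cyc, ← part_cyc, h]

/-- The order is the least common multiple of the cycle lengths, hence divides their product, which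
is odd. -/
theorem odd_orderOf {σ : Equiv.Perm (Fin n)} (h : (cyc σ).IsOdd) : Odd (orderOf σ) := by
  have h1 : ∀ k ∈ σ.cycleType, Odd k := by
    intro k hk
    rw [cycleType_eq_map_image_support, image_support_cycleFactorsFinset, Multiset.mem_map] at hk
    obtain ⟨s, hs, rfl⟩ := hk
    rw [Finset.mem_val, Finset.mem_image] at hs
    obtain ⟨x, hx, rfl⟩ := hs
    convert h _ ((cyc σ).part_mem.2 (Finset.mem_univ x)) using 2
    ext y
    rw [Equiv.Perm.mem_support_cycleOf_iff, mem_part_iff, part_cyc]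
    simp [hx]
  rw [← Equiv.Perm.lcm_cycleType]
  refine Odd.of_dvd_nat (Multiset.prod_induction Odd _ (fun _ _ => Odd.mul) odd_one h1) ?_
  exact Multiset.lcm_dvd.2 fun k hk => Multiset.dvd_prod hk

theorem sign_eq_one_of_odd_orderOf {α : Type*} [Fintype α] [DecidableEq α] {σ : Equiv.Perm α}
    {m : ℕ} (hm : Odd m) (h : σ ^ m = 1) : Equiv.Perm.sign σ = 1 := by
  have h1 := congrArg Equiv.Perm.sign h
  rw [map_pow, map_one] at h1
  rcases Int.units_eq_one_or (Equiv.Perm.sign σ) with h2 | h2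
  · exact h2
  · rw [h2, hm.neg_one_pow] at h1
    exact absurd h1 (by decide)

end SetPartition

/-- The basis of `NCSym` consisting of the power sums `p_π`. -/
def powerSumBasis : Module.Basis (Σ n, SetPartition n) ℚ NCSym :=
  (Module.Basis.span SetPartition.linearIndependent_p).map
    (LinearEquiv.ofEq _ _ SetPartition.span_p)

theorem powerSumBasis_apply (π : Σ n, SetPartition n) :
    (powerSumBasis π : NCSeries) = π.2.p := by
  simp [powerSumBasis, Module.Basis.span_apply]

/-- The sign of the permutations whose orbits are the blocks of `π`. -/
def SetPartition.sign {n : ℕ} (π : SetPartition n) : ℚ :=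
  ((Equiv.Perm.sign π.exists_cyc.choose : ℤ) : ℚ)

theorem SetPartition.sign_cyc {n : ℕ} (σ : Equiv.Perm (Fin n)) :
    (SetPartition.cyc σ).sign = ((Equiv.Perm.sign σ : ℤ) : ℚ) := by
  unfold SetPartition.sign
  rw [SetPartition.sign_eq_of_cyc_eq (SetPartition.cyc σ).exists_cyc.choose_spec]

theorem SetPartition.sign_of_isOdd {n : ℕ} {π : SetPartition n} (h : π.IsOdd) : π.sign = 1 := by
  obtain ⟨σ, rfl⟩ := π.exists_cyc
  rw [SetPartition.sign_cyc, SetPartition.sign_eq_one_of_odd_orderOf (SetPartition.odd_orderOf h)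
    (pow_orderOf_eq_one σ)]
  simp

/-- The expansions of `h_π` and `e_π` run over the same permutations and differ by the signs only.
So the map scaling each power sum by its sign agrees with `ω` on the basis of the `h_π`. -/
theorem omega_powerSumBasis (π : Σ n, SetPartition n) :
    omega (powerSumBasis π) = π.2.sign • powerSumBasis π := by
  have h1 : omega = powerSumBasis.constr ℚ fun π => π.2.sign • powerSumBasis π := by
    refine homogeneousBasis.ext fun π => Subtype.ext ?_
    rw [omega_h]
    have h2 : homogeneousBasis π = ∑ σ ∈ π.2.youngPerms, powerSumBasis ⟨π.1, SetPartition.cyc σ⟩ := by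
      refine Subtype.ext ?_
      rw [homogeneousBasis_apply, SetPartition.h_eq_sum_p, Submodule.coe_sum]
      simp only [powerSumBasis_apply]
    rw [h2, map_sum, Submodule.coe_sum, SetPartition.e_eq_sum_p]
    refine Finset.sum_congr rfl fun σ _ => ?_
    rw [Module.Basis.constr_basis, Submodule.coe_smul, powerSumBasis_apply, SetPartition.sign_cyc]
  rw [h1, Module.Basis.constr_basis]

/-- The span of the power sums indexed by odd set partitions. -/
def oddPowerSums : Submodule ℚ NCSeries :=
  Submodule.span ℚ (Set.range fun π : OddPartition => π.1.2.p)

theorem SetPartition.p_mem_oddPowerSums {n : ℕ} {π : SetPartition n} (h : π.IsOdd) :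
    π.p ∈ oddPowerSums := Submodule.subset_span ⟨⟨⟨n, π⟩, h⟩, rfl⟩

theorem omega_eq_self_of_mem {f : NCSeries} (hf : f ∈ oddPowerSums) :
    ∃ x : NCSym, (x : NCSeries) = f ∧ omega x = x := by
  induction hf using Submodule.span_induction with
  | mem f hf =>
    obtain ⟨π, rfl⟩ := hf
    exact ⟨powerSumBasis π.1, powerSumBasis_apply _, by
      rw [omega_powerSumBasis, SetPartition.sign_of_isOdd π.2, one_smul]⟩
  | zero => exact ⟨0, rfl, map_zero _⟩
  | add f g _ _ hf hg =>
    obtain ⟨x, rfl, hx⟩ := hf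
    obtain ⟨y, rfl, hy⟩ := hg
    exact ⟨x + y, rfl, by rw [map_add, hx, hy]⟩
  | smul c f _ hf =>
    obtain ⟨x, rfl, hx⟩ := hf
    exact ⟨c • x, rfl, by rw [map_smul, hx]⟩

/-! ## The functions `q_π` in terms of power sums -/

open EdgeColouredDigraph

section SignedColourings

variable {n : ℕ}

/-- The signed colouring with absolute values `κ` that is negative exactly on `N`. -/
def signedColouring (κ : Fin n → ℕ+) (N : Finset (Fin n)) (i : Fin n) : SignedColour :=
  toLex (κ i, decide (i ∉ N))

theorem isPos_signedColouring (κ : Fin n → ℕ+) (N : Finset (Fin n)) (i : Fin n) :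
    SignedColour.IsPos (signedColouring κ N i) ↔ i ∉ N := by
  simp [SignedColour.IsPos, signedColouring]

theorem isNeg_signedColouring (κ : Fin n → ℕ+) (N : Finset (Fin n)) (i : Fin n) :
    SignedColour.IsNeg (signedColouring κ N i) ↔ i ∈ N := by
  simp [SignedColour.IsNeg, signedColouring]

theorem signedColouring_eq_iff (κ : Fin n → ℕ+) (N : Finset (Fin n)) (i j : Fin n) :
    signedColouring κ N i = signedColouring κ N j ↔ κ i = κ j ∧ (i ∈ N ↔ j ∈ N) := by
  simp only [signedColouring, toLex_inj, Prod.mk.injEq, decide_eq_decide, not_iff_not]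

-- Once the absolute values are prescribed by the word, a signed colouring amounts to the choice of
-- the set `N` where it is negative.
open Classical in
theorem enriched_ofFn (G : EdgeColouredDigraph n) (κ : Fin n → ℕ+) :
    G.enriched (List.ofFn κ) =
      ∑ N : Finset (Fin n), if G.IsEnriched (signedColouring κ N) then (1 : ℚ) else 0 := by
  unfold EdgeColouredDigraph.enriched wordSum
  rw [Finset.sum_boole, ← Fintype.card_subtype, ← Nat.card_eq_fintype_card]
  congr 1
  refine (Nat.card_congr (Equiv.ofBijective (fun N => ⟨signedColouring κ N.1, N.2, rfl⟩)
    ⟨fun N N' h => ?_, fun c => ?_⟩)).symm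
  · refine Subtype.ext (Finset.ext fun i => ?_)
    have h1 := congrFun (congrArg Subtype.val h) i
    rw [← isNeg_signedColouring κ N.1 i, ← isNeg_signedColouring κ N'.1 i]
    exact iff_of_eq (congrArg SignedColour.IsNeg h1)
  · obtain ⟨c, hc, hw⟩ := c
    have hκ := List.ofFn_injective hw
    have he : signedColouring κ (Finset.univ.filter fun i => SignedColour.IsNeg (c i)) = c := by
      funext i
      refine ofLex.injective (Prod.ext (congrFun hκ i).symm ?_)
      change decide _ = _
      rw [Bool.eq_iff_iff, decide_eq_true_iff, Finset.mem_filter_univ]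
      exact iff_of_eq (Bool.not_eq_false _)
    exact ⟨⟨Finset.univ.filter fun i => SignedColour.IsNeg (c i), he.symm ▸ hc⟩, Subtype.ext he⟩

theorem enriched_homogeneous (G : EdgeColouredDigraph n) : Homogeneous n G.enriched := by
  intro w hw
  have : IsEmpty {c : Fin n → SignedColour // G.IsEnriched c ∧
      (List.ofFn fun i => SignedColour.abs (c i)) = w} := ⟨fun x => hw (by rw [← x.2.2]; simp)⟩
  unfold EdgeColouredDigraph.enriched wordSum
  simp

/-- An order embedding of the signed colours into the colours. -/
def SignedColour.toColour (c : SignedColour) : ℕ+ :=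
  Nat.succPNat (2 * (ofLex c).1 + (ofLex c).2.toNat)

/-- Up to a shift by one, `-k` goes to `2k` and `k` to `2k + 1`. Thus statements about ordinary
colourings, such as `h_ofFn`, apply to signed ones. -/
theorem SignedColour.toColour_strictMono : StrictMono SignedColour.toColour := by
  intro c d h
  rw [Prod.Lex.lt_iff] at h
  unfold SignedColour.toColour
  rw [Nat.succPNat_lt_succPNat]
  have h1 := Bool.toNat_le (ofLex c).2
  rcases h with h | ⟨h, h'⟩
  · have := PNat.coe_lt_coe _ _ |>.2 h
    omega
  · rw [Bool.lt_iff] at h'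
    rw [h, h'.1, h'.2]
    simp

end SignedColourings

/-! ### Signs of the restrictions of a permutation to its stable sets. -/

section Restriction

variable {n : ℕ}

/-- The permutation that agrees with `σ` on the `σ`-stable set `N` and is trivial elsewhere. -/
def restrictPerm (σ : Equiv.Perm (Fin n)) (N : Finset (Fin n)) : Equiv.Perm (Fin n) := by
  classical exact if h : ∀ i, σ i ∈ N ↔ i ∈ N then Equiv.Perm.ofSubtype (σ.subtypePerm h) else 1

theorem restrictPerm_apply {σ : Equiv.Perm (Fin n)} {N : Finset (Fin n)}
    (h : ∀ i, σ i ∈ N ↔ i ∈ N) (i : Fin n) :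
    restrictPerm σ N i = if i ∈ N then σ i else i := by
  unfold restrictPerm
  rw [dif_pos h]
  split_ifs with hi
  · rw [Equiv.Perm.ofSubtype_apply_of_mem _ hi]
    rfl
  · rw [Equiv.Perm.ofSubtype_apply_of_not_mem _ hi]

open Classical in
/-- The sign of the restriction of `σ` to `N`, or zero if `N` is not `σ`-stable. -/
def restrictSign (σ : Equiv.Perm (Fin n)) (N : Finset (Fin n)) : ℚ :=
  if ∀ i, σ i ∈ N ↔ i ∈ N then ((Equiv.Perm.sign (restrictPerm σ N) : ℤ) : ℚ) else 0

/-- A transposition inside `N` does not affect stability of `N` and multiplies the restriction by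
that transposition. This drives the cancellation in `sum_isEnriched`. -/
theorem restrictSign_mul_swap (σ : Equiv.Perm (Fin n)) {N : Finset (Fin n)} {a b : Fin n}
    (ha : a ∈ N) (hb : b ∈ N) (hab : a ≠ b) :
    restrictSign (σ * Equiv.swap a b) N = - restrictSign σ N := by
  have hsw : ∀ i, Equiv.swap a b i ∈ N ↔ i ∈ N := by
    intro i
    rcases eq_or_ne i a with rfl | h1
    · simp [ha, hb]
    · rcases eq_or_ne i b with rfl | h2
      · simp [ha, hb]
      · rw [Equiv.swap_apply_of_ne_of_ne h1 h2]
  have hst : (∀ i, (σ * Equiv.swap a b) i ∈ N ↔ i ∈ N) ↔ ∀ i, σ i ∈ N ↔ i ∈ N := by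
    simp only [Equiv.Perm.mul_apply]
    constructor
    · intro h i
      have := h (Equiv.swap a b i)
      rwa [Equiv.swap_apply_self, hsw] at this
    · intro h i
      rw [h, hsw]
  unfold restrictSign
  by_cases h : ∀ i, σ i ∈ N ↔ i ∈ N
  · rw [if_pos (hst.2 h), if_pos h]
    have : restrictPerm (σ * Equiv.swap a b) N = restrictPerm σ N * Equiv.swap a b := by
      ext1 i
      rw [restrictPerm_apply (hst.2 h)]
      change _ = restrictPerm σ N (Equiv.swap a b i)
      rw [restrictPerm_apply h]
      simp only [hsw]
      split_ifs with hi
      · rfl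
      · rw [Equiv.swap_apply_of_ne_of_ne]
        · rintro rfl
          exact hi ha
        · rintro rfl
          exact hi hb
    rw [this, map_mul, Equiv.Perm.sign_swap hab]
    simp
  · rw [if_neg (mt hst.1 h), if_neg h, neg_zero]

/-- Adding a cycle of `σ` to a stable set multiplies the restriction by that cycle, and a cycle of
even length is an odd permutation. -/
theorem restrictSign_symmDiff (σ : Equiv.Perm (Fin n)) (x : Fin n)
    (heven : Even ((SetPartition.cyc σ).part x).card) (N : Finset (Fin n)) :
    restrictSign σ (symmDiff N ((SetPartition.cyc σ).part x)) = - restrictSign σ N := by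
  classical
  set B := (SetPartition.cyc σ).part x with hB
  have hmB : ∀ i, i ∈ B ↔ σ.SameCycle x i := fun i => by
    rw [hB, SetPartition.mem_part_iff, SetPartition.part_cyc]
  have hstB : ∀ i, σ i ∈ B ↔ i ∈ B := fun i => by
    rw [hmB, hmB, Equiv.Perm.sameCycle_apply_right]
  have hxB : x ∈ B := (hmB x).2 (Equiv.Perm.SameCycle.refl _ _)
  have hst : ∀ N : Finset (Fin n), (∀ i, σ i ∈ N ↔ i ∈ N) →
      ∀ i, σ i ∈ symmDiff N B ↔ i ∈ symmDiff N B := by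
    intro N h i
    simp only [Finset.mem_symmDiff, h, hstB]
  have key : ∀ N : Finset (Fin n), (∀ i, σ i ∈ N ↔ i ∈ N) → x ∉ N →
      restrictSign σ (symmDiff N B) = - restrictSign σ N := by
    intro N h hx
    have hd : ∀ i ∈ B, i ∉ N := by
      intro i hi
      obtain ⟨k, rfl⟩ := ((hmB i).1 hi).exists_nat_pow_eq
      suffices ∀ k : ℕ, (σ ^ k) x ∉ N from this k
      intro k
      induction k with
      | zero => exact hx
      | succ k ih => rwa [pow_succ', Equiv.Perm.mul_apply, h]
    have h1 : restrictPerm σ (symmDiff N B) = restrictPerm σ N * σ.cycleOf x := by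
      ext1 i
      rw [restrictPerm_apply (hst N h), Equiv.Perm.mul_apply, restrictPerm_apply h,
        Equiv.Perm.cycleOf_apply]
      simp only [← hmB, Finset.mem_symmDiff]
      by_cases hi : i ∈ B
      · have h2 := hd _ hi
        have h3 := hd _ ((hstB i).2 hi)
        simp [hi, h2, h3]
      · simp [hi]
    -- An orbit of even size is not a fixed point, so `σ.cycleOf x` is a genuine cycle and the sign
    -- formula for cycles applies.
    have h2 : x ∈ σ.support := by
      rw [Equiv.Perm.mem_support]
      intro hfix
      have : B = {x} := by
        ext i
        rw [hmB, Finset.mem_singleton]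
        constructor
        · exact fun h => (h.eq_of_left hfix).symm
        · rintro rfl
          exact Equiv.Perm.SameCycle.refl _ _
      rw [this] at heven
      simp at heven
    have h3 : (σ.cycleOf x).support = B := by
      ext i
      rw [Equiv.Perm.mem_support_cycleOf_iff, hmB]
      simp [h2]
    unfold restrictSign
    rw [if_pos (hst N h), if_pos h, h1, map_mul,
      (Equiv.Perm.isCycle_cycleOf σ (Equiv.Perm.mem_support.1 h2)).sign, h3, heven.neg_one_pow]
    simp
  by_cases h : ∀ i, σ i ∈ N ↔ i ∈ N
  · by_cases hx : x ∈ N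
    -- If `x ∈ N`, removing the orbit leads back to the case already treated, read in the opposite
    -- direction.
    · have := key (symmDiff N B) (hst N h) (by simp [Finset.mem_symmDiff, hx, hxB])
      rw [symmDiff_symmDiff_cancel_right] at this
      rw [this, neg_neg]
    · exact key N h hx
  · have h' : ¬ ∀ i, σ i ∈ symmDiff N B ↔ i ∈ symmDiff N B := fun h' => h (by
      have := hst _ h'
      rwa [symmDiff_symmDiff_cancel_right] at this)
    unfold restrictSign
    rw [if_neg h, if_neg h', neg_zero]

/-- The sum of the signs of all restrictions of `σ` to stable sets; it is `2 ^ k` if `σ` has `k`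
cycles, all of odd length, and zero otherwise. -/
def cycleWeight (σ : Equiv.Perm (Fin n)) : ℚ := ∑ N : Finset (Fin n), restrictSign σ N

/-- Toggling an even orbit in `N` is a bijection that reverses every sign, so the weight equals its
own negative. -/
theorem isOdd_of_cycleWeight_ne_zero {σ : Equiv.Perm (Fin n)} (h : cycleWeight σ ≠ 0) :
    (SetPartition.cyc σ).IsOdd := by
  intro B hB
  rw [← Nat.not_even_iff_odd]
  intro heven
  refine h ?_
  obtain ⟨x, hx⟩ := (SetPartition.cyc σ).nonempty_of_mem_parts hB
  obtain rfl := (SetPartition.cyc σ).part_eq_of_mem hB hx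
  have h1 : cycleWeight σ = - cycleWeight σ := by
    unfold cycleWeight
    rw [← Finset.sum_neg_distrib]
    refine Finset.sum_nbij' (fun N => symmDiff N ((SetPartition.cyc σ).part x))
      (fun N => symmDiff N ((SetPartition.cyc σ).part x)) (by simp) (by simp) (by simp) (by simp)
      fun N _ => ?_
    rw [restrictSign_symmDiff σ x heven, neg_neg]
  linarith

/-- The restriction of a permutation of odd order is killed by the same odd power, hence is even.
All terms are therefore 0 or 1, and the empty set contributes 1. -/
theorem cycleWeight_pos {σ : Equiv.Perm (Fin n)} (h : (SetPartition.cyc σ).IsOdd) :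
    0 < cycleWeight σ := by
  have h1 : ∀ N : Finset (Fin n), (∀ i, σ i ∈ N ↔ i ∈ N) → restrictSign σ N = 1 := by
    intro N hN
    unfold restrictSign
    rw [if_pos hN, SetPartition.sign_eq_one_of_odd_orderOf (SetPartition.odd_orderOf h)]
    · simp
    · ext1 i
      have : ∀ k : ℕ, ((restrictPerm σ N) ^ k) i = if i ∈ N then (σ ^ k) i else i := by
        intro k
        induction k with
        | zero => simp
        | succ k ih =>
          rw [pow_succ', pow_succ', Equiv.Perm.mul_apply, ih, restrictPerm_apply hN]
          have hk : ∀ k : ℕ, (σ ^ k) i ∈ N ↔ i ∈ N := by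
            intro k
            induction k with
            | zero => simp
            | succ k ih => rw [pow_succ', Equiv.Perm.mul_apply, hN, ih]
          by_cases hi : i ∈ N
          · rw [if_pos hi, if_pos hi, if_pos ((hk k).2 hi), Equiv.Perm.mul_apply]
          · rw [if_neg hi, if_neg hi, if_neg hi]
      rw [this, pow_orderOf_eq_one]
      simp
  unfold cycleWeight
  refine Finset.sum_pos' (fun N _ => ?_) ⟨∅, Finset.mem_univ _, by rw [h1 _ (by simp)]; norm_num⟩
  by_cases hN : ∀ i, σ i ∈ N ↔ i ∈ N
  · rw [h1 N hN]
    norm_num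
  · unfold restrictSign
    rw [if_neg hN]

end Restriction

/-! ### Expansion of `q_π` in power sums. -/

namespace SetPartition

variable {n : ℕ}

/-- The relation "smaller, or equal and positive" is transitive, so it passes from consecutive
elements to all pairs in a block. -/
theorem isEnriched_doublePaths (π : SetPartition n) (σ : Equiv.Perm (Fin n))
    (c : Fin n → SignedColour) :
    (π.doublePaths.relabel σ).IsEnriched c ↔ ∀ a b, π.part b = π.part a → a < b →
      c (σ a) < c (σ b) ∨ (c (σ a) = c (σ b) ∧ SignedColour.IsPos (c (σ a))) := by
  constructor
  · rintro ⟨h, -⟩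
    refine consecutive_chain π (fun a b => c (σ a) < c (σ b) ∨
      (c (σ a) = c (σ b) ∧ SignedColour.IsPos (c (σ a)))) ?_ ?_
    · rintro a b d (h1 | ⟨h1, h1'⟩) (h2 | ⟨h2, h2'⟩)
      · exact Or.inl (h1.trans h2)
      · exact Or.inl (h2 ▸ h1)
      · exact Or.inl (h1 ▸ h2)
      · exact Or.inr ⟨h1.trans h2, h1'⟩
    · intro a b hab
      refine h _ _ ?_
      change π.Consecutive _ _
      simpa using hab
  · intro h
    refine ⟨fun a b hab => ?_, fun a b hab => hab.elim⟩
    change π.Consecutive _ _ at hab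
    simpa using h _ _ (consecutive_part hab) hab.2.1

-- If no two elements of `N` share a block of `π` and a letter, negative ties cannot occur. Enriched
-- then means weakly increasing in the signed colours, the count comes from `h_ofFn`, and every
-- restriction to `N` on the right is trivial. If two elements of `N` do share both, they lie on one
-- path of double edges with the same negative colour, so nothing is enriched; on the right their
-- transposition cancels the signs.
open Classical in
theorem sum_isEnriched (π : SetPartition n) (κ : Fin n → ℕ+) (N : Finset (Fin n)) :
    (∑ σ ∈ π.youngPerms,
      if (π.doublePaths.relabel σ).IsEnriched (signedColouring κ N) then (1 : ℚ) else 0) =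
      ∑ σ ∈ π.youngPerms ∩ (ker κ).youngPerms, restrictSign σ N := by
  by_cases hsep : ∀ i ∈ N, ∀ j ∈ N, π.part i = π.part j → κ i = κ j → i = j
  · set κ' : Fin n → ℕ+ := fun i => SignedColour.toColour (signedColouring κ N i) with hκ'
    have h1 : ∀ σ ∈ π.youngPerms,
        (if (π.doublePaths.relabel σ).IsEnriched (signedColouring κ N) then (1 : ℚ) else 0) =
          (π.doublePaths.relabel σ).chromatic (List.ofFn κ') := by
      intro σ hσ
      rw [mem_youngPerms] at hσ
      unfold EdgeColouredDigraph.chromatic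
      rw [wordSum_ofFn]
      refine if_congr ?_ rfl rfl
      rw [isProper_doublePaths, isEnriched_doublePaths]
      refine forall₄_congr fun a b hab hlt => ?_
      rw [hκ', SignedColour.toColour_strictMono.le_iff_le, le_iff_lt_or_eq]
      refine or_congr Iff.rfl (and_iff_left_of_imp fun he => ?_)
      rw [isPos_signedColouring]
      intro ha
      -- A tie at a negative colour would put two distinct elements of `N` in the same block of `π`
      -- with the same letter, against `hsep`.
      rw [signedColouring_eq_iff] at he
      exact hlt.ne (σ.injective (hsep _ ha _ (he.2.1 ha) (by rw [hσ, hσ, hab]) he.1))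
    rw [Finset.sum_congr rfl h1]
    have h2 := π.h_ofFn κ'
    unfold h at h2
    rw [NCSeries.sum_apply] at h2
    have h3 : ∀ σ ∈ π.youngPerms ∩ (ker κ).youngPerms,
        restrictSign σ N = if ∀ i, σ i ∈ N ↔ i ∈ N then 1 else 0 := by
      intro σ hσ
      simp only [Finset.mem_inter, mem_youngPerms, part_ker] at hσ
      unfold restrictSign
      by_cases hN : ∀ i, σ i ∈ N ↔ i ∈ N
      · have : restrictPerm σ N = 1 := by
          ext1 i
          rw [restrictPerm_apply hN]
          split_ifs with hi
          · exact hsep _ ((hN i).2 hi) _ hi (hσ.1 i) (hσ.2 i).symm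
          · rfl
        rw [if_pos hN, if_pos hN, this]
        simp
      · rw [if_neg hN, if_neg hN]
    rw [h2, Finset.sum_congr rfl h3, Finset.sum_boole]
    -- The permutations preserving the signed colouring are those that preserve the word and
    -- stabilize `N`.
    congr 2
    ext σ
    simp only [Finset.mem_inter, Finset.mem_filter, mem_youngPerms, part_ker, hκ',
      SignedColour.toColour_strictMono.injective.eq_iff, signedColouring_eq_iff, and_assoc,
      forall_and]
    simp only [iff_comm]
  · push Not at hsep
    obtain ⟨i, hi, j, hj, h1, h2, hne⟩ := hsep
    have key : ∀ σ ∈ π.youngPerms, ∀ i ∈ N, ∀ j ∈ N, π.part i = π.part j → κ i = κ j →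
        (π.doublePaths.relabel σ).IsEnriched (signedColouring κ N) → ¬ σ.symm i < σ.symm j := by
      intro σ hσ i hi j hj h1 h2 he hlt
      rw [mem_youngPerms] at hσ
      have h3 := (isEnriched_doublePaths _ _ _).1 he (σ.symm i) (σ.symm j)
        (by rw [← hσ, ← hσ (σ.symm i), σ.apply_symm_apply, σ.apply_symm_apply, h1]) hlt
      rw [σ.apply_symm_apply, σ.apply_symm_apply,
        (signedColouring_eq_iff _ _ _ _).2 ⟨h2, iff_of_true hi hj⟩, isPos_signedColouring] at h3
      exact h3.elim (lt_irrefl _) fun h => h.2 hj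
    rw [Finset.sum_eq_zero fun σ hσ => if_neg fun he => ?_]
    · symm
      refine Finset.sum_involution (fun σ _ => σ * Equiv.swap i j) ?_ ?_ ?_ ?_
      · intro σ _
        rw [restrictSign_mul_swap σ hi hj hne, add_neg_cancel]
      · intro σ _ _ he
        refine hne ?_
        have := congrArg (fun τ => τ i) (mul_eq_left.1 he)
        simpa using this.symm
      · intro σ hσ
        rw [Finset.mem_inter] at hσ ⊢
        exact ⟨mul_mem_youngPerms hσ.1 (swap_mem_youngPerms h1),
          mul_mem_youngPerms hσ.2 (swap_mem_youngPerms ((part_ker _ _ _).2 h2.symm))⟩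
      · intro σ _
        simp [mul_assoc]
    · rcases lt_trichotomy (σ.symm i) (σ.symm j) with h | h | h
      · exact key σ hσ i hi j hj h1 h2 he h
      · exact hne (σ.symm.injective h)
      · exact key σ hσ j hj i hi h1.symm h2.symm he h

/-- Interchange the sum over `σ` with the sum over the negative sets `N`, and apply `sum_isEnriched`
for each `N`. -/
theorem q_eq_sum_p (π : SetPartition n) :
    π.q = ∑ σ ∈ π.youngPerms, cycleWeight σ • (cyc σ).p := by
  classical
  have hq : Homogeneous n π.q := Homogeneous.sum fun σ _ => enriched_homogeneous _
  refine Homogeneous.ext hq (Homogeneous.sum fun σ _ => (cyc σ).p_homogeneous.smul _) fun κ => ?_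
  unfold q
  rw [NCSeries.sum_apply, NCSeries.sum_apply]
  simp only [enriched_ofFn, NCSeries.smul_apply, p_ofFn, ← mem_youngPerms_iff_cyc_le, mul_ite,
    mul_one, mul_zero]
  rw [Finset.sum_ite_mem]
  unfold cycleWeight
  rw [Finset.sum_comm, Finset.sum_comm (s := π.youngPerms ∩ (ker κ).youngPerms)]
  exact Finset.sum_congr rfl fun N _ => sum_isEnriched π κ N

end SetPartition

/-! ## Chains of sets -/

section Chains

variable {n : ℕ} {Y : Type*}

open Classical in
/-- The chains of `t`-stable subsets of `[n]` that contain the full set and, for every `i`, the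
set of the elements of smaller `c`-value than `i`. They correspond to the set compositions that
refine the one given by `c` and whose blocks are unions of fibres of `t`. -/
def refiningChains (c : Fin n → ℕ) (t : Fin n → Y) : Finset (Finset (Finset (Fin n))) :=
  Finset.univ.filter fun 𝒞 => (∀ S ∈ 𝒞, ∀ T ∈ 𝒞, S ⊆ T ∨ T ⊆ S) ∧ Finset.univ ∈ 𝒞 ∧
    (∀ i, (Finset.univ.filter fun j => c j < c i) ∈ 𝒞) ∧
    ∀ S ∈ 𝒞, ∀ i j, t i = t j → i ∈ S → j ∈ S

theorem mem_refiningChains {c : Fin n → ℕ} {t : Fin n → Y} {𝒞 : Finset (Finset (Fin n))} :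
    𝒞 ∈ refiningChains c t ↔ (∀ S ∈ 𝒞, ∀ T ∈ 𝒞, S ⊆ T ∨ T ⊆ S) ∧ Finset.univ ∈ 𝒞 ∧
    (∀ i, (Finset.univ.filter fun j => c j < c i) ∈ 𝒞) ∧
    ∀ S ∈ 𝒞, ∀ i j, t i = t j → i ∈ S → j ∈ S := by
  simp [refiningChains]

theorem card_image_le_of_imp {α X Z : Type*} [Fintype α] [DecidableEq X] [DecidableEq Z]
    {f : α → X} {g : α → Z} (h : ∀ i j, g i = g j → f i = f j) :
    (Finset.univ.image f).card ≤ (Finset.univ.image g).card := by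
  rcases isEmpty_or_nonempty X with hX | hX
  · simp [Finset.eq_empty_of_isEmpty]
  · obtain ⟨e, rfl⟩ := (Function.factorsThrough_iff (f := g) f).1 fun i j => h i j
    rw [← Finset.image_image]
    exact Finset.card_image_le

/-- If `c` and `t` have the same fibres, there is only one chain. -/
theorem sum_refiningChains_of_iff [DecidableEq Y] (c : Fin n → ℕ) (t : Fin n → Y)
    (h : ∀ i j, c i = c j ↔ t i = t j) :
    ∑ 𝒞 ∈ refiningChains c t, (-1 : ℚ) ^ 𝒞.card = (-1) ^ (1 + (Finset.univ.image t).card) := by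
  set D : Fin n → Finset (Fin n) := fun i => Finset.univ.filter fun j => c j < c i with hD
  have hmD : ∀ i j, j ∈ D i ↔ c j < c i := by simp [hD]
  have huniq : refiningChains c t = {insert Finset.univ (Finset.univ.image D)} := by
    ext 𝒞
    rw [Finset.mem_singleton, mem_refiningChains]
    constructor
    · rintro ⟨h1, h2, h3, h4⟩
      refine Finset.Subset.antisymm (fun S hS => ?_) (Finset.insert_subset h2 ?_)
      · rw [Finset.mem_insert, or_iff_not_imp_left]
        intro hne
        -- A member `S` other than the full set is the lower set of the least level that it misses:
        -- stability under `t` keeps `S` from splitting a level, and comparability with the lower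
        -- sets keeps it from skipping one.
        obtain ⟨j, hj, hmin⟩ := Finset.exists_min_image (Finset.univ.filter fun j => j ∉ S) c (by
          by_contra he
          rw [Finset.not_nonempty_iff_eq_empty, Finset.filter_eq_empty_iff] at he
          exact hne (Finset.eq_univ_iff_forall.2 fun x => not_not.1 (he (Finset.mem_univ x))))
        simp only [Finset.mem_filter, Finset.mem_univ, true_and] at hj hmin
        refine Finset.mem_image.2 ⟨j, Finset.mem_univ _, Finset.ext fun k => ?_⟩
        rw [hmD]
        constructor
        · intro hk
          by_contra hkS
          exact absurd (hmin k hkS) (not_le.2 hk)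
        · intro hk
          by_contra hlt
          rcases (not_lt.1 hlt).eq_or_lt with he | hlt
          · exact hj (h4 S hS k j ((h _ _).1 he.symm) hk)
          · rcases h1 S hS _ (h3 k) with hs | hs
            · exact lt_irrefl _ ((hmD k k).1 (hs hk))
            · exact hj (hs ((hmD k j).2 hlt))
      · exact Finset.image_subset_iff.2 fun i _ => h3 i
    · rintro rfl
      refine ⟨?_, Finset.mem_insert_self _ _, fun i => Finset.mem_insert_of_mem
        (Finset.mem_image_of_mem D (Finset.mem_univ i)), ?_⟩
      · intro S hS T hT
        rcases Finset.mem_insert.1 hS with rfl | hS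
        · exact Or.inr (Finset.subset_univ _)
        rcases Finset.mem_insert.1 hT with rfl | hT
        · exact Or.inl (Finset.subset_univ _)
        obtain ⟨i, -, rfl⟩ := Finset.mem_image.1 hS
        obtain ⟨j, -, rfl⟩ := Finset.mem_image.1 hT
        rcases le_total (c i) (c j) with hij | hij
        · exact Or.inl fun k hk => (hmD _ _).2 (((hmD _ _).1 hk).trans_le hij)
        · exact Or.inr fun k hk => (hmD _ _).2 (((hmD _ _).1 hk).trans_le hij)
      · intro S hS i j hij hi
        rcases Finset.mem_insert.1 hS with rfl | hS
        · exact Finset.mem_univ _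
        obtain ⟨k, -, rfl⟩ := Finset.mem_image.1 hS
        rw [hmD] at hi ⊢
        rwa [← (h i j).2 hij]
  have hcard : (Finset.univ.image D).card = (Finset.univ.image t).card := by
    have hDt : ∀ i j, D i = D j ↔ t i = t j := by
      intro i j
      rw [← h]
      constructor
      · intro he
        refine le_antisymm (not_lt.1 fun hlt => ?_) (not_lt.1 fun hlt => ?_)
        · exact lt_irrefl _ ((hmD j j).1 (he ▸ (hmD i j).2 hlt))
        · exact lt_irrefl _ ((hmD i i).1 (he.symm ▸ (hmD j i).2 hlt))
      · intro he
        simp only [hD, he]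
    exact le_antisymm (card_image_le_of_imp fun i j => (hDt i j).2)
      (card_image_le_of_imp fun i j => (hDt i j).1)
  -- The full set is not a lower set of any `i`, since `i` is missing from its own lower set; it
  -- accounts for the extra 1 in the exponent.
  rw [huniq, Finset.sum_singleton, Finset.card_insert_of_notMem, hcard, add_comm]
  intro hu
  obtain ⟨i, -, hi⟩ := Finset.mem_image.1 hu
  exact lt_irrefl _ ((hmD i i).1 (hi ▸ Finset.mem_univ i))

/-- Refining `c` by moving one fibre of `t` to the front of its level does not change the
alternating sum. -/
theorem sum_refiningChains_refine (c : Fin n → ℕ) (t : Fin n → Y)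
    (h : ∀ i j, t i = t j → c i = c j) {x y : Fin n} (hc : c x = c y) (ht : t x ≠ t y)
    (c' : Fin n → ℕ)
    (hc' : ∀ i j, c' i < c' j ↔ c i < c j ∨ (c i = c x ∧ c j = c x ∧ t i = t x ∧ t j ≠ t x)) :
    ∑ 𝒞 ∈ refiningChains c t, (-1 : ℚ) ^ 𝒞.card =
      ∑ 𝒞 ∈ refiningChains c' t, (-1 : ℚ) ^ 𝒞.card := by
  classical
  -- `E` is the cut that separates the fibre of `x` from the rest of its level. The chains for `c'`
  -- are the chains for `c` that contain `E`, so the chains avoiding `E` have to cancel.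
  set E : Finset (Fin n) := Finset.univ.filter fun j => c j < c x ∨ t j = t x with hE
  have h1 : refiningChains c' t = (refiningChains c t).filter fun 𝒞 => E ∈ 𝒞 := by
    ext 𝒞
    rw [Finset.mem_filter, mem_refiningChains, mem_refiningChains]
    have hdE : ∀ k, c k = c x → t k ≠ t x → (Finset.univ.filter fun j => c' j < c' k) = E := by
      intro k hk hk'
      ext j
      simp only [Finset.mem_filter, Finset.mem_univ, true_and, hc', hE, hk]
      exact or_congr Iff.rfl ⟨fun h => h.2.1, fun h' => ⟨h _ _ h', h', hk'⟩⟩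
    have hd : ∀ k, ¬ (c k = c x ∧ t k ≠ t x) →
        (Finset.univ.filter fun j => c' j < c' k) = Finset.univ.filter fun j => c j < c k := by
      intro k hk
      ext j
      simp only [Finset.mem_filter, Finset.mem_univ, true_and, hc']
      tauto
    have hdx : (Finset.univ.filter fun j => c' j < c' x) = Finset.univ.filter fun j => c j < c x :=
      hd x (by simp)
    constructor
    · rintro ⟨a1, a2, a3, a4⟩
      refine ⟨⟨a1, a2, fun i => ?_, a4⟩, ?_⟩
      · by_cases hi : c i = c x
        · rw [hi, ← hdx]
          exact a3 x
        · rw [← hd i fun h => hi h.1]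
          exact a3 i
      · rw [← hdE y hc.symm ht.symm]
        exact a3 y
    · rintro ⟨⟨a1, a2, a3, a4⟩, a5⟩
      refine ⟨a1, a2, fun i => ?_, a4⟩
      by_cases hi : c i = c x ∧ t i ≠ t x
      · rw [hdE i hi.1 hi.2]
        exact a5
      · rw [hd i hi]
        exact a3 i
  rw [h1, ← Finset.sum_filter_add_sum_filter_not (refiningChains c t) (fun 𝒞 => E ∈ 𝒞),
    add_eq_left]
  -- `T 𝒞` is the smallest member of the chain that contains `x`, and `U 𝒞` is `T 𝒞` without the
  -- fibre of `x`. Inserting or deleting `U 𝒞` is the sign-reversing involution: it splits the fibre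
  -- of `x` from its block or merges it with the preceding one.
  set T : Finset (Finset (Fin n)) → Finset (Fin n) := fun 𝒞 =>
    Finset.univ.filter fun j => ∀ S ∈ 𝒞, x ∈ S → j ∈ S with hT
  set U : Finset (Finset (Fin n)) → Finset (Fin n) := fun 𝒞 =>
    (T 𝒞).filter fun j => t j ≠ t x with hU
  have hmT : ∀ 𝒞 j, j ∈ T 𝒞 ↔ ∀ S ∈ 𝒞, x ∈ S → j ∈ S := by simp [hT]
  have hmU : ∀ 𝒞 j, j ∈ U 𝒞 ↔ j ∈ T 𝒞 ∧ t j ≠ t x := by simp [hU]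
  have hxU : ∀ 𝒞, x ∉ U 𝒞 := fun 𝒞 hx => ((hmU _ _).1 hx).2 rfl
  have hTmem : ∀ 𝒞 ∈ refiningChains c t, T 𝒞 ∈ 𝒞 := by
    intro 𝒞 h𝒞
    rw [mem_refiningChains] at h𝒞
    obtain ⟨a1, a2, a3, a4⟩ := h𝒞
    obtain ⟨S, hS, hmin⟩ := Finset.exists_min_image (𝒞.filter fun S => x ∈ S) Finset.card
      ⟨_, Finset.mem_filter.2 ⟨a2, Finset.mem_univ _⟩⟩
    rw [Finset.mem_filter] at hS
    have : T 𝒞 = S := by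
      ext j
      rw [hmT]
      constructor
      · exact fun h => h S hS.1 hS.2
      · intro hj S' hS' hx
        rcases a1 S hS.1 S' hS' with h | h
        · exact h hj
        · rwa [Finset.eq_of_subset_of_card_le h (hmin S' (Finset.mem_filter.2 ⟨hS', hx⟩))]
    rw [this]
    exact hS.1
  -- The involution must not delete a compulsory member. The only lower set that could equal `U 𝒞`
  -- is that of the level of `x`; then `T 𝒞 = E`, which is excluded.
  have hne : ∀ 𝒞 ∈ refiningChains c t, E ∉ 𝒞 → ∀ i,
      (Finset.univ.filter fun j => c j < c i) ≠ U 𝒞 := by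
    intro 𝒞 h𝒞 hE𝒞 i hi
    have hT𝒞 := hTmem 𝒞 h𝒞
    rw [mem_refiningChains] at h𝒞
    obtain ⟨a1, a2, a3, a4⟩ := h𝒞
    have hxT : x ∈ T 𝒞 := (hmT _ _).2 fun S _ h => h
    have hmi : ∀ j, c j < c i ↔ j ∈ T 𝒞 ∧ t j ≠ t x := fun j => by
      rw [← hmU, ← hi]
      simp
    have hxi : ¬ c x < c i := fun hlt => ((hmi x).1 hlt).2 rfl
    rcases (not_lt.1 hxi).lt_or_eq with hlt | he
    · have hiT : i ∈ T 𝒞 := by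
        rcases a1 _ hT𝒞 _ (a3 x) with hs | hs
        · exact absurd (hs hxT) (by simp)
        · exact hs (by simpa using hlt)
      exact lt_irrefl _ ((hmi i).2 ⟨hiT, fun he => hlt.ne (h _ _ he)⟩)
    · refine hE𝒞 ?_
      have : E = T 𝒞 := by
        ext j
        simp only [hE, Finset.mem_filter, Finset.mem_univ, true_and, ← he, hmi]
        constructor
        · rintro (h | h)
          · exact h.1
          · exact a4 _ hT𝒞 x j h.symm hxT
        · intro hj
          by_cases h : t j = t x
          · exact Or.inr h
          · exact Or.inl ⟨hj, h⟩
      rw [this]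
      exact hT𝒞
  have hmem : ∀ (𝒞 : Finset (Finset (Fin n))) (S), S ≠ U 𝒞 →
      (S ∈ symmDiff 𝒞 {U 𝒞} ↔ S ∈ 𝒞) := by
    intro 𝒞 S hS
    simp [Finset.mem_symmDiff, hS]
  -- Since `x ∉ U 𝒞`, toggling it does not change the members containing `x`, so `T` and `U` stay
  -- the same and the map is an involution.
  have hTinv : ∀ 𝒞, T (symmDiff 𝒞 {U 𝒞}) = T 𝒞 := by
    intro 𝒞
    ext j
    rw [hmT, hmT]
    refine forall_congr' fun S => ?_
    by_cases hS : S = U 𝒞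
    · subst hS
      simp [hxU]
    · rw [hmem _ _ hS]
  have hUinv : ∀ 𝒞, U (symmDiff 𝒞 {U 𝒞}) = U 𝒞 := by
    intro 𝒞
    ext j
    rw [hmU, hmU, hTinv]
  refine Finset.sum_involution (fun 𝒞 _ => symmDiff 𝒞 {U 𝒞}) ?_ ?_ ?_ ?_
  · intro 𝒞 _
    by_cases hU𝒞 : U 𝒞 ∈ 𝒞
    · have : symmDiff 𝒞 {U 𝒞} = 𝒞.erase (U 𝒞) := by
        ext S
        by_cases hS : S = U 𝒞 <;> simp [Finset.mem_symmDiff, hS, hU𝒞]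
      rw [this, ← Finset.card_erase_add_one hU𝒞]
      ring
    · have : symmDiff 𝒞 {U 𝒞} = insert (U 𝒞) 𝒞 := by
        ext S
        by_cases hS : S = U 𝒞 <;> simp [Finset.mem_symmDiff, hS, hU𝒞]
      rw [this, Finset.card_insert_of_notMem hU𝒞]
      ring
  · intro 𝒞 _ _ he
    have := symmDiff_eq_left.1 he
    simp at this
  · intro 𝒞 h𝒞
    rw [Finset.mem_filter] at h𝒞 ⊢
    obtain ⟨h𝒞, hE𝒞⟩ := h𝒞
    have hT𝒞 := hTmem 𝒞 h𝒞
    have hne' := hne 𝒞 h𝒞 hE𝒞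
    rw [mem_refiningChains] at h𝒞 ⊢
    obtain ⟨a1, a2, a3, a4⟩ := h𝒞
    have hxT : x ∈ T 𝒞 := (hmT _ _).2 fun S _ h => h
    have hsub : ∀ S ∈ symmDiff 𝒞 {U 𝒞}, S = U 𝒞 ∨ S ∈ 𝒞 := by
      intro S hS
      by_cases he : S = U 𝒞
      · exact Or.inl he
      · exact Or.inr ((hmem _ _ he).1 hS)
    -- Members containing `x` contain `T 𝒞`; members without `x` lie in `T 𝒞` and, being stable,
    -- miss the whole fibre of `x`.
    have hcomp : ∀ S ∈ 𝒞, S ⊆ U 𝒞 ∨ U 𝒞 ⊆ S := by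
      intro S hS
      by_cases hx : x ∈ S
      · exact Or.inr fun j hj => (hmT _ _).1 ((hmU _ _).1 hj).1 S hS hx
      · refine Or.inl fun j hj => (hmU _ _).2 ⟨?_, fun he => hx (a4 S hS j x he hj)⟩
        rcases a1 S hS _ hT𝒞 with hs | hs
        · exact hs hj
        · exact absurd (hs hxT) hx
    refine ⟨⟨?_, ?_, ?_, ?_⟩, ?_⟩
    · intro S hS S' hS'
      rcases hsub S hS with rfl | hS
      · rcases hsub S' hS' with rfl | hS'
        · exact Or.inl (Finset.Subset.refl _)
        · exact (hcomp S' hS').symm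
      · rcases hsub S' hS' with rfl | hS'
        · exact hcomp S hS
        · exact a1 S hS S' hS'
    · exact (hmem _ _ fun he => hxU 𝒞 (he ▸ Finset.mem_univ x)).2 a2
    · exact fun i => (hmem _ _ (hne' i)).2 (a3 i)
    · intro S hS i j hij hi
      rcases hsub S hS with rfl | hS
      · rw [hmU] at hi ⊢
        exact ⟨a4 _ hT𝒞 i j hij hi.1, hij ▸ hi.2⟩
      · exact a4 S hS i j hij hi
    · rw [hmem]
      · exact hE𝒞
      · intro he
        refine hxU 𝒞 (he ▸ ?_)
        simp [hE]
  · intro 𝒞 _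
    simp only [hUinv]
    exact symmDiff_symmDiff_cancel_right _ _

/-- As long as a level of `c` contains two fibres of `t`, `c` can be refined without changing the
sum. The number of pairs on a common level drops each time, until levels and fibres agree and one
chain remains. -/
theorem sum_refiningChains [DecidableEq Y] (c : Fin n → ℕ) (t : Fin n → Y)
    (h : ∀ i j, t i = t j → c i = c j) :
    ∑ 𝒞 ∈ refiningChains c t, (-1 : ℚ) ^ 𝒞.card = (-1) ^ (1 + (Finset.univ.image t).card) := by
  suffices ∀ (N : ℕ) (c : Fin n → ℕ), (∀ i j, t i = t j → c i = c j) →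
      (Finset.univ.filter fun p : Fin n × Fin n => c p.1 = c p.2).card = N →
      ∑ 𝒞 ∈ refiningChains c t, (-1 : ℚ) ^ 𝒞.card = (-1) ^ (1 + (Finset.univ.image t).card) from
    this _ c h rfl
  intro N
  induction N using Nat.strong_induction_on with
  | _ N ih =>
    rintro c h rfl
    by_cases hall : ∀ i j, c i = c j → t i = t j
    · exact sum_refiningChains_of_iff c t fun i j => ⟨hall i j, h i j⟩
    · push Not at hall
      obtain ⟨x, y, hxy, hne⟩ := hall
      -- Doubling makes room between the levels: on the level of `x`, the fibre of `x` keeps the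
      -- even value and everything else moves one up.
      let c' : Fin n → ℕ := fun i => 2 * c i + if c i = c x ∧ t i ≠ t x then 1 else 0
      have hc' : ∀ i, c' i = 2 * c i + if c i = c x ∧ t i ≠ t x then 1 else 0 := fun _ => rfl
      rw [sum_refiningChains_refine c t h hxy hne c']
      · refine ih _ (Finset.card_lt_card (Finset.ssubset_iff_of_subset ?_ |>.2
          ⟨(x, y), ?_, ?_⟩)) c' ?_ rfl
        · intro p
          simp only [Finset.mem_filter, Finset.mem_univ, true_and, hc']
          intro hp
          split_ifs at hp <;> omega
        · simpa using hxy
        · simp only [Finset.mem_filter, Finset.mem_univ, true_and, hc']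
          rw [if_neg (by simp), if_pos ⟨hxy.symm, hne.symm⟩]
          omega
        · intro i j hij
          rw [hc', hc', h i j hij, hij]
      · intro i j
        rw [hc', hc']
        by_cases h1 : t i = t x <;> by_cases h2 : t j = t x <;> by_cases h3 : c i = c x <;>
          by_cases h4 : c j = c x <;> simp [h1, h2, h3, h4] <;> omega

end Chains

/-! ## Enriched colourings of paths as alternating sums of proper colourings -/

section ChainWords

variable {n : ℕ}

open Classical in
/-- The word that numbers the blocks of the set composition of a chain of sets. -/
def chainWord (𝒞 : Finset (Finset (Fin n))) (i : Fin n) : ℕ+ :=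
  Nat.succPNat (𝒞.filter fun S => i ∉ S).card

/-- The members of a chain that omit `i` and those that omit `j` form nested families, so comparing
their sizes is the same as comparing the families. -/
theorem chainWord_le_iff {𝒞 : Finset (Finset (Fin n))} (h : ∀ S ∈ 𝒞, ∀ T ∈ 𝒞, S ⊆ T ∨ T ⊆ S)
    (i j : Fin n) : chainWord 𝒞 i ≤ chainWord 𝒞 j ↔ ∀ S ∈ 𝒞, j ∈ S → i ∈ S := by
  classical
  unfold chainWord
  rw [Nat.succPNat_le_succPNat]
  constructor
  · intro hle S hS hj
    by_contra hi
    refine absurd hle (not_le.2 (Finset.card_lt_card (Finset.ssubset_iff_of_subset ?_ |>.2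
      ⟨S, by simp [hS, hi], by simp [hj]⟩)))
    intro T hT
    rw [Finset.mem_filter] at hT ⊢
    refine ⟨hT.1, fun hiT => ?_⟩
    rcases h S hS T hT.1 with hs | hs
    · exact hT.2 (hs hj)
    · exact hi (hs hiT)
  · intro hall
    refine Finset.card_le_card fun S hS => ?_
    rw [Finset.mem_filter] at hS ⊢
    exact ⟨hS.1, fun hj => hS.2 (hall S hS.1 hj)⟩

theorem chainWord_lt_iff {𝒞 : Finset (Finset (Fin n))} (h : ∀ S ∈ 𝒞, ∀ T ∈ 𝒞, S ⊆ T ∨ T ⊆ S)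
    (i j : Fin n) : chainWord 𝒞 i < chainWord 𝒞 j ↔ ∃ S ∈ 𝒞, i ∈ S ∧ j ∉ S := by
  rw [← not_le, chainWord_le_iff h]
  push Not
  rfl

/-- The set of the first `m` letters of `σ`. -/
def initialSegment (σ : Equiv.Perm (Fin n)) (m : ℕ) : Finset (Fin n) :=
  Finset.univ.filter fun j => (σ.symm j).val < m

theorem mem_initialSegment (σ : Equiv.Perm (Fin n)) (m : ℕ) (j : Fin n) :
    σ j ∈ initialSegment σ m ↔ j.val < m := by
  simp [initialSegment]

theorem initialSegment_injOn (σ : Equiv.Perm (Fin n)) :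
    Set.InjOn (initialSegment σ) (Set.Iic n) := by
  have key : ∀ a b : ℕ, b ≤ n → a < b → initialSegment σ a ≠ initialSegment σ b := by
    intro a b hb hab he
    have := (mem_initialSegment σ b ⟨a, by omega⟩).2 hab
    rw [← he, mem_initialSegment] at this
    exact lt_irrefl _ this
  intro a ha b hb he
  rcases lt_trichotomy a b with h | h | h
  · exact absurd he (key a b hb h)
  · exact h
  · exact absurd he.symm (key b a ha h)

/-- Sets that are closed downward along `σ` are initial segments. -/
theorem exists_initialSegment (σ : Equiv.Perm (Fin n)) (S : Finset (Fin n))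
    (h : ∀ i j, i ≤ j → σ j ∈ S → σ i ∈ S) : ∃ m ≤ n, S = initialSegment σ m := by
  by_cases hall : ∀ i, σ i ∈ S
  · refine ⟨n, le_rfl, Finset.ext fun i => ?_⟩
    obtain ⟨i, rfl⟩ := σ.surjective i
    rw [mem_initialSegment]
    exact iff_of_true (hall i) i.2
  · push Not at hall
    -- `m` is the first position whose letter lies outside `S`.
    obtain ⟨m, hm, hmin⟩ := WellFounded.has_min (wellFounded_lt (α := Fin n)) {i | σ i ∉ S} hall
    refine ⟨m, m.2.le, Finset.ext fun i => ?_⟩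
    obtain ⟨i, rfl⟩ := σ.surjective i
    rw [mem_initialSegment]
    constructor
    · intro hi
      by_contra hlt
      exact hm (h m i (not_lt.1 hlt) hi)
    · intro hlt
      by_contra hi
      exact hmin i hi hlt

theorem monotone_of_le_succ {X : Type*} [Preorder X] {g : Fin n → X}
    (h : ∀ (k : ℕ) (hk : k + 1 < n), g ⟨k, Nat.lt_of_succ_lt hk⟩ ≤ g ⟨k + 1, hk⟩) :
    Monotone g := by
  cases n with
  | zero => exact fun a => a.elim0
  | succ n => exact Fin.monotone_iff_le_succ.2 fun i => h i.val (Nat.succ_lt_succ i.2)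

-- The hypothesis says that the fibres of `g` are intervals. The positions `m < n` that are counted
-- are the first elements of the fibres, and the end position `m = n` gives the additional 1.
open Classical in
theorem card_positions {X : Type*} [DecidableEq X] (g : Fin n → X)
    (hg : ∀ i j k, i ≤ k → k ≤ j → g i = g j → g k = g i) :
    ((Finset.range (n + 1)).filter fun m => ¬ ∃ (k : ℕ) (h : k + 1 < n),
      m = k + 1 ∧ g ⟨k, Nat.lt_of_succ_lt h⟩ = g ⟨k + 1, h⟩).card =
      1 + (Finset.univ.image g).card := by
  rw [Finset.range_add_one, Finset.filter_insert, if_pos, Finset.card_insert_of_notMem, add_comm]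
  · congr 1
    refine Finset.card_bij (fun m hm => g ⟨m, Finset.mem_range.1 (Finset.mem_filter.1 hm).1⟩)
      (fun m hm => Finset.mem_image_of_mem _ (Finset.mem_univ _)) ?_ ?_
    · have key : ∀ (a b : ℕ) (ha : a < n) (hb : b < n), (¬ ∃ (k : ℕ) (h : k + 1 < n),
          b = k + 1 ∧ g ⟨k, Nat.lt_of_succ_lt h⟩ = g ⟨k + 1, h⟩) → a < b →
          g ⟨a, ha⟩ ≠ g ⟨b, hb⟩ := by
        rintro a b ha hb hno hab he
        obtain ⟨k, rfl⟩ : ∃ k, b = k + 1 := ⟨b - 1, by omega⟩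
        refine hno ⟨k, hb, rfl, ?_⟩
        rw [← he]
        exact hg _ _ _ (Fin.mk_le_mk.2 (by omega)) (Fin.mk_le_mk.2 (Nat.le_succ k)) he
      intro a ha b hb he
      rw [Finset.mem_filter, Finset.mem_range] at ha hb
      rcases lt_trichotomy a b with h | h | h
      · exact absurd he (key a b ha.1 hb.1 hb.2 h)
      · exact h
      · exact absurd he.symm (key b a hb.1 ha.1 ha.2 h)
    · intro y hy
      obtain ⟨i, -, rfl⟩ := Finset.mem_image.1 hy
      obtain ⟨m, hm, hmin⟩ := WellFounded.has_min (wellFounded_lt (α := Fin n))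
        {j | g j = g i} ⟨i, rfl⟩
      refine ⟨m, Finset.mem_filter.2 ⟨Finset.mem_range.2 m.2, ?_⟩, hm⟩
      rintro ⟨k, hk, he, hgk⟩
      have hm' : m = ⟨k + 1, hk⟩ := Fin.ext he
      refine hmin ⟨k, Nat.lt_of_succ_lt hk⟩ ?_ ?_
      · change g _ = g i
        rw [hgk, ← hm']
        exact hm
      · rw [hm']
        exact Fin.mk_lt_mk.2 (Nat.lt_succ_self k)
  · simp
  · rintro ⟨k, hk, he, -⟩
    omega

/-- If `L` is properly contained in `H`, toggling an element of `H \ L` cancels all terms; if `L` is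
not contained in `H`, the interval is empty. -/
theorem sum_Icc_neg_one_pow_card {X : Type*} [DecidableEq X] (L H : Finset X) :
    ∑ B ∈ Finset.Icc L H, (-1 : ℚ) ^ B.card = if L = H then (-1) ^ H.card else 0 := by
  split_ifs with he
  · rw [he, Finset.Icc_self, Finset.sum_singleton]
  · by_cases hLH : L ⊆ H
    · obtain ⟨a, haH, haL⟩ := Finset.exists_of_ssubset (lt_of_le_of_ne hLH he)
      refine Finset.sum_involution (fun B _ => symmDiff B {a}) ?_ ?_ ?_ ?_
      · intro B _
        by_cases ha : a ∈ B
        · have : symmDiff B {a} = B.erase a := by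
            ext b
            by_cases hb : b = a <;> simp [Finset.mem_symmDiff, hb, ha]
          rw [this, ← Finset.card_erase_add_one ha]
          ring
        · have : symmDiff B {a} = insert a B := by
            ext b
            by_cases hb : b = a <;> simp [Finset.mem_symmDiff, hb, ha]
          rw [this, Finset.card_insert_of_notMem ha]
          ring
      · intro B _ _ he
        have := symmDiff_eq_left.1 he
        simp at this
      · intro B hB
        rw [Finset.mem_Icc] at hB ⊢
        constructor
        · intro b hb
          have : b ≠ a := fun h => haL (h ▸ hb)
          simp [Finset.mem_symmDiff, this, hB.1 hb]
        · intro b hb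
          rcases Finset.mem_symmDiff.1 hb with h | h
          · exact hB.2 h.1
          · rwa [Finset.mem_singleton.1 h.1]
      · intro B _
        exact symmDiff_symmDiff_cancel_right _ _
    · rw [Finset.Icc_eq_empty hLH, Finset.sum_empty]

theorem isProper_path (A : Finset ℕ) (σ : Equiv.Perm (Fin n)) (κ : Fin n → ℕ+) :
    (path A σ).IsProper κ ↔ ∀ (k : ℕ) (h : k + 1 < n),
      κ (σ ⟨k, Nat.lt_of_succ_lt h⟩) ≤ κ (σ ⟨k + 1, h⟩) ∧
      (k + 1 ∈ A → κ (σ ⟨k, Nat.lt_of_succ_lt h⟩) < κ (σ ⟨k + 1, h⟩)) := by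
  constructor
  · rintro ⟨h1, h2⟩ k h
    have h3 : k + 1 ∈ A → κ (σ ⟨k, Nat.lt_of_succ_lt h⟩) < κ (σ ⟨k + 1, h⟩) :=
      fun hk => h2 _ _ ⟨k, h, hk, rfl, rfl⟩
    refine ⟨?_, h3⟩
    by_cases hk : k + 1 ∈ A
    · exact (h3 hk).le
    · exact h1 _ _ ⟨k, h, hk, rfl, rfl⟩
  · intro h
    constructor
    · rintro a b ⟨k, hk, hA, rfl, rfl⟩
      exact (h k hk).1
    · rintro a b ⟨k, hk, hA, rfl, rfl⟩
      exact (h k hk).2 hA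

theorem isEnriched_path (A : Finset ℕ) (σ : Equiv.Perm (Fin n)) (c : Fin n → SignedColour) :
    (path A σ).IsEnriched c ↔ ∀ (k : ℕ) (h : k + 1 < n),
      c (σ ⟨k, Nat.lt_of_succ_lt h⟩) ≤ c (σ ⟨k + 1, h⟩) ∧
      (c (σ ⟨k, Nat.lt_of_succ_lt h⟩) = c (σ ⟨k + 1, h⟩) →
        (SignedColour.IsPos (c (σ ⟨k, Nat.lt_of_succ_lt h⟩)) ↔ k + 1 ∉ A)) := by
  have hpn : ∀ d : SignedColour, SignedColour.IsNeg d ↔ ¬ SignedColour.IsPos d := fun d => by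
    simp [SignedColour.IsPos, SignedColour.IsNeg]
  constructor
  · rintro ⟨h1, h2⟩ k h
    by_cases hk : k + 1 ∈ A
    · have := h2 _ _ ⟨k, h, hk, rfl, rfl⟩
      rw [hpn] at this
      rcases this with h3 | h3
      · exact ⟨h3.le, fun he => absurd he h3.ne⟩
      · exact ⟨h3.1.le, fun _ => iff_of_false h3.2 (not_not.2 hk)⟩
    · rcases h1 _ _ ⟨k, h, hk, rfl, rfl⟩ with h3 | h3
      · exact ⟨h3.le, fun he => absurd he h3.ne⟩
      · exact ⟨h3.1.le, fun _ => iff_of_true h3.2 hk⟩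
  · intro h
    constructor
    · rintro a b ⟨k, hk, hA, rfl, rfl⟩
      obtain ⟨h1, h2⟩ := h k hk
      exact h1.lt_or_eq.imp id fun he => ⟨he, (h2 he).2 hA⟩
    · rintro a b ⟨k, hk, hA, rfl, rfl⟩
      obtain ⟨h1, h2⟩ := h k hk
      rw [hpn]
      exact h1.lt_or_eq.imp id fun he => ⟨he, fun hp => (h2 he).1 hp hA⟩

open Classical in
/-- Whether a signed colouring of a path is enriched is an alternating sum over proper colourings
of the path. -/
theorem sum_refiningChains_path {Y : Type*} [DecidableEq Y] (A : Finset ℕ)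
    (σ : Equiv.Perm (Fin n)) (c : Fin n → SignedColour) (r : Fin n → Y)
    (hr : ∀ i j, r i = r j ↔ i = j ∨ (c i = c j ∧ SignedColour.IsPos (c i))) :
    ∑ 𝒞 ∈ refiningChains (fun i => (SignedColour.toColour (c i) : ℕ)) r,
        (-1 : ℚ) ^ 𝒞.card * (path A σ).chromatic (List.ofFn (chainWord 𝒞)) =
      (-1) ^ (1 + (Finset.univ.image r).card) * if (path A σ).IsEnriched c then 1 else 0 := by
  have hlt : ∀ i j, (SignedColour.toColour (c i) : ℕ) < SignedColour.toColour (c j) ↔ c i < c j :=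
    fun i j => by rw [PNat.coe_lt_coe, SignedColour.toColour_strictMono.lt_iff_lt]
  have hlow : ∀ 𝒞 ∈ refiningChains (fun i => (SignedColour.toColour (c i) : ℕ)) r, ∀ i,
      (Finset.univ.filter fun j => c j < c i) ∈ 𝒞 := by
    intro 𝒞 h𝒞 i
    have := (mem_refiningChains.1 h𝒞).2.2.1 i
    simpa only [hlt] using this
  unfold EdgeColouredDigraph.chromatic
  simp only [wordSum_ofFn, mul_ite, mul_one, mul_zero]
  rw [← Finset.sum_filter]
  -- Without monotonicity both sides vanish: at a descent of `c` along the path, a compulsory lower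
  -- set contains the later vertex but not the earlier one, so the chain word descends too.
  by_cases hmono : Monotone (c ∘ σ)
  swap
  · have hex : ∃ (k : ℕ) (h : k + 1 < n),
        c (σ ⟨k + 1, h⟩) < c (σ ⟨k, Nat.lt_of_succ_lt h⟩) := by
      by_contra hno
      push Not at hno
      exact hmono (monotone_of_le_succ hno)
    obtain ⟨k, hk, hck⟩ := hex
    rw [if_neg, Finset.sum_eq_zero]
    · intro 𝒞 h𝒞
      obtain ⟨h𝒞, hp⟩ := Finset.mem_filter.1 h𝒞
      have h1 := ((isProper_path _ _ _).1 hp k hk).1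
      rw [chainWord_le_iff (mem_refiningChains.1 h𝒞).1] at h1
      have h2 := h1 _ (hlow 𝒞 h𝒞 (σ ⟨k, Nat.lt_of_succ_lt hk⟩)) (by simpa using hck)
      simp at h2
    · intro he
      exact absurd ((isEnriched_path _ _ _).1 he k hk).1 (not_le.2 hck)
  -- A chain whose word is proper on the path is a set of cut positions. `L` consists of the cuts
  -- that are forced: the two ends, the strict ascents of `c` and the solid edges. `H` consists of
  -- the cuts that are allowed, namely those not inside a positive level.
  set L : Finset ℕ := (Finset.range (n + 1)).filter fun m => m = 0 ∨ m = n ∨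
    ∃ (k : ℕ) (h : k + 1 < n), m = k + 1 ∧
      (c (σ ⟨k, Nat.lt_of_succ_lt h⟩) < c (σ ⟨k + 1, h⟩) ∨ k + 1 ∈ A) with hL
  set H : Finset ℕ := (Finset.range (n + 1)).filter fun m => ¬ ∃ (k : ℕ) (h : k + 1 < n),
    m = k + 1 ∧ (r ∘ σ) ⟨k, Nat.lt_of_succ_lt h⟩ = (r ∘ σ) ⟨k + 1, h⟩ with hH
  have hrk : ∀ (k : ℕ) (h : k + 1 < n),
      (r ∘ σ) ⟨k, Nat.lt_of_succ_lt h⟩ = (r ∘ σ) ⟨k + 1, h⟩ ↔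
      (c (σ ⟨k, Nat.lt_of_succ_lt h⟩) = c (σ ⟨k + 1, h⟩) ∧
        SignedColour.IsPos (c (σ ⟨k, Nat.lt_of_succ_lt h⟩))) := by
    intro k h
    rw [Function.comp_apply, Function.comp_apply, hr, σ.injective.eq_iff, Fin.mk.injEq]
    exact or_iff_right (by omega)
  have hcardH : H.card = 1 + (Finset.univ.image r).card := by
    rw [hH, card_positions (r ∘ σ) ?_]
    · congr 2
      ext y
      simp only [Finset.mem_image, Finset.mem_univ, true_and, Function.comp_apply]
      exact (σ.surjective.exists (p := fun x => r x = y)).symm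
    · intro i j k hik hkj he
      rw [Function.comp_apply, Function.comp_apply, hr] at he ⊢
      rcases he with he | ⟨he, hpos⟩
      · obtain rfl := σ.injective he
        exact Or.inl (congrArg σ (le_antisymm hkj hik))
      · have h1 : c (σ k) = c (σ i) :=
          le_antisymm ((hmono hkj).trans he.ge) (hmono hik)
        exact Or.inr ⟨h1, h1.symm ▸ hpos⟩
  -- Ends and strict ascents belong to both sets. At a tie, the position is in `L` when the edge is
  -- solid and in `H` when the colour is negative, so equality is the enriched condition.
  have hLH : L = H ↔ (path A σ).IsEnriched c := by
    rw [isEnriched_path]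
    constructor
    · intro he k hk
      have hle := hmono (Fin.mk_le_mk.2 (Nat.le_succ k) :
        (⟨k, Nat.lt_of_succ_lt hk⟩ : Fin n) ≤ ⟨k + 1, hk⟩)
      refine ⟨hle, fun hc => ?_⟩
      have h1 : k + 1 ∈ L ↔ k + 1 ∈ A := by
        rw [hL, Finset.mem_filter, Finset.mem_range]
        constructor
        · rintro ⟨-, h | h | ⟨k', hk', h, h'⟩⟩
          · omega
          · omega
          · obtain rfl : k = k' := by omega
            exact h'.resolve_left fun h => h.ne hc
        · exact fun hA => ⟨by omega, Or.inr (Or.inr ⟨k, hk, rfl, Or.inr hA⟩)⟩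
      have h2 : k + 1 ∈ H ↔ ¬ SignedColour.IsPos (c (σ ⟨k, Nat.lt_of_succ_lt hk⟩)) := by
        rw [hH, Finset.mem_filter, Finset.mem_range]
        constructor
        · rintro ⟨-, h⟩ hp
          exact h ⟨k, hk, rfl, (hrk k hk).2 ⟨hc, hp⟩⟩
        · refine fun hp => ⟨by omega, ?_⟩
          rintro ⟨k', hk', h, h'⟩
          obtain rfl : k = k' := by omega
          exact hp ((hrk k hk').1 h').2
      rw [← h1, he, h2, not_not]
    · intro he
      ext m
      rw [hL, hH, Finset.mem_filter, Finset.mem_filter, and_congr_right_iff]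
      intro hm
      rw [Finset.mem_range] at hm
      constructor
      · rintro (h | h | ⟨k, hk, rfl, h⟩)
        · rintro ⟨k, hk, h', -⟩
          omega
        · rintro ⟨k, hk, h', -⟩
          omega
        · rintro ⟨k', hk', h', h''⟩
          obtain rfl : k = k' := by omega
          rw [hrk] at h''
          rcases h with h | h
          · exact h.ne h''.1
          · exact (((he k hk).2 h''.1).1 h''.2) h
      · intro h
        by_cases h0 : m = 0
        · exact Or.inl h0
        by_cases h1 : m = n
        · exact Or.inr (Or.inl h1)
        obtain ⟨k, rfl⟩ : ∃ k, m = k + 1 := ⟨m - 1, by omega⟩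
        have hk : k + 1 < n := by omega
        refine Or.inr (Or.inr ⟨k, hk, rfl, ?_⟩)
        rcases (he k hk).1.lt_or_eq with h2 | h2
        · exact Or.inl h2
        · refine Or.inr (by_contra fun hA => ?_)
          exact h ⟨k, hk, rfl, (hrk k hk).2 ⟨h2, ((he k hk).2 h2).2 hA⟩⟩
  -- Each set `B` of cuts between `L` and `H` corresponds to the chain of initial segments of `σ`
  -- with lengths in `B`.
  have hsum : ∑ B ∈ Finset.Icc L H, (-1 : ℚ) ^ B.card =
      ∑ 𝒞 ∈ (refiningChains (fun i => (SignedColour.toColour (c i) : ℕ)) r).filter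
        (fun 𝒞 => (path A σ).IsProper (chainWord 𝒞)), (-1 : ℚ) ^ 𝒞.card := by
    have hinj : ∀ B ∈ Finset.Icc L H, Set.InjOn (initialSegment σ) B := by
      intro B hB
      refine (initialSegment_injOn σ).mono fun m hm => ?_
      have := (Finset.mem_filter.1 ((Finset.mem_Icc.1 hB).2 hm)).1
      rw [Finset.mem_range] at this
      exact Nat.lt_succ_iff.1 this
    refine Finset.sum_nbij (fun B => B.image (initialSegment σ)) ?_ ?_ ?_ ?_
    · intro B hB
      have hL' : L ⊆ B := (Finset.mem_Icc.1 hB).1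
      have hH' : B ⊆ H := (Finset.mem_Icc.1 hB).2
      have hchain : ∀ S ∈ B.image (initialSegment σ), ∀ T ∈ B.image (initialSegment σ),
          S ⊆ T ∨ T ⊆ S := by
        intro S hS T hT
        obtain ⟨a, -, rfl⟩ := Finset.mem_image.1 hS
        obtain ⟨b, -, rfl⟩ := Finset.mem_image.1 hT
        rcases le_total a b with h | h
        · exact Or.inl (Finset.monotone_filter_right _ fun j _ hj => lt_of_lt_of_le hj h)
        · exact Or.inr (Finset.monotone_filter_right _ fun j _ hj => lt_of_lt_of_le hj h)
      rw [Finset.mem_filter, mem_refiningChains, isProper_path]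
      refine ⟨⟨hchain, ?_, ?_, ?_⟩, ?_⟩
      · refine Finset.mem_image.2 ⟨n, hL' (by simp [hL]), ?_⟩
        simp [initialSegment]
      · intro i
        simp only [hlt]
        obtain ⟨a, rfl⟩ := σ.surjective i
        obtain ⟨m, hm, he⟩ := exists_initialSegment σ
          (Finset.univ.filter fun j => c j < c (σ a)) (fun i j hij hj => by
            simp only [Finset.mem_filter, Finset.mem_univ, true_and] at hj ⊢
            exact (hmono hij).trans_lt hj)
        have hmem : ∀ b, c (σ b) < c (σ a) ↔ b.val < m := fun b => by
          rw [← mem_initialSegment σ m b, ← he]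
          simp
        rw [he]
        refine Finset.mem_image_of_mem _ (hL' ?_)
        rw [hL, Finset.mem_filter, Finset.mem_range]
        refine ⟨by omega, ?_⟩
        by_cases h0 : m = 0
        · exact Or.inl h0
        by_cases h1 : m = n
        · exact Or.inr (Or.inl h1)
        obtain ⟨k, rfl⟩ : ∃ k, m = k + 1 := ⟨m - 1, by omega⟩
        have hk : k + 1 < n := by omega
        refine Or.inr (Or.inr ⟨k, hk, rfl, Or.inl ?_⟩)
        refine ((hmem ⟨k, Nat.lt_of_succ_lt hk⟩).2 (Nat.lt_succ_self k)).trans_le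
          (not_lt.1 fun h => ?_)
        exact lt_irrefl _ ((hmem ⟨k + 1, hk⟩).1 h)
      · intro S hS i j hij hi
        obtain ⟨m, hm, rfl⟩ := Finset.mem_image.1 hS
        obtain ⟨a, rfl⟩ := σ.surjective i
        obtain ⟨b, rfl⟩ := σ.surjective j
        rw [mem_initialSegment] at hi ⊢
        by_contra hb
        rcases (hr _ _).1 hij with he | ⟨he, hpos⟩
        · obtain rfl := σ.injective he
          exact hb hi
        · obtain ⟨k, rfl⟩ : ∃ k, m = k + 1 := ⟨m - 1, by omega⟩
          have hk : k + 1 < n := by omega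
          have h1 : c (σ a) ≤ c (σ ⟨k, Nat.lt_of_succ_lt hk⟩) :=
            hmono (Fin.le_def.2 (Nat.lt_succ_iff.1 hi))
          have h2 : c (σ ⟨k, Nat.lt_of_succ_lt hk⟩) ≤ c (σ ⟨k + 1, hk⟩) :=
            hmono (Fin.le_def.2 (Nat.le_succ k))
          have h3 : c (σ ⟨k + 1, hk⟩) ≤ c (σ b) := hmono (Fin.le_def.2 (not_lt.1 hb))
          have h4 : c (σ ⟨k, Nat.lt_of_succ_lt hk⟩) = c (σ a) :=
            le_antisymm ((h2.trans h3).trans he.ge) h1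
          have h5 : c (σ ⟨k, Nat.lt_of_succ_lt hk⟩) = c (σ ⟨k + 1, hk⟩) :=
            le_antisymm h2 ((h3.trans he.ge).trans h1)
          exact (Finset.mem_filter.1 (hH' hm)).2 ⟨k, hk, rfl, (hrk k hk).2 ⟨h5, h4.symm ▸ hpos⟩⟩
      · intro k hk
        rw [chainWord_le_iff hchain, chainWord_lt_iff hchain]
        constructor
        · intro S hS
          obtain ⟨m, -, rfl⟩ := Finset.mem_image.1 hS
          rw [mem_initialSegment, mem_initialSegment]
          exact Nat.lt_of_succ_lt
        · intro hA
          refine ⟨initialSegment σ (k + 1), Finset.mem_image_of_mem _ (hL' ?_), ?_, ?_⟩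
          · rw [hL, Finset.mem_filter, Finset.mem_range]
            exact ⟨by omega, Or.inr (Or.inr ⟨k, hk, rfl, Or.inr hA⟩)⟩
          · exact (mem_initialSegment _ _ _).2 (Nat.lt_succ_self k)
          · rw [mem_initialSegment]
            exact lt_irrefl _
    · have key : ∀ B ∈ Finset.Icc L H, ∀ B' ∈ Finset.Icc L H,
          B.image (initialSegment σ) = B'.image (initialSegment σ) → B ⊆ B' := by
        intro B hB B' hB' he m hm
        have hle : ∀ B ∈ Finset.Icc L H, ∀ m ∈ B, m ∈ Set.Iic n := by
          intro B hB m hm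
          have := (Finset.mem_filter.1 ((Finset.mem_Icc.1 hB).2 hm)).1
          rw [Finset.mem_range] at this
          exact Nat.lt_succ_iff.1 this
        have h1 := Finset.mem_image_of_mem (initialSegment σ) hm
        rw [he] at h1
        obtain ⟨m', hm', he'⟩ := Finset.mem_image.1 h1
        rwa [← initialSegment_injOn σ (hle B' hB' m' hm') (hle B hB m hm) he']
      intro B hB B' hB' he
      exact Finset.Subset.antisymm (key B hB B' hB' he) (key B' hB' B hB he.symm)
    · intro 𝒞 h𝒞
      obtain ⟨h𝒞, hp⟩ := Finset.mem_filter.1 h𝒞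
      have hlow' := hlow 𝒞 h𝒞
      obtain ⟨a1, a2, a3, a4⟩ := mem_refiningChains.1 h𝒞
      rw [isProper_path] at hp
      have hseg : ∀ S ∈ 𝒞, ∃ m ≤ n, S = initialSegment σ m := by
        intro S hS
        refine exists_initialSegment σ S fun i j hij hj => ?_
        have hm : Monotone (chainWord 𝒞 ∘ σ) := monotone_of_le_succ fun k hk => (hp k hk).1
        exact (chainWord_le_iff a1 _ _).1 (hm hij) S hS hj
      refine ⟨(Finset.range (n + 1)).filter fun m => initialSegment σ m ∈ 𝒞,
        Finset.mem_Icc.2 ⟨?_, ?_⟩, ?_⟩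
      · intro m hm
        rw [hL, Finset.mem_filter] at hm
        refine Finset.mem_filter.2 ⟨hm.1, ?_⟩
        have hn : initialSegment σ n ∈ 𝒞 := by
          convert a2 using 1
          simp [initialSegment]
        rcases hm.2 with rfl | rfl | ⟨k, hk, rfl, h | h⟩
        -- The empty segment is the lower set of the first vertex if there is one; for `n = 0` it
        -- coincides with the full set.
        · rcases Nat.eq_zero_or_pos n with h0 | h0
          · rwa [show initialSegment σ 0 = initialSegment σ n from congrArg _ h0.symm]
          · convert hlow' (σ ⟨0, h0⟩) using 1
            ext j
            obtain ⟨j, rfl⟩ := σ.surjective j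
            rw [mem_initialSegment]
            simp only [Finset.mem_filter, Finset.mem_univ, true_and]
            exact iff_of_false (Nat.not_lt_zero _)
              (not_lt.2 (hmono (Fin.le_def.2 (Nat.zero_le _))))
        · exact hn
        · convert hlow' (σ ⟨k + 1, hk⟩) using 1
          ext j
          obtain ⟨j, rfl⟩ := σ.surjective j
          rw [mem_initialSegment]
          simp only [Finset.mem_filter, Finset.mem_univ, true_and]
          constructor
          · intro hj
            exact lt_of_le_of_lt (hmono (Fin.le_def.2 (Nat.lt_succ_iff.1 hj) :
              j ≤ ⟨k, Nat.lt_of_succ_lt hk⟩)) h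
          · intro hj
            by_contra hlt'
            exact absurd hj (not_lt.2 (hmono (Fin.le_def.2 (not_lt.1 hlt'))))
        · obtain ⟨S, hS, h1, h2⟩ := (chainWord_lt_iff a1 _ _).1 ((hp k hk).2 h)
          obtain ⟨m, -, rfl⟩ := hseg S hS
          rw [mem_initialSegment] at h1 h2
          obtain rfl : m = k + 1 := by
            simp only at h1 h2
            omega
          exact hS
      · intro m hm
        obtain ⟨hm, hm𝒞⟩ := Finset.mem_filter.1 hm
        refine Finset.mem_filter.2 ⟨hm, ?_⟩
        rintro ⟨k, hk, rfl, he⟩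
        have := a4 _ hm𝒞 _ _ he ((mem_initialSegment _ _ _).2 (Nat.lt_succ_self k))
        rw [mem_initialSegment] at this
        exact lt_irrefl _ this
      · ext S
        rw [Finset.mem_image]
        constructor
        · rintro ⟨m, hm, rfl⟩
          exact (Finset.mem_filter.1 hm).2
        · intro hS
          obtain ⟨m, hm, rfl⟩ := hseg S hS
          exact ⟨m, Finset.mem_filter.2 ⟨Finset.mem_range.2 (Nat.lt_succ_iff.2 hm), hS⟩, rfl⟩
    · intro B hB
      rw [Finset.card_image_of_injOn (hinj B hB)]
  rw [← hsum, sum_Icc_neg_one_pow_card, hcardH]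
  simp only [hLH]
end ChainWords

/-! ## The labelled descent-to-peak map on power sums -/

section Theta

variable {n : ℕ}

/-- The key `inl (f i)` for `i ∈ N` and `inr (κ i)` otherwise. -/
def levelKey {X : Type} (f : Fin n → X) (κ : Fin n → ℕ+) (N : Finset (Fin n)) (i : Fin n) :
    X ⊕ ℕ+ :=
  if i ∈ N then Sum.inl (f i) else Sum.inr (κ i)

theorem levelKey_eq_iff {X : Type} (f : Fin n → X) (κ : Fin n → ℕ+) (N : Finset (Fin n))
    (i j : Fin n) : levelKey f κ N i = levelKey f κ N j ↔
      (i ∈ N ∧ j ∈ N ∧ f i = f j) ∨ (i ∉ N ∧ j ∉ N ∧ κ i = κ j) := by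
  unfold levelKey
  by_cases hi : i ∈ N <;> by_cases hj : j ∈ N <;> simp [hi, hj]

theorem card_image_levelKey {X : Type} [DecidableEq X] (f : Fin n → X) (κ : Fin n → ℕ+)
    (N : Finset (Fin n)) :
    (Finset.univ.image (levelKey f κ N)).card = (N.image f).card + (Nᶜ.image κ).card := by
  rw [← Finset.card_disjSum]
  congr 1
  ext y
  rw [Finset.mem_disjSum]
  simp only [Finset.mem_image, Finset.mem_univ, true_and, Finset.mem_compl]
  constructor
  · rintro ⟨i, rfl⟩
    unfold levelKey
    by_cases hi : i ∈ N
    · exact Or.inl ⟨f i, ⟨i, hi, rfl⟩, by rw [if_pos hi]⟩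
    · exact Or.inr ⟨κ i, ⟨i, hi, rfl⟩, by rw [if_neg hi]⟩
  · rintro (⟨_, ⟨i, hi, rfl⟩, rfl⟩ | ⟨_, ⟨i, hi, rfl⟩, rfl⟩)
    · exact ⟨i, if_pos hi⟩
    · exact ⟨i, if_neg hi⟩

/-- The coefficient of the word `κ` after applying the descent-to-peak map, as a combination of
coefficients. -/
def peakCoeff (κ : Fin n → ℕ+) : NCSeries →ₗ[ℚ] ℚ :=
  ∑ N : Finset (Fin n), ((-1 : ℚ) ^ (1 + (Finset.univ.image (levelKey id κ N)).card)) •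
    ∑ 𝒞 ∈ refiningChains (fun i => (SignedColour.toColour (signedColouring κ N i) : ℕ))
      (levelKey id κ N), ((-1 : ℚ) ^ 𝒞.card) • NCSeries.coeff (List.ofFn (chainWord 𝒞))

theorem peakCoeff_apply (κ : Fin n → ℕ+) (f : NCSeries) : peakCoeff κ f =
    ∑ N : Finset (Fin n), (-1 : ℚ) ^ (1 + (Finset.univ.image (levelKey id κ N)).card) *
      ∑ 𝒞 ∈ refiningChains (fun i => (SignedColour.toColour (signedColouring κ N i) : ℕ))
        (levelKey id κ N), (-1 : ℚ) ^ 𝒞.card * f (List.ofFn (chainWord 𝒞)) := by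
  simp [peakCoeff, LinearMap.sum_apply]

/-- For each `N`, the inner sum is the indicator that the signed colouring is enriched, up to a sign
that the prefactor cancels. -/
theorem peakCoeff_F (φ : StandardPair n) (κ : Fin n → ℕ+) :
    peakCoeff κ φ.F = φ.K (List.ofFn κ) := by
  classical
  unfold StandardPair.F StandardPair.K
  rw [peakCoeff_apply, enriched_ofFn]
  refine Finset.sum_congr rfl fun N _ => ?_
  rw [sum_refiningChains_path φ.A φ.σ (signedColouring κ N) (levelKey id κ N), ← mul_assoc,
    ← mul_pow]
  · simp
  · intro i j
    rw [levelKey_eq_iff, isPos_signedColouring, signedColouring_eq_iff]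
    simp only [id]
    constructor
    · rintro (⟨-, -, h⟩ | ⟨h1, h2, h3⟩)
      · exact Or.inl h
      · exact Or.inr ⟨⟨h3, iff_of_false h1 h2⟩, h1⟩
    · rintro (rfl | ⟨⟨h3, h4⟩, h1⟩)
      · by_cases hi : i ∈ N <;> simp [hi]
      · exact Or.inr ⟨h1, mt h4.2 h1, h3⟩

/-- Both sides are linear in `f`, so it suffices to compare them on the fundamental functions. The
formula then evaluates `Θ` on power sums without expanding these into fundamental functions. -/
theorem theta_ofFn (f : NCQSym) (κ : Fin n → ℕ+) :
    theta f (List.ofFn κ) = peakCoeff κ f := by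
  suffices h : NCSeries.coeff (List.ofFn κ) ∘ₗ theta = peakCoeff κ ∘ₗ NCQSym.subtype from
    LinearMap.congr_fun h f
  refine fundamentalBasis.ext fun φ => ?_
  rw [LinearMap.comp_apply, LinearMap.comp_apply, theta_F, Submodule.subtype_apply,
    fundamentalBasis_apply, NCSeries.coeff_apply]
  obtain ⟨k, φ⟩ := φ
  by_cases hk : k = n
  · subst hk
    exact (peakCoeff_F φ κ).symm
  · have hlen : ∀ κ' : Fin n → ℕ+, (List.ofFn κ').length ≠ k := fun κ' => by
      rw [List.length_ofFn]
      exact Ne.symm hk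
    rw [peakCoeff_apply, Finset.sum_eq_zero]
    · exact enriched_homogeneous _ _ (hlen κ)
    · intro N _
      rw [Finset.sum_eq_zero, mul_zero]
      intro 𝒞 _
      rw [φ.F_homogeneous _ (hlen _), mul_zero]

theorem theta_homogeneous {f : NCQSym} (hf : Homogeneous n (f : NCSeries)) :
    Homogeneous n (theta f) := by
  intro w hw
  have h1 := theta_ofFn f w.get
  rw [List.ofFn_get] at h1
  rw [h1, peakCoeff_apply, Finset.sum_eq_zero]
  intro N _
  rw [Finset.sum_eq_zero, mul_zero]
  intro 𝒞 _
  rw [hf _ (by rwa [List.length_ofFn]), mul_zero]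

open Classical in
/-- The eigenvalue of the descent-to-peak map at `p_π`; it is `2 ^ k` if `π` has `k` blocks, all
of odd size, and zero otherwise. -/
def SetPartition.peakWeight (π : SetPartition n) : ℚ :=
  ∑ N : Finset (Fin n), if ∀ i j, π.part j = π.part i → i ∈ N → j ∈ N then
    (-1) ^ (N.card + (N.image π.part).card) else 0

-- The word of a chain occurs in `p_π` exactly when all members of the chain are unions of blocks of
-- `π`. The compulsory lower sets then force `κ` and `N` to be constant on the blocks. For such `N`,
-- the chains that remain are again refining chains, with the points of `N` replaced by the blocks
-- of `π` inside `N`, and `sum_refiningChains` evaluates them.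
open Classical in
theorem peakCoeff_p (π : SetPartition n) (κ : Fin n → ℕ+) :
    peakCoeff κ π.p = if π ≤ SetPartition.ker κ then π.peakWeight else 0 := by
  rw [peakCoeff_apply]
  simp only [SetPartition.p_ofFn, mul_ite, mul_one, mul_zero, ← Finset.sum_filter]
  have hlt : ∀ N i j, (SignedColour.toColour (signedColouring κ N i) : ℕ) <
      SignedColour.toColour (signedColouring κ N j) ↔
      signedColouring κ N i < signedColouring κ N j := fun N i j => by
    rw [PNat.coe_lt_coe, SignedColour.toColour_strictMono.lt_iff_lt]
  have heq : ∀ N i j, (SignedColour.toColour (signedColouring κ N i) : ℕ) =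
      SignedColour.toColour (signedColouring κ N j) ↔ κ i = κ j ∧ (i ∈ N ↔ j ∈ N) :=
    fun N i j => by
      rw [PNat.coe_inj, SignedColour.toColour_strictMono.injective.eq_iff, signedColouring_eq_iff]
  have hstable : ∀ 𝒞 : Finset (Finset (Fin n)), (∀ S ∈ 𝒞, ∀ T ∈ 𝒞, S ⊆ T ∨ T ⊆ S) →
      (π ≤ SetPartition.ker (chainWord 𝒞) ↔
        ∀ i j, π.part j = π.part i → ∀ S ∈ 𝒞, i ∈ S → j ∈ S) := by
    intro 𝒞 h𝒞
    rw [SetPartition.le_ker_iff]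
    constructor
    · exact fun h i j hij => (chainWord_le_iff h𝒞 j i).1 (h i j hij).ge
    · exact fun h i j hij => le_antisymm ((chainWord_le_iff h𝒞 i j).2 (h j i hij.symm))
        ((chainWord_le_iff h𝒞 j i).2 (h i j hij))
  -- If two elements of a block had different signed colours, the lower set of the larger one would
  -- separate them.
  have hconst : ∀ N : Finset (Fin n),
      (∃ 𝒞 ∈ refiningChains (fun i => (SignedColour.toColour (signedColouring κ N i) : ℕ))
        (levelKey id κ N), π ≤ SetPartition.ker (chainWord 𝒞)) →
      ∀ i j, π.part j = π.part i → κ i = κ j ∧ (i ∈ N ↔ j ∈ N) := by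
    rintro N ⟨𝒞, h𝒞, hπ⟩ i j hij
    rw [mem_refiningChains] at h𝒞
    rw [hstable 𝒞 h𝒞.1] at hπ
    rw [← heq]
    refine le_antisymm (not_lt.1 fun h => ?_) (not_lt.1 fun h => ?_)
    · have := hπ j i hij.symm _ (h𝒞.2.2.1 i) (by simpa using h)
      simp at this
    · have := hπ i j hij _ (h𝒞.2.2.1 j) (by simpa using h)
      simp at this
  split_ifs with hκ
  · rw [SetPartition.le_ker_iff] at hκ
    unfold SetPartition.peakWeight
    refine Finset.sum_congr rfl fun N _ => ?_
    split_ifs with hN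
    · have hNiff : ∀ i j, π.part j = π.part i → (i ∈ N ↔ j ∈ N) := fun i j hij =>
        ⟨hN i j hij, hN j i hij.symm⟩
      have h1 : (refiningChains (fun i => (SignedColour.toColour (signedColouring κ N i) : ℕ))
          (levelKey id κ N)).filter (fun 𝒞 => π ≤ SetPartition.ker (chainWord 𝒞)) =
          refiningChains (fun i => (SignedColour.toColour (signedColouring κ N i) : ℕ))
          (levelKey π.part κ N) := by
        ext 𝒞
        rw [Finset.mem_filter, mem_refiningChains, mem_refiningChains]
        constructor
        · rintro ⟨⟨a1, a2, a3, a4⟩, a5⟩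
          refine ⟨a1, a2, a3, fun S hS i j hij hi => ?_⟩
          rw [hstable 𝒞 a1] at a5
          rcases (levelKey_eq_iff _ _ _ _ _).1 hij with h | h
          · exact a5 i j h.2.2.symm S hS hi
          · exact a4 S hS i j ((levelKey_eq_iff _ _ _ _ _).2 (Or.inr h)) hi
        · rintro ⟨a1, a2, a3, a4⟩
          refine ⟨⟨a1, a2, a3, fun S hS i j hij hi => ?_⟩, ?_⟩
          · rcases (levelKey_eq_iff _ _ _ _ _).1 hij with ⟨-, -, h⟩ | h
            · rwa [← show i = j from h]
            · exact a4 S hS i j ((levelKey_eq_iff _ _ _ _ _).2 (Or.inr h)) hi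
          · rw [hstable 𝒞 a1]
            intro i j hij S hS hi
            refine a4 S hS i j ((levelKey_eq_iff _ _ _ _ _).2 ?_) hi
            by_cases hiN : i ∈ N
            · exact Or.inl ⟨hiN, hN i j hij hiN, hij.symm⟩
            · exact Or.inr ⟨hiN, mt (hNiff i j hij).2 hiN, hκ i j hij⟩
      rw [h1, sum_refiningChains, card_image_levelKey, card_image_levelKey, Finset.image_id]
      -- The letters used outside `N` are counted once in the prefactor and once in the chain sum,
      -- so they do not affect the sign; only the points and the blocks inside `N` remain.
      · rw [← pow_add, show 1 + (N.card + (Nᶜ.image κ).card) +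
          (1 + ((N.image π.part).card + (Nᶜ.image κ).card)) =
          N.card + (N.image π.part).card + 2 * (1 + (Nᶜ.image κ).card) by ring, pow_add,
          pow_mul]
        simp
      · intro i j hij
        rw [heq]
        rcases (levelKey_eq_iff _ _ _ _ _).1 hij with ⟨h1, h2, h3⟩ | ⟨h1, h2, h3⟩
        · exact ⟨hκ i j h3.symm, iff_of_true h1 h2⟩
        · exact ⟨h3, iff_of_false h1 h2⟩
    · rw [Finset.filter_eq_empty_iff.2, Finset.sum_empty, mul_zero]
      intro 𝒞 h𝒞 hπ
      exact hN fun i j hij => (hconst N ⟨𝒞, h𝒞, hπ⟩ i j hij).2.1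
  · refine Finset.sum_eq_zero fun N _ => ?_
    rw [Finset.filter_eq_empty_iff.2, Finset.sum_empty, mul_zero]
    intro 𝒞 h𝒞 hπ
    exact hκ ((SetPartition.le_ker_iff _ _).2 fun i j hij => (hconst N ⟨𝒞, h𝒞, hπ⟩ i j hij).1)

theorem theta_p (π : SetPartition n) :
    theta ⟨π.p, NCSym_le_NCQSym π.p_mem_NCSym⟩ = π.peakWeight • π.p := by
  classical
  refine Homogeneous.ext (theta_homogeneous π.p_homogeneous) (π.p_homogeneous.smul _) fun κ => ?_
  rw [theta_ofFn, peakCoeff_p, NCSeries.smul_apply, SetPartition.p_ofFn, mul_ite, mul_one, mul_zero]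

/-- Each block `B` contained in `N` adds `|B| + 1` to the exponent, which is even. So no term is
negative, and `N = ∅` contributes 1. -/
theorem SetPartition.peakWeight_pos {π : SetPartition n} (h : π.IsOdd) : 0 < π.peakWeight := by
  classical
  have h1 : ∀ N : Finset (Fin n), (∀ i j, π.part j = π.part i → i ∈ N → j ∈ N) →
      (-1 : ℚ) ^ (N.card + (N.image π.part).card) = 1 := by
    intro N hN
    refine Even.neg_one_pow ?_
    rw [Finset.card_eq_sum_card_image π.part N, Finset.card_eq_sum_ones (N.image π.part),
      ← Finset.sum_add_distrib]
    refine Finset.even_sum _ fun B hB => ?_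
    obtain ⟨i, hi, rfl⟩ := Finset.mem_image.1 hB
    have : N.filter (fun a => π.part a = π.part i) = π.part i := by
      ext j
      rw [Finset.mem_filter, π.mem_part_iff]
      exact ⟨fun h => h.2, fun h => ⟨hN i j h hi, h⟩⟩
    rw [this]
    exact (h _ (π.part_mem.2 (Finset.mem_univ i))).add_one
  unfold SetPartition.peakWeight
  refine Finset.sum_pos' (fun N _ => ?_) ⟨∅, Finset.mem_univ _, by simp⟩
  split_ifs with hN
  · rw [h1 N hN]
    exact zero_le_one
  · exact le_rfl

/-- Toggling a block of even size in `N` changes the exponent by an odd number and cancels the terms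
in pairs. -/
theorem SetPartition.peakWeight_eq_zero {π : SetPartition n} (h : ¬ π.IsOdd) :
    π.peakWeight = 0 := by
  classical
  unfold SetPartition.IsOdd at h
  push Not at h
  obtain ⟨B, hB, heven⟩ := h
  rw [Nat.not_odd_iff_even] at heven
  obtain ⟨x, hx⟩ := π.nonempty_of_mem_parts hB
  obtain rfl := π.part_eq_of_mem hB hx
  have hst : ∀ N : Finset (Fin n), (∀ i j, π.part j = π.part i → i ∈ N → j ∈ N) →
      ∀ i j, π.part j = π.part i → i ∈ symmDiff N (π.part x) → j ∈ symmDiff N (π.part x) := by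
    intro N hN i j hij
    have := hN j i hij.symm
    have := hN i j hij
    simp only [Finset.mem_symmDiff, mem_part_iff, hij]
    tauto
  have key : ∀ N : Finset (Fin n), (∀ i j, π.part j = π.part i → i ∈ N → j ∈ N) → x ∉ N →
      (-1 : ℚ) ^ ((symmDiff N (π.part x)).card + ((symmDiff N (π.part x)).image π.part).card) =
      - (-1) ^ (N.card + (N.image π.part).card) := by
    intro N hN hxN
    have hd : Disjoint N (π.part x) := by
      rw [Finset.disjoint_left]
      exact fun i hi hix => hxN (hN i x (π.mem_part_iff.1 hix).symm hi)
    have h1 : (π.part x).image π.part = {π.part x} := by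
      ext C
      rw [Finset.mem_image, Finset.mem_singleton]
      constructor
      · rintro ⟨i, hi, rfl⟩
        exact π.mem_part_iff.1 hi
      · rintro rfl
        exact ⟨x, hx, rfl⟩
    have h2 : Disjoint (N.image π.part) {π.part x} := by
      rw [Finset.disjoint_singleton_right, Finset.mem_image]
      rintro ⟨i, hi, he⟩
      exact hxN (hN i x he.symm hi)
    rw [hd.symmDiff_eq_sup, Finset.sup_eq_union, Finset.card_union_of_disjoint hd,
      Finset.image_union, h1, Finset.card_union_of_disjoint h2, Finset.card_singleton]
    obtain ⟨k, hk⟩ := heven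
    rw [hk, show N.card + (k + k) + ((N.image π.part).card + 1) =
      N.card + (N.image π.part).card + 2 * k + 1 by ring, pow_succ, pow_add _ _ (2 * k), pow_mul]
    simp
  unfold SetPartition.peakWeight
  refine Finset.sum_involution (fun N _ => symmDiff N (π.part x)) ?_ ?_ (by simp) (by simp)
  · intro N _
    by_cases hN : ∀ i j, π.part j = π.part i → i ∈ N → j ∈ N
    · rw [if_pos hN, if_pos (hst N hN)]
      by_cases hxN : x ∈ N
      · have := key (symmDiff N (π.part x)) (hst N hN) (by simp [Finset.mem_symmDiff, hxN, hx])
        rw [symmDiff_symmDiff_cancel_right] at this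
        rw [this, neg_add_cancel]
      · rw [key N hN hxN, add_neg_cancel]
    · rw [if_neg hN, if_neg, add_zero]
      intro h
      refine hN ?_
      have := hst _ h
      rwa [symmDiff_symmDiff_cancel_right] at this
  · intro N _ _ he
    have := symmDiff_eq_left.1 he
    rw [this] at hx
    exact Finset.notMem_empty _ hx

/-- The power sums form an eigenbasis of `NCSym` for `Θ`, and the eigenvalue is nonzero exactly for
odd partitions. -/
theorem NCOmega_eq : NCOmega = oddPowerSums := by
  have h1 : NCOmega = Submodule.span ℚ (Set.range fun π : (Σ n, SetPartition n) =>
      π.2.peakWeight • π.2.p) := by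
    unfold NCOmega
    rw [LinearMap.range_eq_map, ← powerSumBasis.span_eq, Submodule.map_span, ← Set.range_comp]
    congr 2
    funext π
    rw [Function.comp_apply, LinearMap.comp_apply, ← theta_p]
    congr 1
    exact Subtype.ext (powerSumBasis_apply π)
  rw [h1]
  apply le_antisymm <;> refine Submodule.span_le.2 ?_
  · rintro _ ⟨π, rfl⟩
    by_cases h : π.2.IsOdd
    · exact Submodule.smul_mem _ _ (SetPartition.p_mem_oddPowerSums h)
    · simp [SetPartition.peakWeight_eq_zero h]
  · rintro _ ⟨π, rfl⟩
    have h2 := Submodule.smul_mem _ (π.1.2.peakWeight)⁻¹ (Submodule.subset_span (R := ℚ)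
      (Set.mem_range_self (f := fun π : (Σ n, SetPartition n) => π.2.peakWeight • π.2.p) π.1))
    simpa [smul_smul, (SetPartition.peakWeight_pos π.2).ne'] using h2

end Theta

/-! ## Triangularity with respect to the power sums -/

/-- The span of the odd power sums strictly below `π` in the refinement order. -/
def lowerPowerSums (π : Σ n, SetPartition n) : Submodule ℚ NCSeries :=
  Submodule.span ℚ ((fun τ : (Σ n, SetPartition n) => τ.2.p) '' {τ | τ.2.IsOdd ∧ τ < π})

/-- A nonzero multiple of `p_π` plus odd power sums strictly below `π`. -/
def IsTriangular (π : Σ n, SetPartition n) (f : NCSeries) : Prop :=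
  ∃ c : ℚ, c ≠ 0 ∧ ∃ g ∈ lowerPowerSums π, f = c • π.2.p + g

theorem lowerPowerSums_le (π : Σ n, SetPartition n) : lowerPowerSums π ≤ oddPowerSums := by
  refine Submodule.span_le.2 ?_
  rintro _ ⟨τ, hτ, rfl⟩
  exact SetPartition.p_mem_oddPowerSums hτ.1

theorem IsTriangular.mem {π : Σ n, SetPartition n} {f : NCSeries} (hf : IsTriangular π f)
    (hπ : π.2.IsOdd) : f ∈ oddPowerSums := by
  obtain ⟨c, -, g, hg, rfl⟩ := hf
  exact Submodule.add_mem _ (Submodule.smul_mem _ _ (SetPartition.p_mem_oddPowerSums hπ))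
    (lowerPowerSums_le _ hg)

theorem isTriangular_p (π : Σ n, SetPartition n) : IsTriangular π π.2.p :=
  ⟨1, one_ne_zero, 0, Submodule.zero_mem _, by rw [one_smul, add_zero]⟩

theorem SetPartition.q_mem_oddPowerSums {n : ℕ} (π : SetPartition n) : π.q ∈ oddPowerSums := by
  rw [SetPartition.q_eq_sum_p]
  refine Submodule.sum_mem _ fun σ _ => ?_
  by_cases h : cycleWeight σ = 0
  · rw [h, zero_smul]
    exact Submodule.zero_mem _
  · exact Submodule.smul_mem _ _
      (SetPartition.p_mem_oddPowerSums (isOdd_of_cycleWeight_ne_zero h))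

/-- Group the expansion of `q_π` by whether `cyc σ = π`. The permutations with orbits `π` exist and
have positive weights, so the coefficient of `p_π` cannot cancel; all others have strictly finer
orbits and contribute only if these are odd. -/
theorem isTriangular_q {π : Σ n, SetPartition n} (hπ : π.2.IsOdd) : IsTriangular π π.2.q := by
  classical
  obtain ⟨n, π⟩ := π
  refine ⟨∑ σ ∈ π.youngPerms.filter (fun σ => SetPartition.cyc σ = π), cycleWeight σ, ?_,
    ∑ σ ∈ π.youngPerms.filter (fun σ => ¬ SetPartition.cyc σ = π),
      cycleWeight σ • (SetPartition.cyc σ).p, ?_, ?_⟩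
  · refine (Finset.sum_pos (fun σ hσ => ?_) ?_).ne'
    · have h1 := (Finset.mem_filter.1 hσ).2
      exact cycleWeight_pos (h1.symm ▸ hπ)
    · obtain ⟨σ, hσ⟩ := π.exists_cyc
      exact ⟨σ, Finset.mem_filter.2 ⟨(SetPartition.mem_youngPerms_iff_cyc_le _ _).2 hσ.le, hσ⟩⟩
  · refine Submodule.sum_mem _ fun σ hσ => ?_
    obtain ⟨h1, h2⟩ := Finset.mem_filter.1 hσ
    by_cases h : cycleWeight σ = 0
    · rw [h, zero_smul]
      exact Submodule.zero_mem _
    · refine Submodule.smul_mem _ _ (Submodule.subset_span ⟨⟨n, SetPartition.cyc σ⟩,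
        ⟨isOdd_of_cycleWeight_ne_zero h, ?_⟩, rfl⟩)
      exact Sigma.mk_lt_mk_iff.2
        (lt_of_le_of_ne ((SetPartition.mem_youngPerms_iff_cyc_le _ _).1 h1) h2)
  · change π.q = _ • π.p + _
    rw [SetPartition.q_eq_sum_p, ← Finset.sum_filter_add_sum_filter_not π.youngPerms
      (fun σ => SetPartition.cyc σ = π), Finset.sum_smul]
    congr 1
    refine Finset.sum_congr rfl fun σ hσ => ?_
    rw [(Finset.mem_filter.1 hσ).2]

/-- Well-founded induction along refinement: `p_π` is obtained from `f π` by subtracting odd power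
sums strictly below `π`. -/
theorem span_of_isTriangular {f : OddPartition → NCSeries} (hf : ∀ π, IsTriangular π.1 (f π)) :
    Submodule.span ℚ (Set.range f) = oddPowerSums := by
  apply le_antisymm
  · refine Submodule.span_le.2 ?_
    rintro _ ⟨π, rfl⟩
    exact (hf π).mem π.2
  · refine Submodule.span_le.2 ?_
    rintro _ ⟨⟨⟨n, π⟩, hπ⟩, rfl⟩
    change π.p ∈ Submodule.span ℚ (Set.range f)
    induction π using WellFoundedLT.induction with
    | _ π ih =>
      obtain ⟨c, hc, g, hg, he⟩ := hf ⟨⟨n, π⟩, hπ⟩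
      have h1 : g ∈ Submodule.span ℚ (Set.range f) := by
        refine Submodule.span_le.2 ?_ hg
        rintro _ ⟨τ, ⟨hτ, hlt⟩, rfl⟩
        obtain ⟨k, τ⟩ := τ
        obtain ⟨hk, hlt'⟩ := Sigma.lt_def.1 hlt
        obtain rfl : k = n := hk
        exact ih τ hlt' hτ
      have h2 : π.p = c⁻¹ • (f ⟨⟨n, π⟩, hπ⟩ - g) := by
        rw [he, add_sub_cancel_right, smul_smul, inv_mul_cancel₀ hc, one_smul]
      rw [h2]
      exact Submodule.smul_mem _ _ (Submodule.sub_mem _ (Submodule.subset_span ⟨_, rfl⟩) h1)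

/-- Take `π` maximal in the support of a relation. Modulo the span `W` of all the other power sums,
only the leading term of `f π` survives, which would place `p_π` in `W`. -/
theorem linearIndependent_of_isTriangular {f : OddPartition → NCSeries}
    (hf : ∀ π, IsTriangular π.1 (f π)) : LinearIndependent ℚ f := by
  classical
  rw [linearIndependent_iff']
  intro s g hs
  by_contra hne
  push Not at hne
  obtain ⟨π₀, hπ₀, hg₀⟩ := hne
  obtain ⟨π, hπ, hmax⟩ := Finset.exists_maximal (s := s.filter fun π => g π ≠ 0)
    ⟨π₀, Finset.mem_filter.2 ⟨hπ₀, hg₀⟩⟩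
  obtain ⟨hπs, hgπ⟩ := Finset.mem_filter.1 hπ
  set W : Submodule ℚ NCSeries :=
    Submodule.span ℚ ((fun τ : (Σ n, SetPartition n) => τ.2.p) '' {τ | τ ≠ π.1}) with hW
  have hlow : ∀ τ : Σ n, SetPartition n, ¬ π.1 < τ → lowerPowerSums τ ≤ W := by
    intro τ hτ
    refine Submodule.span_mono (Set.image_mono ?_)
    rintro ρ ⟨-, hρ⟩ he
    exact hτ (he ▸ hρ)
  have hnot : π.1.2.p ∉ W := by
    have := SetPartition.linearIndependent_p.notMem_span_image (s := {τ | τ ≠ π.1}) (x := π.1)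
      (by simp)
    exact this
  obtain ⟨c, hc, r, hr, he⟩ := hf π
  rw [← Finset.add_sum_erase _ _ hπs] at hs
  have h1 : ∑ τ ∈ s.erase π, g τ • f τ ∈ W := by
    refine Submodule.sum_mem _ fun τ hτ => ?_
    obtain ⟨hne, hτs⟩ := Finset.mem_erase.1 hτ
    by_cases hgτ : g τ = 0
    · rw [hgτ, zero_smul]
      exact Submodule.zero_mem _
    · obtain ⟨c', -, r', hr', he'⟩ := hf τ
      have hlt : ¬ π.1 < τ.1 := fun hlt =>
        absurd (hmax (Finset.mem_filter.2 ⟨hτs, hgτ⟩) hlt.le) (not_le_of_gt hlt)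
      rw [he']
      refine Submodule.smul_mem _ _ (Submodule.add_mem _ (Submodule.smul_mem _ _
        (Submodule.subset_span ⟨τ.1, fun h => hne (Subtype.ext h), rfl⟩)) (hlow _ hlt hr'))
  refine hnot ?_
  have h2 : π.1.2.p = (g π * c)⁻¹ • (-(∑ τ ∈ s.erase π, g τ • f τ) - g π • r) := by
    rw [eq_inv_smul_iff₀ (mul_ne_zero hgπ hc), mul_smul, eq_sub_iff_add_eq, ← smul_add, ← he]
    exact eq_neg_of_add_eq_zero_left hs
  rw [h2]
  exact Submodule.smul_mem _ _ (Submodule.sub_mem _ (Submodule.neg_mem _ h1)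
    (Submodule.smul_mem _ _ (hlow _ (lt_irrefl _) hr)))

/-! ## Free generation -/

/-- The free algebra is the monoid algebra of the free monoid, so its words are a basis, and
injectivity of the lift becomes linear independence of the products of generators. -/
theorem freeAlgebra_lift_eq {I : Type} (x : I → NCSeries) :
    FreeAlgebra.lift ℚ x = (MonoidAlgebra.lift ℚ NCSeries (FreeMonoid I) (FreeMonoid.lift x)).comp
      (FreeAlgebra.equivMonoidAlgebraFreeMonoid (R := ℚ) (X := I)).toAlgHom := by
  refine FreeAlgebra.hom_ext (funext fun i => ?_)
  simp [FreeAlgebra.equivMonoidAlgebraFreeMonoid]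

theorem freelyGenerates_of_words {I : Type} (x : I → NCSeries) (S : Submodule ℚ NCSeries)
    (hli : LinearIndependent ℚ fun l : List I => (l.map x).prod)
    (hspan : Submodule.span ℚ (Set.range fun l : List I => (l.map x).prod) = S) :
    FreelyGenerates x S := by
  have hw : ∀ l : FreeMonoid I, FreeMonoid.lift x l = (l.toList.map x).prod :=
    FreeMonoid.lift_apply x
  constructor
  · rw [freeAlgebra_lift_eq]
    refine Function.Injective.comp (g := MonoidAlgebra.lift ℚ NCSeries (FreeMonoid I)
      (FreeMonoid.lift x)) ?_ FreeAlgebra.equivMonoidAlgebraFreeMonoid.injective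
    intro a b hab
    rw [MonoidAlgebra.lift_apply, MonoidAlgebra.lift_apply] at hab
    simp only [hw] at hab
    have := hli (a₁ := a.coeff) (a₂ := b.coeff) hab
    exact MonoidAlgebra.coeffEquiv.injective this
  · rw [← hspan, ← Algebra.adjoin_range_eq_range_freeAlgebra_lift, Algebra.adjoin_eq_span,
      ← FreeMonoid.mrange_lift]
    congr 1
    ext f
    constructor
    · rintro ⟨l, rfl⟩
      exact ⟨l.toList, (hw l).symm⟩
    · rintro ⟨l, rfl⟩
      exact ⟨FreeMonoid.ofList l, hw _⟩

/-! ## Concatenation of set partitions -/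

namespace SetPartition

/-- The set partitions of all `[n]`. -/
abbrev Graded : Type := Σ n, SetPartition n

/-- Two natural numbers lie in the same block. -/
def Rel (π : Graded) (i j : ℕ) : Prop :=
  ∃ (hi : i < π.1) (hj : j < π.1), π.2.part ⟨i, hi⟩ = π.2.part ⟨j, hj⟩

theorem Rel.lt_left {π : Graded} {i j : ℕ} (h : Rel π i j) : i < π.1 := h.1
theorem Rel.lt_right {π : Graded} {i j : ℕ} (h : Rel π i j) : j < π.1 := h.2.1

theorem Rel.symm {π : Graded} {i j : ℕ} (h : Rel π i j) : Rel π j i :=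
  ⟨h.2.1, h.1, h.2.2.symm⟩

/-- Describing blocks by a relation on natural numbers allows partitions of different `[n]` to be
compared and shifted without casts between index types. -/
theorem graded_le_iff {π τ : Graded} :
    π ≤ τ ↔ π.1 = τ.1 ∧ ∀ i j, Rel π i j → Rel τ i j := by
  obtain ⟨n, π⟩ := π
  obtain ⟨k, τ⟩ := τ
  constructor
  · intro h
    obtain ⟨hk, h⟩ := Sigma.le_def.1 h
    obtain rfl : n = k := hk
    refine ⟨rfl, ?_⟩
    rintro i j ⟨hi, hj, he⟩
    exact ⟨hi, hj, ((le_iff _ _).1 h ⟨i, hi⟩ ⟨j, hj⟩ he.symm).symm⟩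
  · rintro ⟨hk, h⟩
    obtain rfl : n = k := hk
    refine Sigma.mk_le_mk_iff.2 ((le_iff _ _).2 fun i j hij => ?_)
    exact (h i j ⟨i.2, j.2, hij.symm⟩).2.2.symm

theorem graded_ext {π τ : Graded} (h1 : π.1 = τ.1) (h2 : ∀ i j, Rel π i j ↔ Rel τ i j) : π = τ :=
  le_antisymm (graded_le_iff.2 ⟨h1, fun i j => (h2 i j).1⟩)
    (graded_le_iff.2 ⟨h1.symm, fun i j => (h2 i j).2⟩)

open Classical in
/-- The set partition of `[n]` into the fibres of `f`. -/
def ofFun {X : Type} (n : ℕ) (f : Fin n → X) : Graded := ⟨n, Finpartition.ofSetoid (Setoid.ker f)⟩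

theorem rel_ofFun {X : Type} {n : ℕ} {f : Fin n → X} {i j : ℕ} :
    Rel (ofFun n f) i j ↔ ∃ (hi : i < n) (hj : j < n), f ⟨i, hi⟩ = f ⟨j, hj⟩ := by
  classical
  unfold Rel ofFun
  refine exists₂_congr fun hi hj => ?_
  rw [part_ofSetoid]
  exact eq_comm

/-- The shifted concatenation of set partitions. -/
def concat (π τ : Graded) : Graded :=
  ofFun (π.1 + τ.1) fun i => if h : i.val < π.1 then
    (Sum.inl (π.2.part ⟨i.val, h⟩) : Finset (Fin π.1) ⊕ Finset (Fin τ.1))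
    else Sum.inr (τ.2.part ⟨i.val - π.1, by omega⟩)

theorem concat_fst (π τ : Graded) : (concat π τ).1 = π.1 + τ.1 := rfl

theorem rel_concat {π τ : Graded} {i j : ℕ} : Rel (concat π τ) i j ↔
    Rel π i j ∨ (π.1 ≤ i ∧ π.1 ≤ j ∧ Rel τ (i - π.1) (j - π.1)) := by
  unfold concat
  rw [rel_ofFun]
  constructor
  · rintro ⟨hi, hj, he⟩
    by_cases h1 : i < π.1 <;> by_cases h2 : j < π.1
    · simp only [h1, h2, dif_pos, Sum.inl.injEq] at he
      exact Or.inl ⟨h1, h2, he⟩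
    · simp [h1, h2] at he
    · simp [h1, h2] at he
    · simp only [h1, h2, dif_neg, not_false_iff, Sum.inr.injEq] at he
      exact Or.inr ⟨not_lt.1 h1, not_lt.1 h2, _, _, he⟩
  · rintro (⟨h1, h2, he⟩ | ⟨h1, h2, h3, h4, he⟩)
    · refine ⟨by omega, by omega, ?_⟩
      simp only [h1, h2, dif_pos, he]
    · refine ⟨by omega, by omega, ?_⟩
      simp only [not_lt.2 h1, not_lt.2 h2, dif_neg, not_false_iff, he]

theorem concat_mono {π π' τ τ' : Graded} (h1 : π ≤ π') (h2 : τ ≤ τ') :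
    concat π τ ≤ concat π' τ' := by
  rw [graded_le_iff] at *
  obtain ⟨h1, h1'⟩ := h1
  obtain ⟨h2, h2'⟩ := h2
  refine ⟨by rw [concat_fst, concat_fst, h1, h2], fun i j hij => ?_⟩
  rw [rel_concat] at *
  rw [← h1]
  exact hij.imp (h1' i j) fun h => ⟨h.1, h.2.1, h2' _ _ h.2.2⟩

theorem rel_left_of_concat {π τ : Graded} {i j : ℕ} (hi : i < π.1) :
    Rel (concat π τ) i j ↔ Rel π i j := by
  rw [rel_concat]
  exact or_iff_left fun h => absurd h.1 (not_le.2 hi)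

theorem rel_right_of_concat {π τ : Graded} {i j : ℕ} :
    Rel (concat π τ) (π.1 + i) (π.1 + j) ↔ Rel τ i j := by
  rw [rel_concat, Nat.add_sub_cancel_left, Nat.add_sub_cancel_left]
  constructor
  · rintro (h | h)
    · exact absurd h.lt_left (by omega)
    · exact h.2.2
  · exact fun h => Or.inr ⟨by omega, by omega, h⟩

/-- Once the cut position is known, both factors are recovered by restricting the relation to the
two sides. -/
theorem concat_inj {π π' τ τ' : Graded} (h : concat π τ = concat π' τ') (h1 : π.1 = π'.1) :
    π = π' ∧ τ = τ' := by
  constructor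
  · refine graded_ext h1 fun i j => ?_
    constructor
    · intro hij
      have hi := hij.lt_left
      rw [← rel_left_of_concat (τ := τ) hi, h, rel_left_of_concat (h1 ▸ hi)] at hij
      exact hij
    · intro hij
      have hi := hij.lt_left
      rw [← rel_left_of_concat (τ := τ') hi, ← h, rel_left_of_concat (h1.symm ▸ hi)] at hij
      exact hij
  · have h2 := congrArg Sigma.fst h
    rw [concat_fst, concat_fst] at h2
    refine graded_ext (by omega) fun i j => ?_
    rw [← rel_right_of_concat (π := π), h, h1, rel_right_of_concat]

theorem concat_lt {π π' τ τ' : Graded} (h1 : π ≤ π') (h2 : τ ≤ τ') (h : π < π' ∨ τ < τ') :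
    concat π τ < concat π' τ' := by
  refine lt_of_le_of_ne (concat_mono h1 h2) fun he => ?_
  obtain ⟨h3, h4⟩ := concat_inj he (graded_le_iff.1 h1).1
  exact h.elim (fun h => h.ne h3) fun h => h.ne h4

open Classical in
theorem isOdd_iff (π : Graded) :
    π.2.IsOdd ↔ ∀ i < π.1, Odd ((Finset.range π.1).filter fun j => Rel π i j).card := by
  obtain ⟨n, π⟩ := π
  have key : ∀ i : Fin n, ((Finset.range n).filter fun j => Rel ⟨n, π⟩ i j).card =
      (π.part i).card := by
    intro i
    rw [← Finset.card_map Fin.valEmbedding (s := π.part i)]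
    congr 1
    ext j
    rw [Finset.mem_filter, Finset.mem_range, Finset.mem_map]
    simp only [Fin.valEmbedding_apply, mem_part_iff]
    constructor
    · rintro ⟨hj, _, _, he⟩
      exact ⟨⟨j, hj⟩, he.symm, rfl⟩
    · rintro ⟨j, he, rfl⟩
      exact ⟨j.2, i.2, j.2, he.symm⟩
  constructor
  · intro h i hi
    rw [key ⟨i, hi⟩]
    exact h _ (π.part_mem.2 (Finset.mem_univ _))
  · intro h B hB
    obtain ⟨i, hi⟩ := π.nonempty_of_mem_parts hB
    rw [← π.part_eq_of_mem hB hi, ← key i]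
    exact h i i.2

/-- The blocks of the concatenation are the blocks of `π` and the shifted blocks of `τ`, of
unchanged sizes. -/
theorem isOdd_concat {π τ : Graded} : (concat π τ).2.IsOdd ↔ π.2.IsOdd ∧ τ.2.IsOdd := by
  classical
  rw [isOdd_iff, isOdd_iff, isOdd_iff, concat_fst]
  have h1 : ∀ i < π.1, (Finset.range (π.1 + τ.1)).filter (fun j => Rel (concat π τ) i j) =
      (Finset.range π.1).filter (fun j => Rel π i j) := by
    intro i hi
    ext j
    rw [Finset.mem_filter, Finset.mem_filter, rel_left_of_concat hi, Finset.mem_range,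
      Finset.mem_range]
    exact ⟨fun h => ⟨h.2.lt_right, h.2⟩, fun h => ⟨by omega, h.2⟩⟩
  have h2 : ∀ i, ((Finset.range (π.1 + τ.1)).filter
      (fun j => Rel (concat π τ) (π.1 + i) j)).card =
      ((Finset.range τ.1).filter (fun j => Rel τ i j)).card := by
    intro i
    rw [← Finset.card_map (addLeftEmbedding π.1)
      (s := (Finset.range τ.1).filter fun j => Rel τ i j)]
    congr 1
    ext j
    simp only [Finset.mem_filter, Finset.mem_range, Finset.mem_map, addLeftEmbedding_apply]
    constructor
    · rintro ⟨hj, hr⟩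
      have hle : π.1 ≤ j := by
        by_contra hlt
        have := (rel_left_of_concat (not_le.1 hlt)).1 hr.symm
        exact absurd this.lt_right (by omega)
      obtain ⟨j, rfl⟩ := Nat.exists_eq_add_of_le hle
      exact ⟨j, ⟨by omega, rel_right_of_concat.1 hr⟩, rfl⟩
    · rintro ⟨j, ⟨hj, hr⟩, rfl⟩
      exact ⟨by omega, rel_right_of_concat.2 hr⟩
  constructor
  · intro h
    refine ⟨fun i hi => ?_, fun i hi => ?_⟩
    · rw [← h1 i hi]
      exact h i (by omega)
    · rw [← h2 i]
      exact h _ (by omega)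
  · rintro ⟨h3, h4⟩ i hi
    by_cases hlt : i < π.1
    · rw [h1 i hlt]
      exact h3 i hlt
    · obtain ⟨i, rfl⟩ := Nat.exists_eq_add_of_le (not_lt.1 hlt)
      rw [h2]
      exact h4 i (by omega)

theorem isConnected_iff (π : Graded) : π.2.IsConnected ↔
    0 < π.1 ∧ ∀ k, 0 < k → k < π.1 → ∃ i j, i < k ∧ k ≤ j ∧ Rel π i j := by
  unfold IsConnected
  refine and_congr Iff.rfl (forall₃_congr fun k _ _ => ?_)
  constructor
  · rintro ⟨B, hB, ⟨i, hi, hik⟩, j, hj, hkj⟩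
    exact ⟨i, j, hik, hkj, i.2, j.2, by
      rw [Fin.eta, Fin.eta, π.2.part_eq_of_mem hB hi, π.2.part_eq_of_mem hB hj]⟩
  · rintro ⟨i, j, hik, hkj, hi, hj, he⟩
    exact ⟨π.2.part ⟨i, hi⟩, π.2.part_mem.2 (Finset.mem_univ _),
      ⟨⟨i, hi⟩, π.2.mem_part (Finset.mem_univ _), hik⟩, ⟨j, hj⟩, π.2.mem_part_iff.2 he.symm, hkj⟩

/-- The set partition of `[0]`. -/
def empty : Graded := ofFun 0 fun _ => ()

theorem eq_empty {π : Graded} (h : π.1 = 0) : π = empty :=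
  graded_ext h fun i j => ⟨fun hij => absurd hij.lt_left (by omega),
    fun hij => absurd (show i < 0 from hij.lt_left) (by omega)⟩

theorem isOdd_empty : empty.2.IsOdd :=
  (isOdd_iff _).2 fun i hi => absurd (show i < 0 from hi) (by omega)

/-- A nonempty set partition splits off a connected one. -/
theorem exists_connected_concat (π : Graded) (h : 0 < π.1) :
    ∃ τ ρ : Graded, τ.2.IsConnected ∧ concat τ ρ = π := by
  classical
  -- The connected factor ends at the smallest positive position that no block crosses; the end of
  -- `π` is always such a position.
  have hex : ∃ k, 0 < k ∧ k ≤ π.1 ∧ ∀ i j, i < k → k ≤ j → ¬ Rel π i j :=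
    ⟨π.1, h, le_rfl, fun i j _ hj hr => absurd hr.lt_right (not_lt.2 hj)⟩
  obtain ⟨hk0, hkn, hk⟩ := Nat.find_spec hex
  have hmin := fun m => Nat.find_min hex (m := m)
  set k := Nat.find hex
  set τ : Graded := ofFun k fun i => π.2.part ⟨i.val, by omega⟩ with hτ
  set ρ : Graded := ofFun (π.1 - k) fun i => π.2.part ⟨i.val + k, by omega⟩ with hρ
  have hτr : ∀ i j, Rel τ i j ↔ i < k ∧ j < k ∧ Rel π i j := by
    intro i j
    rw [hτ, rel_ofFun]
    exact ⟨fun ⟨h1, h2, h3⟩ => ⟨h1, h2, by omega, by omega, h3⟩,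
      fun ⟨h1, h2, _, _, h3⟩ => ⟨h1, h2, h3⟩⟩
  have hρr : ∀ i j, Rel ρ i j ↔ Rel π (i + k) (j + k) := by
    intro i j
    rw [hρ, rel_ofFun]
    exact ⟨fun ⟨h1, h2, h3⟩ => ⟨by omega, by omega, h3⟩,
      fun ⟨h1, h2, h3⟩ => ⟨by omega, by omega, h3⟩⟩
  have hτ1 : τ.1 = k := rfl
  have hρ1 : ρ.1 = π.1 - k := rfl
  refine ⟨τ, ρ, (isConnected_iff _).2 ⟨hk0, fun m hm hmk => ?_⟩, graded_ext ?_ fun i j => ?_⟩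
  · rw [hτ1] at hmk
    have := hmin m hmk
    push Not at this
    obtain ⟨i, j, hi, hj, hr⟩ := this hm (by omega)
    -- By minimality some block crosses `m`, and since no block crosses `k`, the crossing pair stays
    -- inside the first factor.
    refine ⟨i, j, hi, hj, (hτr i j).2 ⟨by omega, ?_, hr⟩⟩
    by_contra hjk
    exact hk i j (by omega) (not_lt.1 hjk) hr
  · rw [concat_fst, hτ1, hρ1]
    omega
  · rw [rel_concat, hτr, hρr, hτ1]
    constructor
    · rintro (h | ⟨h1, h2, h3⟩)
      · exact h.2.2
      · rwa [Nat.sub_add_cancel h1, Nat.sub_add_cancel h2] at h3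
    · intro hr
      by_cases hi : i < k <;> by_cases hj : j < k
      · exact Or.inl ⟨hi, hj, hr⟩
      · exact absurd hr (hk i j hi (not_lt.1 hj))
      · exact absurd hr.symm (hk j i hj (not_lt.1 hi))
      · exact Or.inr ⟨not_lt.1 hi, not_lt.1 hj, by
          rwa [Nat.sub_add_cancel (not_lt.1 hi), Nat.sub_add_cancel (not_lt.1 hj)]⟩

/-- If `π` were shorter than `π'`, a block of the connected partition `π'` would cross the position
where `π` ends, but in the concatenation no block does. -/
theorem connected_concat_inj {π π' τ τ' : Graded} (hπ : π.2.IsConnected) (hπ' : π'.2.IsConnected)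
    (h : concat π τ = concat π' τ') : π = π' ∧ τ = τ' := by
  refine concat_inj h ?_
  have key : ∀ {π π' τ τ' : Graded}, π.2.IsConnected → π'.2.IsConnected →
      concat π τ = concat π' τ' → ¬ π.1 < π'.1 := by
    intro π π' τ τ' hπ hπ' h hlt
    rw [isConnected_iff] at hπ hπ'
    obtain ⟨i, j, hi, hj, hr⟩ := hπ'.2 π.1 hπ.1 hlt
    rw [← rel_left_of_concat (τ := τ') (by omega), ← h, rel_left_of_concat hi] at hr
    exact absurd hr.lt_right (not_lt.2 hj)
  exact le_antisymm (not_lt.1 (key hπ' hπ h.symm)) (not_lt.1 (key hπ hπ' h))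

/-- The concatenation of a list of connected odd set partitions. -/
def concatList (l : List ConnectedOddPartition) : Graded :=
  l.foldr (fun π τ => concat π.1 τ) empty

theorem isOdd_concatList (l : List ConnectedOddPartition) : (concatList l).2.IsOdd := by
  induction l with
  | nil => exact isOdd_empty
  | cons π l ih => exact isOdd_concat.2 ⟨π.2.2, ih⟩

theorem concatList_injective : Function.Injective concatList := by
  have hpos : ∀ (π : ConnectedOddPartition) l, concatList (π :: l) ≠ empty := by
    intro π l he
    have h1 : π.1.1 + (concatList l).1 = 0 := congrArg Sigma.fst he
    have := π.2.1.1
    omega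
  intro l
  induction l with
  | nil =>
    intro l' h
    cases l' with
    | nil => rfl
    | cons π' l' => exact absurd h.symm (hpos π' l')
  | cons π l ih =>
    intro l' h
    cases l' with
    | nil => exact absurd h (hpos π l)
    | cons π' l' =>
      obtain ⟨h1, h2⟩ := connected_concat_inj π.2.1 π'.2.1 h
      rw [Subtype.ext h1, ih h2]

theorem exists_concatList (π : Graded) (hπ : π.2.IsOdd) : ∃ l, concatList l = π := by
  induction h : π.1 using Nat.strong_induction_on generalizing π with
  | _ n ih =>
    rcases Nat.eq_zero_or_pos π.1 with h0 | h0
    · exact ⟨[], (eq_empty h0).symm⟩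
    · obtain ⟨τ, ρ, hτ, rfl⟩ := exists_connected_concat π h0
      rw [isOdd_concat] at hπ
      have := hτ.1
      rw [concat_fst] at h
      obtain ⟨l, hl⟩ := ih ρ.1 (by omega) ρ hπ.2 rfl
      exact ⟨⟨τ, hτ, hπ.1⟩ :: l, congrArg (concat τ) hl⟩

/-- Odd set partitions are uniquely concatenations of connected odd set partitions. -/
def concatEquiv : List ConnectedOddPartition ≃ OddPartition :=
  Equiv.ofBijective (fun l => ⟨concatList l, isOdd_concatList l⟩)
    ⟨fun _ _ h => concatList_injective (congrArg Subtype.val h), fun π => by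
      obtain ⟨l, hl⟩ := exists_concatList π.1 π.2
      exact ⟨l, Subtype.ext hl⟩⟩

open Classical in
theorem p_apply (π : Graded) (w : List ℕ+) :
    π.2.p w = if w.length = π.1 ∧ ∀ i j, Rel π i j → w[i]? = w[j]? then 1 else 0 := by
  obtain ⟨n, π⟩ := π
  by_cases hw : w.length = n
  · subst hw
    have h1 := π.p_ofFn w.get
    rw [List.ofFn_get] at h1
    rw [h1]
    refine if_congr ?_ rfl rfl
    rw [le_ker_iff]
    constructor
    · intro h
      refine ⟨rfl, ?_⟩
      rintro i j ⟨hi, hj, he⟩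
      have := h ⟨i, hi⟩ ⟨j, hj⟩ he.symm
      rw [List.getElem?_eq_getElem hi, List.getElem?_eq_getElem hj]
      exact congrArg some this
    · rintro ⟨-, h⟩ i j hij
      have := h i j ⟨i.2, j.2, hij.symm⟩
      rw [List.getElem?_eq_getElem i.2, List.getElem?_eq_getElem j.2] at this
      exact Option.some_injective _ this
  · rw [π.p_homogeneous w hw, if_neg fun h => hw h.1]

theorem p_empty : empty.2.p = 1 := by
  classical
  ext w
  rw [p_apply, NCSeries.one_def]
  refine if_congr ?_ rfl rfl
  rw [← List.length_eq_zero_iff]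
  exact and_iff_left fun i j h => absurd (show i < 0 from h.lt_left) (by omega)

/-- By homogeneity only the factorization of a word at the length of `π` can contribute. The word is
constant on the blocks of the concatenation if and only if its two pieces are constant on the blocks
of `π` and of `τ`. -/
theorem p_mul_p (π τ : Graded) : π.2.p * τ.2.p = (concat π τ).2.p := by
  classical
  ext w
  rw [NCSeries.mul_def, p_apply (concat π τ), concat_fst]
  by_cases hw : w.length = π.1 + τ.1
  · rw [Finset.sum_eq_single π.1]
    · rw [p_apply, p_apply, ite_zero_mul_ite_zero, mul_one]
      refine if_congr ?_ rfl rfl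
      rw [List.length_take, List.length_drop]
      constructor
      · rintro ⟨⟨-, h1⟩, -, h2⟩
        refine ⟨hw, fun i j hij => ?_⟩
        rcases rel_concat.1 hij with h | ⟨h3, h4, h5⟩
        · have := h1 i j h
          rwa [List.getElem?_take_of_lt h.lt_left, List.getElem?_take_of_lt h.lt_right] at this
        · have := h2 _ _ h5
          rwa [List.getElem?_drop, List.getElem?_drop, Nat.add_sub_cancel' h3,
            Nat.add_sub_cancel' h4] at this
      · rintro ⟨-, h⟩
        refine ⟨⟨by omega, fun i j hij => ?_⟩, by omega, fun i j hij => ?_⟩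
        · rw [List.getElem?_take_of_lt hij.lt_left, List.getElem?_take_of_lt hij.lt_right]
          exact h i j (rel_concat.2 (Or.inl hij))
        · rw [List.getElem?_drop, List.getElem?_drop]
          exact h _ _ (rel_right_of_concat.2 hij)
    · intro i hi hne
      rw [Finset.mem_range] at hi
      rw [π.2.p_homogeneous _ (by rw [List.length_take]; omega), zero_mul]
    · intro hn
      exact absurd (Finset.mem_range.2 (by omega)) hn
  · rw [if_neg fun h => hw h.1]
    refine Finset.sum_eq_zero fun i hi => ?_
    rw [Finset.mem_range] at hi
    by_cases h1 : i = π.1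
    · rw [τ.2.p_homogeneous _ (by rw [List.length_drop]; omega), mul_zero]
    · rw [π.2.p_homogeneous _ (by rw [List.length_take]; omega), zero_mul]

end SetPartition

/-! ### Products of triangular elements and the free generators. -/

open SetPartition

theorem mul_mem_span_of_forall {A B C : Set NCSeries} (h : ∀ a ∈ A, ∀ b ∈ B, a * b ∈ C)
    {f g : NCSeries} (hf : f ∈ Submodule.span ℚ A) (hg : g ∈ Submodule.span ℚ B) :
    f * g ∈ Submodule.span ℚ C := by
  have h1 := Submodule.mul_mem_mul hf hg
  rw [Submodule.span_mul_span] at h1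
  refine Submodule.span_mono ?_ h1
  rintro _ ⟨a, ha, b, hb, rfl⟩
  exact h a ha b hb

/-- Multiplying out gives the leading power sums' product and products `p_ρ p_ρ'` with `ρ ≤ π`, `ρ'
≤ τ`, at least one strict. The latter are strictly below the concatenation by `concat_lt`. -/
theorem IsTriangular.mul {π τ : Graded} (hπ : π.2.IsOdd) (hτ : τ.2.IsOdd) {f g : NCSeries}
    (hf : IsTriangular π f) (hg : IsTriangular τ g) : IsTriangular (concat π τ) (f * g) := by
  obtain ⟨c, hc, f', hf', rfl⟩ := hf
  obtain ⟨d, hd, g', hg', rfl⟩ := hg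
  refine ⟨c * d, mul_ne_zero hc hd, c • (π.2.p * g') + (d • (f' * τ.2.p) + f' * g'), ?_, ?_⟩
  · have hπs : π.2.p ∈ Submodule.span ℚ {π.2.p} := Submodule.mem_span_singleton_self _
    have hτs : τ.2.p ∈ Submodule.span ℚ {τ.2.p} := Submodule.mem_span_singleton_self _
    have key : ∀ {ρ ρ' : Graded}, ρ.2.IsOdd → ρ'.2.IsOdd → ρ ≤ π → ρ' ≤ τ → (ρ < π ∨ ρ' < τ) →
        ρ.2.p * ρ'.2.p ∈ (fun τ : Graded => τ.2.p) '' {ρ | ρ.2.IsOdd ∧ ρ < concat π τ} := by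
      intro ρ ρ' h1 h2 h3 h4 h5
      exact ⟨concat ρ ρ', ⟨isOdd_concat.2 ⟨h1, h2⟩, concat_lt h3 h4 h5⟩, (p_mul_p ρ ρ').symm⟩
    refine Submodule.add_mem _ (Submodule.smul_mem _ _ (mul_mem_span_of_forall ?_ hπs hg'))
      (Submodule.add_mem _ (Submodule.smul_mem _ _ (mul_mem_span_of_forall ?_ hf' hτs))
        (mul_mem_span_of_forall ?_ hf' hg'))
    · rintro _ rfl _ ⟨ρ', ⟨h1, h2⟩, rfl⟩
      exact key hπ h1 le_rfl h2.le (Or.inr h2)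
    · rintro _ ⟨ρ, ⟨h1, h2⟩, rfl⟩ _ rfl
      exact key h1 hτ h2.le le_rfl (Or.inl h2)
    · rintro _ ⟨ρ, ⟨h1, h2⟩, rfl⟩ _ ⟨ρ', ⟨h3, h4⟩, rfl⟩
      exact key h1 h3 h2.le h4.le (Or.inl h2)
  · rw [← p_mul_p, add_mul, mul_add, mul_add, smul_mul_smul_comm, smul_mul_assoc, mul_smul_comm]
    abel

/-- A word in the generators is triangular with leading term the power sum of the concatenated
partition. As words correspond bijectively to odd partitions, they inherit spanning and independence
from the triangularity lemmas. -/
theorem freelyGenerates_of_isTriangular {x : ConnectedOddPartition → NCSeries}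
    (hx : ∀ π, IsTriangular π.1 (x π)) : FreelyGenerates x oddPowerSums := by
  have h1 : ∀ l : List ConnectedOddPartition, IsTriangular (concatList l) (l.map x).prod := by
    intro l
    induction l with
    | nil =>
      rw [List.map_nil, List.prod_nil, ← p_empty]
      exact isTriangular_p empty
    | cons π l ih =>
      rw [List.map_cons, List.prod_cons]
      exact (hx π).mul π.2.2 (isOdd_concatList l) ih
  set f : OddPartition → NCSeries := fun π => ((concatEquiv.symm π).map x).prod with hf
  have h2 : ∀ π, IsTriangular π.1 (f π) := by
    intro π
    obtain ⟨l, rfl⟩ := concatEquiv.surjective π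
    rw [hf]
    simp only [Equiv.symm_apply_apply]
    exact h1 l
  have h3 : (fun l : List ConnectedOddPartition => (l.map x).prod) = f ∘ concatEquiv := by
    funext l
    simp [hf]
  refine freelyGenerates_of_words x _ ?_ ?_
  · rw [h3]
    exact (linearIndependent_of_isTriangular h2).comp _ concatEquiv.injective
  · rw [h3, concatEquiv.surjective.range_comp]
    exact span_of_isTriangular h2

end

end NCSchurQ

theorem mainTheorem9 :
    (∀ (n : ℕ) (π : NCSchurQ.SetPartition n),
      ∃ x : NCSchurQ.NCSym, (x : NCSchurQ.NCSeries) = π.q ∧ NCSchurQ.omega x = x) ∧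
    (LinearIndependent ℚ (fun π : NCSchurQ.OddPartition => π.1.2.q) ∧
      Submodule.span ℚ (Set.range fun π : NCSchurQ.OddPartition => π.1.2.q) =
        NCSchurQ.NCOmega) ∧
    NCSchurQ.FreelyGenerates (fun π : NCSchurQ.ConnectedOddPartition => π.1.2.p)
      NCSchurQ.NCOmega ∧
    NCSchurQ.FreelyGenerates (fun π : NCSchurQ.ConnectedOddPartition => π.1.2.q)
      NCSchurQ.NCOmega := by
  refine ⟨fun n π => NCSchurQ.omega_eq_self_of_mem π.q_mem_oddPowerSums, ?_⟩
  rw [NCSchurQ.NCOmega_eq]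
  exact ⟨⟨NCSchurQ.linearIndependent_of_isTriangular fun π => NCSchurQ.isTriangular_q π.2,
      NCSchurQ.span_of_isTriangular fun π => NCSchurQ.isTriangular_q π.2⟩,
    NCSchurQ.freelyGenerates_of_isTriangular fun π => NCSchurQ.isTriangular_p π.1,
    NCSchurQ.freelyGenerates_of_isTriangular fun π => NCSchurQ.isTriangular_q π.2.2⟩
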